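/- Let $\Omega\subset\mathbb R^3$ be a bounded domain with smooth boundary $\Gamma$. All function spaces are spaces of complex-valued functions on $\Omega$; $\|\cdot\|$ and $(w_1,w_2)=\int_\Omega w_1\overline{w_2}\,dx$ are the norm and scalar product of $L^2$, $\|u\|_{H^1}^2=\|u\|^2+\|\nabla u\|^2$, $H^1_0$ is the closure of $C_c^\infty(\Omega)$ in this norm and $H^{-1}$ is its dual. Let $a,b,c,m,U,g,\gamma,\mu,\nu\in\mathbb R$ and $d=d_r+i\,d_i\in\mathbb C$ satisfy $U,b,c,m,\gamma>0$, $aU<1$ and $d_i>0$, and let $f,h\in H^1_0$ be independent of time. Consider $$\begin{cases} d\,v_t-\left(a-\tfrac1U\right)i v-\tfrac{ig}{U}\phi-\tfrac{ic}{4m}\Delta v+ib|v|^2v=f,\\ \phi_t+\gamma\phi-\tfrac{ig}{U}v+\tfrac{ig^2}{U}\phi+i(2\nu-2\mu)\phi-\tfrac{i}{4m}\Delta\phi=h,\end{cases}\qquad v|_\Gamma=\phi|_\Gamma=0,\quad v|_{t=0}=v_0,\ \phi|_{t=0}=\phi_0, \tag{P}$$ with $(v_0,\phi_0)\in H^1_0\times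 H^1_0$. A weak solution of (P) on $[0,T]$, $T>0$, is a pair $(v,\phi)$ with $v,\phi\in C([0,T],H^1_0)$, $v_t\in L^2((0,T),L^2)$, $\phi_t\in L^2((0,T),H^{-1})$ such that for all $\psi\in H^1_0$ and all complex-valued $\xi\in C^1[0,T]$ with $\xi(T)=0$ $$\int_0^T\!\Big[-d(v,\xi_t\psi)-i\left(a-\tfrac1U\right)(v,\xi\psi)-\tfrac{ig}{U}(\phi,\xi\psi)+\tfrac{ic}{4m}(\nabla v,\xi\nabla\psi)+ib(|v|^2v,\xi\psi)\Big]dt=\int_0^T(f,\xi\psi)\,dt+d\,(v_0,\xi(0)\psi),$$ $$\int_0^T\!\Big[-(\phi,\xi_t\psi)-\tfrac{ig}{U}(v,\xi\psi)+i\left(\tfrac{g^2}{U}+2\nu-2\mu\right)(\phi,\xi\psi)+\tfrac{i}{4m}(\nabla\phi,\xi\nabla\psi)+\gamma(\phi,\xi\psi)\Big]dt=\int_0^T(h,\xi\psi)\,dt+(\phi_0,\xi(0)\psi).$$ **Theorem.** 1. (Continuous dependence.) For any $(v_{01},\phi_{01}),(v_{02},\phi_{02})\in H^1_0\times H^1_0$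 and any $T>0$, if $(v_1,\phi_1)$ and $(v_2,\phi_2)$ are weak solutions of (P) on $[0,T]$ with these initial data, then for all $0\le t\le T$ $$\|v_1(t)-v_2(t)\|_{H^1}^2+\|\phi_1(t)-\phi_2(t)\|_{H^1}^2+\int_0^t\|v_{1t}(s)-v_{2t}(s)\|^2ds\le L_1e^{L_2t}\left(\|v_{01}-v_{02}\|_{H^1}^2+\|\phi_{01}-\phi_{02}\|_{H^1}^2\right),$$ where $L_1,L_2>0$ depend only on the coefficients $a,b,c,m,U,g,\gamma,\mu,\nu,d$ and on upper bounds for the volume $|\Omega|$, for $\|f\|_{H^1},\|h\|_{H^1}$ and for $\|v_{01}\|_{H^1},\|\phi_{01}\|_{H^1},\|v_{02}\|_{H^1},\|\phi_{02}\|_{H^1}$; in particular they do not depend on $T$. 2. (Uniqueness.) For any $(v_0,\phi_0)\in H^1_0\times H^1_0$ and $T>0$, two weak solutions of (P) on $[0,T]$ with initial data $(v_0,\phi_0)$ coincide on $[0,T]$. 3. (Semigroup.) There is a strongly continuous semigroup $S(t)$, $t\ge0$, on $H^1_0\times H^1_0$ such that for every $(v_0,\phi_0)\in H^1_0\times H^1_0$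 and every $T>0$, $(v(t),\phi(t))=S(t)(v_0,\phi_0)$ is a (by 2, the unique) weak solution of (P) on $[0,T]$ with initial data $(v_0,\phi_0)$. Here strongly continuous semigroup means: $S(0)=\mathrm{Id}$, $S(t+s)=S(t)S(s)$, each $S(t)$ is continuous on $H^1_0\times H^1_0$, and $t\mapsto S(t)z$ is continuous on $[0,\infty)$ for each $z$. -/

import Mathlib

open MeasureTheory Set Topology
open scoped ContDiff ComplexConjugate NNReal InnerProductSpace

noncomputable section

namespace BCSBEC

/-- The ambient space `ℝ³`. -/
abbrev E3 : Type := EuclideanSpace ℝ (Fin 3)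

/-- A bounded domain (open, connected, nonempty) of `ℝ³` with smooth boundary: near every boundary
point the domain is the sublevel set `{ρ < 0}` of a smooth function `ρ` with nonzero gradient. -/
structure IsSmoothBoundedDomain (Ω : Set E3) : Prop where
  isOpen : IsOpen Ω
  isConnected : IsConnected Ω
  isBounded : Bornology.IsBounded Ω
  smooth_boundary : ∀ x ∈ frontier Ω, ∃ W ∈ 𝓝 x, ∃ ρ : E3 → ℝ,
    ContDiff ℝ ∞ ρ ∧ fderiv ℝ ρ x ≠ 0 ∧ Ω ∩ W = {y | ρ y < 0} ∩ W

/-! ### Function spaces -/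

/-- `L²(Ω; ℂ)`. -/
abbrev L2 (Ω : Set E3) : Type := Lp ℂ 2 (volume.restrict Ω)

/-- `L²(Ω; ℂ³)`, where the gradients live. -/
abbrev L2Vec (Ω : Set E3) : Type := Lp (EuclideanSpace ℂ (Fin 3)) 2 (volume.restrict Ω)

/-- The Hilbert space of pairs `(u, G)`, with `‖(u, G)‖² = ‖u‖² + ‖G‖²`. -/
abbrev Pair (Ω : Set E3) : Type := WithLp 2 (L2 Ω × L2Vec Ω)

/-- Complex-valued smooth functions with compact support contained in `Ω`. -/
structure IsTestFunction (Ω : Set E3) (θ : E3 → ℂ) : Prop where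
  contDiff : ContDiff ℝ ∞ θ
  hasCompactSupport : HasCompactSupport θ
  tsupport_subset : tsupport θ ⊆ Ω

/-- The classical gradient `(∂₁θ, ∂₂θ, ∂₃θ)` of a complex-valued function on `ℝ³`. -/
def grad (θ : E3 → ℂ) (x : E3) : EuclideanSpace ℂ (Fin 3) :=
  WithLp.toLp 2 fun j => fderiv ℝ θ x (EuclideanSpace.single j 1)

/-- The subspace `{(θ, ∇θ) : θ ∈ C_c^∞(Ω; ℂ)}` of `L²(Ω; ℂ) × L²(Ω; ℂ³)`. -/
def testGraph (Ω : Set E3) : Submodule ℂ (Pair Ω) where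
  carrier := {p | ∃ θ : E3 → ℂ, IsTestFunction Ω θ ∧
    p.fst =ᵐ[volume.restrict Ω] θ ∧ p.snd =ᵐ[volume.restrict Ω] grad θ}
  zero_mem' := by
    refine ⟨0, ⟨contDiff_const, HasCompactSupport.zero, by simp [tsupport]⟩, ?_, ?_⟩
    · exact Lp.coeFn_zero _ _ _
    · refine (Lp.coeFn_zero _ _ _).trans (Filter.Eventually.of_forall fun x => ?_)
      ext j
      simp [grad]
  add_mem' := by
    rintro p q ⟨θ, hθ, h1, h2⟩ ⟨η, hη, h3, h4⟩
    refine ⟨θ + η, ⟨hθ.contDiff.add hη.contDiff, hθ.hasCompactSupport.add hη.hasCompactSupport,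
      (tsupport_add θ η).trans (union_subset hθ.tsupport_subset hη.tsupport_subset)⟩, ?_, ?_⟩
    · filter_upwards [Lp.coeFn_add p.fst q.fst, h1, h3] with x hx hx1 hx3
      rw [WithLp.add_fst, hx, Pi.add_apply, hx1, hx3, Pi.add_apply]
    · filter_upwards [Lp.coeFn_add p.snd q.snd, h2, h4] with x hx hx2 hx4
      rw [WithLp.add_snd, hx, Pi.add_apply, hx2, hx4]
      ext j
      have e1 := (hθ.contDiff.differentiable (by simp)) x
      have e2 := (hη.contDiff.differentiable (by simp)) x
      simp [grad, fderiv_add e1 e2]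
  smul_mem' := by
    rintro k p ⟨θ, hθ, h1, h2⟩
    refine ⟨k • θ, ⟨hθ.contDiff.const_smul k, hθ.hasCompactSupport.smul_left (f := fun _ => k),
      (closure_mono (Function.support_const_smul_subset k θ)).trans hθ.tsupport_subset⟩, ?_, ?_⟩
    · filter_upwards [Lp.coeFn_smul k p.fst, h1] with x hx hx1
      rw [WithLp.smul_fst, hx, Pi.smul_apply, hx1, Pi.smul_apply]
    · filter_upwards [Lp.coeFn_smul k p.snd, h2] with x hx hx2
      rw [WithLp.smul_snd, hx, Pi.smul_apply, hx2]
      ext j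
      have e1 := (hθ.contDiff.differentiable (by simp)) x
      simp [grad, fderiv_const_smul e1 k]

/-- The complex Sobolev space `H¹₀(Ω)`, i.e. the closure of `C_c^∞(Ω; ℂ)` in the `H¹`-norm
`‖u‖²_{H¹} = ‖u‖² + ‖∇u‖²`. An element is stored as the pair `(u, ∇u)` of the function and its weak
gradient (which is determined by `u`). -/
def H10 (Ω : Set E3) : Submodule ℂ (Pair Ω) := (testGraph Ω).topologicalClosure

/-- The embedding `H¹₀(Ω) → L²(Ω)`, `u ↦ u`. -/
def toL2 (Ω : Set E3) : H10 Ω →L[ℂ] L2 Ω :=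
  (WithLp.fstL 2 ℂ (L2 Ω) (L2Vec Ω)).comp (H10 Ω).subtypeL

/-- The gradient `H¹₀(Ω) → L²(Ω; ℂ³)`, `u ↦ ∇u`. -/
def gradL (Ω : Set E3) : H10 Ω →L[ℂ] L2Vec Ω :=
  (WithLp.sndL 2 ℂ (L2 Ω) (L2Vec Ω)).comp (H10 Ω).subtypeL

/-- `H⁻¹(Ω)`, the dual of `H¹₀(Ω)`, realized as the bounded antilinear functionals, so that `L²(Ω)`
embeds into it complex-linearly. -/
abbrev HNeg1 (Ω : Set E3) : Type := H10 Ω →L⋆[ℂ] ℂ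

/-- The embedding `H¹₀(Ω) → H⁻¹(Ω)` through `L²(Ω)`: `u` acts as `ψ ↦ ∫_Ω u ψ̄ dx`. -/
def toHNeg1 (Ω : Set E3) (u : H10 Ω) : HNeg1 Ω :=
  (innerSLFlip ℂ (toL2 Ω u)).comp (toL2 Ω)

/-- The `L²` scalar product `(u, ψ) = ∫_Ω u ψ̄ dx`. (Mathlib's inner product is conjugate linear in
its first argument.) -/
def pairing {Ω : Set E3} (u ψ : H10 Ω) : ℂ := ⟪toL2 Ω ψ, toL2 Ω u⟫_ℂ

/-- `(∇u, ∇ψ) = ∫_Ω ∇u · conj(∇ψ) dx`. -/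
def gradPairing {Ω : Set E3} (u ψ : H10 Ω) : ℂ := ⟪gradL Ω ψ, gradL Ω u⟫_ℂ

/-- `(|u|²u, ψ) = ∫_Ω |u|² u ψ̄ dx`. -/
def cubicPairing {Ω : Set E3} (u ψ : H10 Ω) : ℂ :=
  ∫ x in Ω, ((‖toL2 Ω u x‖ ^ 2 : ℝ) : ℂ) * toL2 Ω u x * conj (toL2 Ω ψ x)

/-- `w ∈ L²((0,T), X)` is the distributional time derivative on `(0,T)` of `u : [0,T] → X`. -/
structure HasL2TimeDeriv {X : Type*} [NormedAddCommGroup X] [NormedSpace ℝ X]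
    (T : ℝ) (u w : ℝ → X) : Prop where
  memLp : MemLp w 2 (volume.restrict (Ioo 0 T))
  integral_eq : ∀ η : ℝ → ℝ, ContDiff ℝ ∞ η → HasCompactSupport η → tsupport η ⊆ Ioo 0 T →
    ∫ t in Ioo 0 T, deriv η t • u t = - ∫ t in Ioo 0 T, η t • w t

/-! ### The coupled Ginzburg-Landau system -/

/-- The coefficients of the system. -/
structure Coeffs where
  (a b c m U g γ μ ν : ℝ)
  d : ℂ

/-- The standing assumptions on the coefficients. -/
structure Coeffs.Admissible (p : Coeffs) : Prop where
  U_pos : 0 < p.U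
  b_pos : 0 < p.b
  c_pos : 0 < p.c
  m_pos : 0 < p.m
  aU_lt_one : p.a * p.U < 1
  γ_pos : 0 < p.γ
  d_im_pos : 0 < p.d.im

/-- `(v, φ)` is a weak solution on `[0,T]`, with initial data `(v₀, φ₀)`, of
`d v_t - (a - 1/U) i v - (i g/U) φ - (i c/4m) Δv + i b |v|² v = f`,
`φ_t + γ φ - (i g/U) v + (i g²/U) φ + i (2ν - 2μ) φ - (i/4m) Δφ = h`,
`v = φ = 0` on the boundary. Only the values of `v`, `φ` on `[0,T]` matter. The test functions are
`ξ(t) ψ(x)` with `ψ ∈ H¹₀(Ω)` and `ξ` of class `C¹`, `ξ(T) = 0`. -/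
structure IsWeakSolution (p : Coeffs) {Ω : Set E3} (f h : H10 Ω) (T : ℝ) (v₀ φ₀ : H10 Ω)
    (v φ : ℝ → H10 Ω) : Prop where
  continuousOn_v : ContinuousOn v (Icc 0 T)
  continuousOn_φ : ContinuousOn φ (Icc 0 T)
  deriv_v : ∃ w : ℝ → L2 Ω, HasL2TimeDeriv T (fun t => toL2 Ω (v t)) w
  deriv_φ : ∃ w : ℝ → HNeg1 Ω, HasL2TimeDeriv T (fun t => toHNeg1 Ω (φ t)) w
  eq_v : ∀ (ψ : H10 Ω) (ξ : ℝ → ℂ), ContDiff ℝ 1 ξ → ξ T = 0 →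
    ∫ t in (0 : ℝ)..T,
      (-p.d * pairing (v t) (deriv ξ t • ψ)
        - Complex.I * (p.a - 1 / p.U) * pairing (v t) (ξ t • ψ)
        - Complex.I * p.g / p.U * pairing (φ t) (ξ t • ψ)
        + Complex.I * p.c / (4 * p.m) * gradPairing (v t) (ξ t • ψ)
        + Complex.I * p.b * cubicPairing (v t) (ξ t • ψ))
    = (∫ t in (0 : ℝ)..T, pairing f (ξ t • ψ)) + p.d * pairing v₀ (ξ 0 • ψ)
  eq_φ : ∀ (ψ : H10 Ω) (ξ : ℝ → ℂ), ContDiff ℝ 1 ξ → ξ T = 0 →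
    ∫ t in (0 : ℝ)..T,
      (-pairing (φ t) (deriv ξ t • ψ)
        - Complex.I * p.g / p.U * pairing (v t) (ξ t • ψ)
        + Complex.I * (p.g ^ 2 / p.U + 2 * p.ν - 2 * p.μ) * pairing (φ t) (ξ t • ψ)
        + Complex.I / (4 * p.m) * gradPairing (φ t) (ξ t • ψ)
        + p.γ * pairing (φ t) (ξ t • ψ))
    = (∫ t in (0 : ℝ)..T, pairing h (ξ t • ψ)) + pairing φ₀ (ξ 0 • ψ)

/-- A strongly continuous (nonlinear) semigroup on a topological space `X`. -/
structure IsStronglyContinuousSemigroup {X : Type*} [TopologicalSpace X]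
    (S : ℝ≥0 → X → X) : Prop where
  map_zero : ∀ z, S 0 z = z
  map_add : ∀ s t z, S (s + t) z = S s (S t z)
  continuous_time : ∀ z, Continuous fun t => S t z
  continuous_state : ∀ t, Continuous (S t)

end BCSBEC

end

/-!
The idea is to read both equations as linear evolution equations for the Dirichlet Laplacian, with
the coupling and the cubic term on the right-hand side. Let `J : H¹₀ → L²` be the embedding. Because
of the choice of the norm of `H¹₀`, the Gram operator `B = J† J` is the inverse of `1 - Δ`, and
testing with all `ξ(t) ψ` amounts to the integrated equation `B y(t) = B y(0) + ∫ (J† F - θ y)` in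
`H¹₀` (`integral_test_iff`, `tested_iff_isMildSolution`). All of the analysis concerns this equation
for an abstract injective operator `J` between Hilbert spaces, with dense range and norm at most
one.

* The first equation has `θ = i c / (4 m d)`, and `Re θ⁻¹ > 0` because `d` has positive imaginary
  part. It is parabolic: testing with the time derivative bounds `y` in `H¹₀` and `y_t` in `L²` by
  the force in `L²` (`SolvesLinear.norm_sq_add_integral_le`).
* The second equation has imaginary `θ`. It is dispersive and regularizes nothing, but its force is
  affine in `H¹₀`, where the linear evolution is isometric
  (`SolvesLinear.norm_sq_le_of_re_eq_zero`).

These computations need more regularity in time than solutions have. They are made rigorous by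
operators `Q = f(B)` that cut off the part of the spectrum of `B` near zero and converge strongly to
the identity (`exists_isCutoff_tendsto`); after such a cutoff a solution is continuously
differentiable in time. The same cutoffs yield solutions of the linear equations.

The cubic term enters through the properties collected in `IsCubic`: by the Sobolev inequality
`H¹₀ → L⁶` it is locally Lipschitz from `H¹₀` to `L²`, with a constant that does not depend on the
domain, and it is the gradient of a convex quartic potential (`isCubic_cubic`). On bounded sets the
two linear estimates and Gronwall's inequality give Lipschitz dependence on the data
(`IsMildSolution.norm_sub_sq_le`).

For the rate not to depend on the length of the time interval, `v` has to be bounded in `H¹₀`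
uniformly in time. The Lyapunov functional `κ/2 ‖∇v‖² + (1/U - a)/2 ‖v‖² + b/4 ∫ |v|⁴ + M ‖φ‖²`,
with `κ = c / (4 m)` and a suitable weight `M`, decays up to a constant (`dissipation_le`): the first
equation is tested with `v_t`, where `d_i > 0` controls `‖v_t‖²`, and with `v`; the second one is
tested with `φ`, where `γ > 0` is the damping; the terms `‖v‖²` that remain are absorbed by the
quartic potential, at the price of a multiple of the volume. Hence `IsMildSolution.norm_v_sq_le`. No
bound on `φ` in `H¹₀` is needed, since the second equation is linear. The two facts combine to
`IsMildSolution.dependence`, and uniqueness is a special case.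

For existence the cubic term is composed with the retraction onto a ball, which makes it globally
Lipschitz, and the system is solved by a Volterra fixed point argument
(`exists_fixedPoint_of_integral_le`). If the ball is larger than the a priori bound, the solution
never leaves it (`exists_isMildSolution`). The semigroup property follows from uniqueness and the
continuity of `S(t)` from the dependence estimate (`exists_semigroup`).
-/

namespace BCSBEC

noncomputable section Abstract

open ContinuousLinearMap Filter

variable {H L : Type*} [NormedAddCommGroup H] [InnerProductSpace ℂ H] [CompleteSpace H]
  [NormedAddCommGroup L] [InnerProductSpace ℂ L] [CompleteSpace L]

/-! ### Spectral cutoffs -/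

/-- The Gram operator `B = J† J` of a bounded operator `J : H → L`. For the embedding
`J : H¹₀ → L²` it is the inverse of `1 - Δ` with Dirichlet boundary conditions. -/
def gram (J : H →L[ℂ] L) : H →L[ℂ] H := adjoint J ∘L J

lemma gram_apply (J : H →L[ℂ] L) (x : H) : gram J x = adjoint J (J x) := rfl

lemma inner_gram (J : H →L[ℂ] L) (x y : H) : ⟪x, gram J y⟫_ℂ = ⟪J x, J y⟫_ℂ := by
  rw [gram_apply, adjoint_inner_right]

lemma gram_isPositive (J : H →L[ℂ] L) : (gram J).IsPositive :=
  isPositive_adjoint_comp_self J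

/-- A cutoff to the part of the spectrum where the Gram operator `B` is boundedly invertible: `Q`
plays the role of the spectral projection, and `A` inverts `B` on the range of `Q`. -/
structure IsCutoff (J : H →L[ℂ] L) (Q A : H →L[ℂ] H) : Prop where
  gram_inv : ∀ x, gram J (A (Q x)) = Q x
  comm : ∀ x, A (Q x) = Q (A x)
  gram_Q : ∀ x, gram J (Q x) = Q (gram J x)
  gram_A : ∀ x, gram J (A x) = A (gram J x)
  symm_Q : ∀ x y, ⟪Q x, y⟫_ℂ = ⟪x, Q y⟫_ℂ
  symm_A : ∀ x y, ⟪A x, y⟫_ℂ = ⟪x, A y⟫_ℂ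
  norm_le : ∀ x, ‖Q x‖ ≤ ‖x‖
  norm_J_le : ∀ x, ‖J (Q x)‖ ≤ ‖J x‖

lemma continuous_cutoffFun (c : ℝ) : Continuous fun x : ℝ => min 1 (max 0 (c * x - 1)) := by
  fun_prop

lemma cutoffFun_nonneg (c x : ℝ) : 0 ≤ min 1 (max 0 (c * x - 1)) :=
  le_min zero_le_one (le_max_left _ _)

/-- The cutoff at spectral height `1 / c`, by the continuous functional calculus of the self-adjoint
operator `B`. A continuous cutoff function suffices; no spectral projection is needed. -/
lemma exists_isCutoff_norm_sub_le (J : H →L[ℂ] L) {c : ℝ} (hc : 0 < c) :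
    ∃ Q A : H →L[ℂ] H, IsCutoff J Q A ∧ ∀ x, ‖Q (gram J x) - gram J x‖ ≤ 2 / c * ‖x‖ := by
  set B := gram J with hB
  have hpos : B.IsPositive := gram_isPositive J
  have hsa : IsSelfAdjoint B := hpos.isSelfAdjoint
  have hspec : ∀ x ∈ spectrum ℝ B, 0 ≤ x := by
    have : 0 ≤ B := (ContinuousLinearMap.nonneg_iff_isPositive B).2 hpos
    exact fun x hx => spectrum_nonneg_of_nonneg this hx
  -- `f` is the cutoff function, zero below `1 / c` and one above `2 / c`. Since `g x = 1 / x` on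
  -- the support of `f`, the operator `A = g(B)` inverts `B` on the range of `Q = f(B)`.
  let f : ℝ → ℝ := fun x => min 1 (max 0 (c * x - 1))
  let g : ℝ → ℝ := fun x => (max x (1 / c))⁻¹
  have hf0 : ∀ x, 0 ≤ f x := cutoffFun_nonneg c
  have hf1 : ∀ x, f x ≤ 1 := fun x => min_le_left _ _
  have hf : Continuous f := continuous_cutoffFun c
  have hg : Continuous g := by
    refine (continuous_id.max continuous_const).inv₀ fun x => ?_
    have : 0 < max x (1 / c) := lt_of_lt_of_le (by positivity) (le_max_right _ _)
    exact this.ne'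
  have hfg : ∀ x, x * (g x * f x) = f x := by
    intro x
    rcases le_or_gt (c * x) 1 with h | h
    · have : f x = 0 := by
        simp only [f]
        rw [max_eq_left (by linarith), min_eq_right zero_le_one]
      rw [this]; simp
    · have hx : 1 / c < x := by rw [div_lt_iff₀ hc]; linarith
      have hx0 : 0 < x := lt_trans (by positivity) hx
      simp only [g]
      rw [max_eq_left hx.le]
      field_simp
  have hcf : ContinuousOn f (spectrum ℝ B) := hf.continuousOn
  have hcg : ContinuousOn g (spectrum ℝ B) := hg.continuousOn
  let Q := cfc f B
  let A := cfc g B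
  have hQA : Commute A Q := cfc_commute_cfc g f B
  have hBid : cfc (fun x : ℝ => x) B = B := cfc_id' ℝ B
  have hQB : Commute B Q := by
    have := cfc_commute_cfc (fun x : ℝ => x) f B
    rwa [hBid] at this
  have hAB : Commute B A := by
    have := cfc_commute_cfc (fun x : ℝ => x) g B
    rwa [hBid] at this
  have hQs : IsSelfAdjoint Q := cfc_predicate f B
  have hAs : IsSelfAdjoint A := cfc_predicate g B
  have hinv : B * (A * Q) = Q := by
    have h1 : A * Q = cfc (fun x => g x * f x) B := (cfc_mul g f B hcg hcf).symm
    have h2 : B * cfc (fun x => g x * f x) B = cfc (fun x => x * (g x * f x)) B := by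
      rw [cfc_mul (fun x => x) (fun x => g x * f x) B continuousOn_id (hcg.mul hcf), hBid]
    rw [h1, h2]
    exact congrArg (fun k => cfc k B) (funext hfg)
  have hsymm : ∀ S : H →L[ℂ] H, IsSelfAdjoint S → ∀ x y, ⟪S x, y⟫_ℂ = ⟪x, S y⟫_ℂ := by
    intro S hS x y
    have := hS.adjoint_eq
    rw [← adjoint_inner_right, this]
  have hQn : ‖Q‖ ≤ 1 := norm_cfc_le zero_le_one fun x _ => by
    rw [Real.norm_of_nonneg (hf0 x)]; exact hf1 x
  have hJ : ∀ x, ‖J (Q x)‖ ≤ ‖J x‖ := by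
    intro x
    -- `J† J - Q J† J Q = (x (1 - f²))(B)` is positive.
    have h1 : 0 ≤ cfc (fun x : ℝ => x - f x * (x * f x)) B := by
      refine cfc_nonneg fun x hx => ?_
      have h0 := hspec x hx
      nlinarith [hf0 x, hf1 x, mul_nonneg h0 (hf0 x), mul_nonneg h0 (sub_nonneg.2 (hf1 x)),
        mul_nonneg (mul_nonneg h0 (hf0 x)) (sub_nonneg.2 (hf1 x))]
    have h2 : cfc (fun x : ℝ => x - f x * (x * f x)) B = B - Q * (B * Q) := by
      rw [cfc_sub (fun x : ℝ => x) (fun x => f x * (x * f x)) B continuousOn_id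
        (hcf.mul (continuousOn_id.mul hcf)), hBid,
        cfc_mul f (fun x => x * f x) B hcf (continuousOn_id.mul hcf),
        cfc_mul (fun x : ℝ => x) f B continuousOn_id hcf, hBid]
    rw [h2, ContinuousLinearMap.nonneg_iff_isPositive] at h1
    have h3 := h1.re_inner_nonneg_right x
    have h4 : ⟪x, (B - Q * (B * Q)) x⟫_ℂ = ⟪J x, J x⟫_ℂ - ⟪J (Q x), J (Q x)⟫_ℂ := by
      rw [← inner_gram, ← inner_gram, hsymm Q hQs, ← inner_sub_right]
      rfl
    rw [h4, map_sub, inner_self_eq_norm_sq, inner_self_eq_norm_sq] at h3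
    exact abs_le_of_sq_le_sq' (by linarith) (norm_nonneg _) |>.2
  refine ⟨Q, A, ⟨fun x => DFunLike.congr_fun hinv x, fun x => DFunLike.congr_fun hQA.eq x,
    fun x => DFunLike.congr_fun hQB.eq x, fun x => DFunLike.congr_fun hAB.eq x, hsymm Q hQs,
    hsymm A hAs, fun x => ?_, hJ⟩, fun x => ?_⟩
  · simpa using Q.le_of_opNorm_le hQn x
  -- `x (1 - f x)` vanishes for `x > 2 / c`.
  · have h1 : ‖cfc (fun x : ℝ => f x * x - x) B‖ ≤ 2 / c := by
      refine norm_cfc_le (by positivity) fun x hx => ?_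
      have h0 := hspec x hx
      rw [Real.norm_eq_abs, abs_le]
      rcases le_or_gt (c * x) 2 with h | h
      · have hx : x ≤ 2 / c := by rw [le_div_iff₀ hc]; linarith
        constructor
        · nlinarith [hf0 x, hf1 x, mul_nonneg h0 (hf0 x)]
        · have : 0 ≤ 2 / c := by positivity
          nlinarith [hf0 x, hf1 x]
      · have : f x = 1 := by
          simp only [f]
          rw [max_eq_right (by linarith), min_eq_left (by linarith)]
        rw [this]
        have : 0 ≤ 2 / c := by positivity
        constructor <;> linarith
    have h2 : cfc (fun x : ℝ => f x * x - x) B = Q * B - B := by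
      rw [cfc_sub (fun x : ℝ => f x * x) (fun x => x) B (hcf.mul continuousOn_id) continuousOn_id,
        cfc_mul f (fun x : ℝ => x) B hcf continuousOn_id, hBid]
    rw [h2] at h1
    exact (Q * B - B).le_of_opNorm_le h1 x

/-- Contractions that converge to the identity on a dense range converge strongly everywhere. -/
lemma tendsto_apply_of_dense_range {E F : Type*} [NormedAddCommGroup E] [NormedSpace ℂ E]
    [NormedAddCommGroup F] [NormedSpace ℂ F] {S : ℕ → F →L[ℂ] F} {T : E →L[ℂ] F}
    (hT : DenseRange T) (hS : ∀ n x, ‖S n x‖ ≤ ‖x‖)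
    (h : ∀ x, Tendsto (fun n => S n (T x)) atTop (𝓝 (T x))) (y : F) :
    Tendsto (fun n => S n y) atTop (𝓝 y) := by
  rw [Metric.tendsto_atTop]
  intro ε hε
  obtain ⟨x, hx⟩ := hT.exists_dist_lt y (show 0 < ε / 3 by positivity)
  obtain ⟨N, hN⟩ := Metric.tendsto_atTop.1 (h x) (ε / 3) (by positivity)
  refine ⟨N, fun n hn => ?_⟩
  have h1 : dist (S n y) (S n (T x)) ≤ dist y (T x) := by
    rw [dist_eq_norm, dist_eq_norm, ← map_sub]
    exact hS n _
  have h2 := dist_triangle4 (S n y) (S n (T x)) (T x) y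
  rw [dist_comm (T x) y] at h2
  linarith [hN n hn]

/-- The Gram operator of an injective operator is self-adjoint and injective, hence has dense
range. -/
lemma denseRange_gram {J : H →L[ℂ] L} (hJ : Function.Injective J) : DenseRange (gram J) := by
  have hsa : IsSelfAdjoint (gram J) := (gram_isPositive J).isSelfAdjoint
  have h1 : (LinearMap.range (gram J : H →ₗ[ℂ] H))ᗮ = ⊥ := by
    rw [Submodule.eq_bot_iff]
    intro x hx
    have h2 := hx (gram J x) ⟨x, rfl⟩
    have h3 : ⟪x, gram J (gram J x)⟫_ℂ = 0 := by
      rw [← adjoint_inner_left, hsa.adjoint_eq]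
      rw [Submodule.mem_orthogonal] at hx
      have := hx (gram J (gram J x)) ⟨gram J x, rfl⟩
      rw [← adjoint_inner_right, hsa.adjoint_eq] at this
      exact this
    rw [← adjoint_inner_left, hsa.adjoint_eq, inner_self_eq_zero] at h3
    have h4 : ⟪x, gram J x⟫_ℂ = 0 := by rw [h3, inner_zero_right]
    rw [inner_gram, inner_self_eq_zero] at h4
    exact hJ (by rw [h4, map_zero])
  have h5 := (Submodule.topologicalClosure_eq_top_iff).2 h1
  have h6 : Dense ((LinearMap.range (gram J : H →ₗ[ℂ] H) : Submodule ℂ H) : Set H) :=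
    Submodule.dense_iff_topologicalClosure_eq_top.2 h5
  exact h6

/-- If `J` is injective, there are spectral cutoffs converging strongly to the identity. -/
lemma exists_isCutoff_tendsto {J : H →L[ℂ] L} (hJ : Function.Injective J) :
    ∃ Q A : ℕ → H →L[ℂ] H, (∀ n, IsCutoff J (Q n) (A n)) ∧
      ∀ x, Tendsto (fun n => Q n x) atTop (𝓝 x) := by
  choose Q A hQA hlim using fun n : ℕ =>
    exists_isCutoff_norm_sub_le J (show (0 : ℝ) < (n : ℝ) + 1 by positivity)
  refine ⟨Q, A, hQA, fun x => tendsto_apply_of_dense_range (denseRange_gram hJ)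
    (fun n x => (hQA n).norm_le x) (fun x => ?_) x⟩
  rw [tendsto_iff_norm_sub_tendsto_zero]
  refine squeeze_zero (fun _ => norm_nonneg _) (fun n => hlim n x) ?_
  have : Tendsto (fun n : ℕ => 2 * ‖x‖ * (1 / ((n : ℝ) + 1))) atTop (𝓝 (2 * ‖x‖ * 0)) :=
    tendsto_one_div_add_atTop_nhds_zero_nat.const_mul _
  rw [mul_zero] at this
  refine this.congr fun n => by ring

/-- The cutoff on `L` induced by a cutoff `(Q, A)` on `H`: the operator `J A Q J†`. -/
def cutoffL (J : H →L[ℂ] L) (Q A : H →L[ℂ] H) : L →L[ℂ] L := J ∘L A ∘L Q ∘L adjoint J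

lemma cutoffL_apply (J : H →L[ℂ] L) (Q A : H →L[ℂ] H) (x : L) :
    cutoffL J Q A x = J (A (Q (adjoint J x))) := rfl

namespace IsCutoff

variable {J : H →L[ℂ] L} {Q A : H →L[ℂ] H}

lemma adjoint_cutoffL (h : IsCutoff J Q A) (x : L) :
    adjoint J (cutoffL J Q A x) = Q (adjoint J x) := h.gram_inv _

lemma cutoffL_J (h : IsCutoff J Q A) (x : H) : cutoffL J Q A (J x) = J (Q x) := by
  rw [cutoffL_apply, ← gram_apply, ← h.gram_Q, ← h.gram_A, h.gram_inv]

lemma norm_cutoffL_le (h : IsCutoff J Q A) (x : L) : ‖cutoffL J Q A x‖ ≤ ‖x‖ := by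
  set y := A (Q (adjoint J x)) with hy
  have h1 : ⟪J y, J y⟫_ℂ = ⟪x, J (Q y)⟫_ℂ := by
    rw [← adjoint_inner_left, ← gram_apply, hy, h.gram_inv, h.symm_Q, adjoint_inner_left]
  have h2 : ‖J y‖ ^ 2 ≤ ‖x‖ * ‖J y‖ := by
    calc ‖J y‖ ^ 2 = ‖⟪J y, J y⟫_ℂ‖ := by rw [inner_self_eq_norm_sq_to_K]; simp
      _ ≤ ‖x‖ * ‖J (Q y)‖ := by rw [h1]; exact norm_inner_le_norm _ _
      _ ≤ ‖x‖ * ‖J y‖ := by gcongr; exact h.norm_J_le y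
  change ‖J y‖ ≤ ‖x‖
  rcases (norm_nonneg (J y)).eq_or_lt with h0 | h0
  · rw [← h0]; exact norm_nonneg _
  · nlinarith

end IsCutoff

lemma tendsto_cutoffL {J : H →L[ℂ] L} (hJ : DenseRange J) {Q A : ℕ → H →L[ℂ] H}
    (h : ∀ n, IsCutoff J (Q n) (A n)) (hQ : ∀ x, Tendsto (fun n => Q n x) atTop (𝓝 x)) (x : L) :
    Tendsto (fun n => cutoffL J (Q n) (A n) x) atTop (𝓝 x) := by
  refine tendsto_apply_of_dense_range hJ (fun n y => (h n).norm_cutoffL_le y) (fun y => ?_) x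
  simp_rw [fun n => (h n).cutoffL_J y]
  exact (J.continuous.tendsto y).comp (hQ y)

end Abstract

noncomputable section TimeDerivatives

open Filter

variable {X Y : Type*} [NormedAddCommGroup X] [NormedSpace ℝ X]
  [NormedAddCommGroup Y] [NormedSpace ℝ Y]

/-! ### Calculus on a time interval -/

lemma integral_eq_sub_of_hasDerivWithinAt [CompleteSpace X] {T t : ℝ} {f f' : ℝ → X}
    (ht : t ∈ Icc 0 T) (hf : ∀ s ∈ Icc 0 T, HasDerivWithinAt f (f' s) (Icc 0 T) s)
    (hf' : Continuous f') :
    ∫ s in (0 : ℝ)..t, f' s = f t - f 0 := by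
  have hsub : Icc 0 t ⊆ Icc 0 T := Icc_subset_Icc_right ht.2
  refine intervalIntegral.integral_eq_sub_of_hasDerivAt_of_le ht.1
    (fun s hs => (hf s (hsub hs)).continuousWithinAt.mono hsub) (fun s hs => ?_)
    (hf'.intervalIntegrable _ _)
  exact (hf s (hsub (Ioo_subset_Icc_self hs))).hasDerivAt
    (mem_of_superset (Ioo_mem_nhds hs.1 hs.2) (Ioo_subset_Icc_self.trans hsub))

lemma memLp_restrict_Ioo_of_continuous {Z : Type*} [NormedAddCommGroup Z] {w : ℝ → Z}
    (hw : Continuous w) (T : ℝ) :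
    MemLp w 2 (volume.restrict (Ioo 0 T)) := by
  obtain ⟨C, hC⟩ := (isCompact_Icc (a := (0 : ℝ)) (b := T)).exists_bound_of_continuousOn
    hw.continuousOn
  refine MemLp.of_bound hw.aestronglyMeasurable C ?_
  filter_upwards [ae_restrict_mem measurableSet_Ioo] with t ht using hC t (Ioo_subset_Icc_self ht)

lemma setIntegral_Ioo_eq {T : ℝ} (hT : 0 ≤ T) (g : ℝ → X) :
    ∫ t in Ioo 0 T, g t = ∫ t in (0 : ℝ)..T, g t := by
  rw [intervalIntegral.integral_of_le hT, integral_Ioc_eq_integral_Ioo]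

/-- A classical derivative is a distributional one. -/
lemma HasL2TimeDeriv.of_hasDerivWithinAt [CompleteSpace X] {T : ℝ} {u w : ℝ → X} (hw : Continuous w)
    (hd : ∀ t ∈ Icc 0 T, HasDerivWithinAt u (w t) (Icc 0 T) t) : HasL2TimeDeriv T u w := by
  refine ⟨memLp_restrict_Ioo_of_continuous hw T, fun η hη _ hsupp => ?_⟩
  rcases lt_or_ge T 0 with hT | hT
  · simp [Ioo_eq_empty_of_le hT.le]
  have hη0 : η 0 = 0 := image_eq_zero_of_notMem_tsupport fun h => lt_irrefl _ (hsupp h).1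
  have hηT : η T = 0 := image_eq_zero_of_notMem_tsupport fun h => lt_irrefl _ (hsupp h).2
  have hu : ContinuousOn u (Icc 0 T) := fun t ht => (hd t ht).continuousWithinAt
  have hη1 : Differentiable ℝ η := hη.differentiable (by simp)
  have hη2 : Continuous (deriv η) := hη.continuous_deriv (by simp)
  have h1 : ∫ t in (0 : ℝ)..T, (η t • w t + deriv η t • u t) = η T • u T - η 0 • u 0 := by
    refine intervalIntegral.integral_eq_sub_of_hasDerivAt_of_le (f := fun t => η t • u t) hT
      (hη.continuous.continuousOn.smul hu) (fun t ht => ?_) ?_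
    · have := (hd t (Ioo_subset_Icc_self ht)).hasDerivAt (Icc_mem_nhds ht.1 ht.2)
      exact (hη1 t).hasDerivAt.smul this
    · refine ContinuousOn.intervalIntegrable ?_
      rw [uIcc_of_le hT]
      exact (hη.continuous.smul hw).continuousOn.add (hη2.continuousOn.smul hu)
  rw [intervalIntegral.integral_add, hη0, hηT] at h1
  · rw [setIntegral_Ioo_eq hT, setIntegral_Ioo_eq hT, eq_neg_iff_add_eq_zero, add_comm, h1]
    simp
  · exact (hη.continuous.smul hw).intervalIntegrable _ _
  · refine ContinuousOn.intervalIntegrable ?_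
    rw [uIcc_of_le hT]
    exact hη2.continuousOn.smul hu

lemma HasL2TimeDeriv.integrable_smul {T : ℝ} {w : ℝ → X}
    (hw : MemLp w 2 (volume.restrict (Ioo 0 T))) {η : ℝ → ℝ} (hη : Continuous η) :
    Integrable (fun t => η t • w t) (volume.restrict (Ioo 0 T)) := by
  have h1 : Integrable w (volume.restrict (Ioo 0 T)) := hw.integrable (by norm_num)
  obtain ⟨C, hC⟩ := (isCompact_Icc (a := (0 : ℝ)) (b := T)).exists_bound_of_continuousOn
    hη.continuousOn
  refine h1.bdd_smul C hη.aestronglyMeasurable ?_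
  filter_upwards [ae_restrict_mem measurableSet_Ioo] with t ht using hC t (Ioo_subset_Icc_self ht)

lemma HasL2TimeDeriv.sub {T : ℝ} {u₁ u₂ w₁ w₂ : ℝ → X} (hu₁ : ContinuousOn u₁ (Icc 0 T))
    (hu₂ : ContinuousOn u₂ (Icc 0 T)) (h₁ : HasL2TimeDeriv T u₁ w₁) (h₂ : HasL2TimeDeriv T u₂ w₂) :
    HasL2TimeDeriv T (fun t => u₁ t - u₂ t) (fun t => w₁ t - w₂ t) := by
  refine ⟨h₁.memLp.sub h₂.memLp, fun η hη hc hs => ?_⟩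
  have hη2 : Continuous (deriv η) := hη.continuous_deriv (by simp)
  have key : ∀ u : ℝ → X, ContinuousOn u (Icc 0 T) →
      Integrable (fun t => deriv η t • u t) (volume.restrict (Ioo 0 T)) := fun u hu =>
    ((hη2.continuousOn.smul hu).integrableOn_Icc).mono_set Ioo_subset_Icc_self
  simp_rw [smul_sub]
  rw [integral_sub (key _ hu₁) (key _ hu₂), integral_sub
    (HasL2TimeDeriv.integrable_smul h₁.memLp hη.continuous)
    (HasL2TimeDeriv.integrable_smul h₂.memLp hη.continuous), h₁.integral_eq η hη hc hs,
    h₂.integral_eq η hη hc hs]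
  abel

/-- The time derivative is unique. -/
lemma HasL2TimeDeriv.ae_eq [CompleteSpace X] {T : ℝ} {u w w' : ℝ → X} (h : HasL2TimeDeriv T u w)
    (h' : HasL2TimeDeriv T u w') : w =ᵐ[volume.restrict (Ioo 0 T)] w' := by
  have hi : Integrable (fun t => w t - w' t) (volume.restrict (Ioo 0 T)) :=
    (h.memLp.sub h'.memLp).integrable (by norm_num)
  have hloc : LocallyIntegrableOn (fun t => w t - w' t) (Ioo 0 T) volume :=
    IntegrableOn.locallyIntegrableOn hi
  have := isOpen_Ioo.ae_eq_zero_of_integral_contDiff_smul_eq_zero hloc fun η hη hc hs => by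
    rw [← setIntegral_eq_integral_of_forall_compl_eq_zero (s := Ioo 0 T)]
    · simp_rw [smul_sub]
      rw [integral_sub (HasL2TimeDeriv.integrable_smul h.memLp hη.continuous)
        (HasL2TimeDeriv.integrable_smul h'.memLp hη.continuous), sub_eq_zero]
      have e1 := h.integral_eq η hη hc hs
      rw [h'.integral_eq η hη hc hs] at e1
      exact (neg_injective e1).symm
    · intro t ht
      rw [image_eq_zero_of_notMem_tsupport (fun h => ht (hs h)), zero_smul]
  filter_upwards [ae_restrict_of_ae this, ae_restrict_mem measurableSet_Ioo] with t h1 h2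
  exact sub_eq_zero.1 (h1 h2)

lemma HasL2TimeDeriv.clm_comp [CompleteSpace X] [CompleteSpace Y] {T : ℝ} {u w : ℝ → X}
    (hu : ContinuousOn u (Icc 0 T))
    (h : HasL2TimeDeriv T u w) (S : X →L[ℝ] Y) :
    HasL2TimeDeriv T (fun t => S (u t)) (fun t => S (w t)) := by
  refine ⟨S.comp_memLp' h.memLp, fun η hη hc hs => ?_⟩
  have hη2 : Continuous (deriv η) := hη.continuous_deriv (by simp)
  simp_rw [← map_smul]
  have hi : Integrable (fun t => deriv η t • u t) (volume.restrict (Ioo 0 T)) :=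
    ((hη2.continuousOn.smul hu).integrableOn_Icc).mono_set Ioo_subset_Icc_self
  rw [S.integral_comp_comm hi,
    S.integral_comp_comm (HasL2TimeDeriv.integrable_smul h.memLp hη.continuous),
    h.integral_eq η hη hc hs, map_neg]

lemma HasL2TimeDeriv.congr_left {T : ℝ} {u u' w : ℝ → X} (h : HasL2TimeDeriv T u w)
    (hu : EqOn u u' (Icc 0 T)) : HasL2TimeDeriv T u' w := by
  refine ⟨h.memLp, fun η hη hc hs => ?_⟩
  rw [← h.integral_eq η hη hc hs]
  refine setIntegral_congr_fun measurableSet_Ioo fun t ht => ?_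
  simp only [hu (Ioo_subset_Icc_self ht)]

/-- The Gronwall inequality in integral form. -/
lemma le_mul_exp_of_le_add_integral {T a C : ℝ} (hC : 0 ≤ C) {y : ℝ → ℝ}
    (hy : Continuous y) (h : ∀ t ∈ Icc 0 T, y t ≤ a + C * ∫ s in (0 : ℝ)..t, y s) :
    ∀ t ∈ Icc 0 T, a + C * ∫ s in (0 : ℝ)..t, y s ≤ a * Real.exp (C * t) := by
  set G : ℝ → ℝ := fun t => a + C * ∫ s in (0 : ℝ)..t, y s with hG
  have hGd : ∀ t, HasDerivAt G (C * y t) t := fun t =>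
    ((intervalIntegral.integral_hasDerivAt_right (hy.intervalIntegrable _ _)
      hy.stronglyMeasurable.stronglyMeasurableAtFilter hy.continuousAt).const_mul C).const_add a
  have hPd : ∀ t, HasDerivAt (fun t => Real.exp (-(C * t)) * G t)
      (Real.exp (-(C * t)) * (C * y t - C * G t)) t := fun t => by
    have h1 : HasDerivAt (fun t : ℝ => -(C * t)) (-(C * 1)) t :=
      ((hasDerivAt_id t).const_mul C).neg
    exact (h1.exp.mul (hGd t)).congr_deriv (by ring)
  have hanti : AntitoneOn (fun t => Real.exp (-(C * t)) * G t) (Icc 0 T) := by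
    refine antitoneOn_of_deriv_nonpos (convex_Icc _ _)
      (fun t _ => (hPd t).continuousAt.continuousWithinAt)
      (fun t _ => (hPd t).differentiableAt.differentiableWithinAt) fun t ht => ?_
    rw [interior_Icc] at ht
    rw [(hPd t).deriv, ← mul_sub]
    have := h t (Ioo_subset_Icc_self ht)
    exact mul_nonpos_of_nonneg_of_nonpos (Real.exp_pos _).le
      (mul_nonpos_of_nonneg_of_nonpos hC (by linarith))
  intro t ht
  have h2 := hanti ⟨le_rfl, ht.1.trans ht.2⟩ ht ht.1
  simp only [mul_zero, neg_zero, Real.exp_zero, one_mul] at h2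
  have h3 : G 0 = a := by simp [hG]
  rw [h3, Real.exp_neg, inv_mul_le_iff₀ (Real.exp_pos _)] at h2
  linarith [mul_comm a (Real.exp (C * t))]

/-- A dissipative differential inequality bounds its solution independently of the length of the
time interval. -/
lemma le_of_deriv_le_neg_mul_add {T c σ : ℝ} (hσ : 0 < σ) {y y' e : ℝ → ℝ}
    (he : Continuous e) (he0 : ∀ t, 0 ≤ e t)
    (hy : ∀ t ∈ Icc 0 T, HasDerivWithinAt y (y' t) (Icc 0 T) t)
    (h : ∀ t ∈ Icc 0 T, y' t ≤ -σ * y t + c + e t) (t : ℝ) (ht : t ∈ Icc 0 T) :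
    y t ≤ |y 0| + |c / σ| + c / σ + ∫ s in (0 : ℝ)..t, e s := by
  set I : ℝ → ℝ := fun t => ∫ s in (0 : ℝ)..t, Real.exp (σ * s) * e s with hI
  have hce : Continuous fun s => Real.exp (σ * s) * e s := by fun_prop
  have hId : ∀ t, HasDerivAt I (Real.exp (σ * t) * e t) t := fun t =>
    intervalIntegral.integral_hasDerivAt_right (hce.intervalIntegrable _ _)
      hce.stronglyMeasurable.stronglyMeasurableAtFilter hce.continuousAt
  have hPd : ∀ t ∈ Icc 0 T, HasDerivWithinAt (fun t => Real.exp (σ * t) * (y t - c / σ) - I t)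
      (Real.exp (σ * t) * (σ * y t - c + y' t - e t)) (Icc 0 T) t := fun t ht => by
    have h1 : HasDerivAt (fun t : ℝ => σ * t) (σ * 1) t := (hasDerivAt_id t).const_mul σ
    refine ((h1.exp.hasDerivWithinAt.mul ((hy t ht).sub_const (c / σ))).sub
      (hId t).hasDerivWithinAt).congr_deriv ?_
    field_simp
  have hanti : AntitoneOn (fun t => Real.exp (σ * t) * (y t - c / σ) - I t) (Icc 0 T) := by
    refine antitoneOn_of_hasDerivWithinAt_nonpos (convex_Icc _ _)
      (fun t ht => (hPd t ht).continuousWithinAt)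
      (fun t ht => (hPd t (interior_subset ht)).mono interior_subset) fun t ht => ?_
    have := h t (interior_subset ht)
    exact mul_nonpos_of_nonneg_of_nonpos (Real.exp_pos _).le (by linarith)
  have h2 := hanti ⟨le_rfl, ht.1.trans ht.2⟩ ht ht.1
  have hI0 : I 0 = 0 := by simp [hI]
  simp only [mul_zero, Real.exp_zero, one_mul, hI0, sub_zero] at h2
  have h3 : I t ≤ Real.exp (σ * t) * ∫ s in (0 : ℝ)..t, e s := by
    rw [← intervalIntegral.integral_const_mul]
    refine intervalIntegral.integral_mono_on ht.1 (hce.intervalIntegrable _ _)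
      ((continuous_const.mul he).intervalIntegrable _ _) fun s hs => ?_
    exact mul_le_mul_of_nonneg_right (Real.exp_le_exp.2 (by nlinarith [hs.2])) (he0 s)
  have h4 : 1 ≤ Real.exp (σ * t) := Real.one_le_exp (mul_nonneg hσ.le ht.1)
  have h5 : 0 ≤ ∫ s in (0 : ℝ)..t, e s := intervalIntegral.integral_nonneg ht.1 fun s _ => he0 s
  have h6 : y 0 - c / σ ≤ |y 0| + |c / σ| := by
    linarith [le_abs_self (y 0), neg_abs_le (c / σ)]
  have h7 : |y 0| + |c / σ| ≤ Real.exp (σ * t) * (|y 0| + |c / σ|) :=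
    le_mul_of_one_le_left (by positivity) h4
  have h8 : Real.exp (σ * t) * (y t - c / σ)
      ≤ Real.exp (σ * t) * (|y 0| + |c / σ| + ∫ s in (0 : ℝ)..t, e s) := by linarith
  linarith [le_of_mul_le_mul_left h8 (Real.exp_pos _)]

end TimeDerivatives

noncomputable section LinearEvolution

open ContinuousLinearMap Filter

/-! ### The linear evolution equation -/

/-- Linear equations with a bounded operator are solved by the variation of constants formula. -/
lemma exists_hasDerivAt_linear {X : Type*} [NormedAddCommGroup X] [NormedSpace ℝ X]
    [CompleteSpace X] (M : X →L[ℝ] X) {g : ℝ → X} (hg : Continuous g) (x : X) :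
    ∃ z : ℝ → X, z 0 = x ∧ ∀ t, HasDerivAt z (M (z t) + g t) t := by
  let E : ℝ → X →L[ℝ] X := fun t => NormedSpace.exp (t • M)
  have hE : ∀ t, HasDerivAt E (M * E t) t := fun t => hasDerivAt_exp_smul_const' M t
  have hEc : Continuous E := continuous_iff_continuousAt.2 fun t => (hE t).continuousAt
  have hEE : ∀ t y, E t (E (-t) y) = y := by
    intro t y
    have h1 : E t * E (-t) = 1 := by
      let _ : NormedAlgebra ℚ (X →L[ℝ] X) := NormedAlgebra.restrictScalars ℚ ℝ _
      simp only [E]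
      rw [← NormedSpace.exp_add_of_commute ((Commute.refl M).smul_left t |>.smul_right (-t)),
        ← add_smul, add_neg_cancel, zero_smul, NormedSpace.exp_zero]
    exact DFunLike.congr_fun h1 y
  have hc : Continuous fun s => E (-s) (g s) := (hEc.comp continuous_neg).clm_apply hg
  refine ⟨fun t => E t (x + ∫ s in (0 : ℝ)..t, E (-s) (g s)), ?_, fun t => ?_⟩
  · simp [E]
  · have h2 : HasDerivAt (fun t => x + ∫ s in (0 : ℝ)..t, E (-s) (g s)) (E (-t) (g t)) t :=
      (intervalIntegral.integral_hasDerivAt_right (hc.intervalIntegrable _ _)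
        hc.stronglyMeasurable.stronglyMeasurableAtFilter hc.continuousAt).const_add x
    refine ((hE t).clm_apply h2).congr_deriv ?_
    rw [hEE]
    rfl

lemma integral_norm_sq_mono {E : Type*} [NormedAddCommGroup E] {t : ℝ} (ht : 0 ≤ t)
    {F G : ℝ → E} (hF : Continuous F)
    (hG : Continuous G) (h : ∀ s, ‖F s‖ ≤ ‖G s‖) :
    ∫ s in (0 : ℝ)..t, ‖F s‖ ^ 2 ≤ ∫ s in (0 : ℝ)..t, ‖G s‖ ^ 2 :=
  intervalIntegral.integral_mono_on ht ((hF.norm.pow 2).intervalIntegrable _ _)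
    ((hG.norm.pow 2).intervalIntegrable _ _) fun s _ =>
      pow_le_pow_left₀ (norm_nonneg _) (h s) 2

lemma hasDerivWithinAt_norm_sq {H : Type*} [NormedAddCommGroup H] [InnerProductSpace ℂ H]
    {y : ℝ → H} {y' : H} {s : Set ℝ} {t : ℝ}
    (h : HasDerivWithinAt y y' s t) :
    HasDerivWithinAt (fun t => ‖y t‖ ^ 2) (2 * (⟪y t, y'⟫_ℂ).re) s t := by
  have h1 := Complex.reCLM.hasFDerivAt.comp_hasDerivWithinAt t (h.inner ℂ h)
  have h2 : (fun t => ‖y t‖ ^ 2) = Complex.reCLM ∘ fun t => ⟪y t, y t⟫_ℂ := by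
    funext t
    simp [← Complex.ofReal_pow, inner_self_eq_norm_sq_to_K]
  rw [h2]
  refine h1.congr_deriv ?_
  have h3 : (⟪y', y t⟫_ℂ).re = (⟪y t, y'⟫_ℂ).re := by
    rw [← inner_conj_symm, Complex.conj_re]
  simp only [map_add, Complex.reCLM_apply, h3]
  ring

variable {H L : Type*} [NormedAddCommGroup H] [InnerProductSpace ℂ H] [CompleteSpace H]
  [NormedAddCommGroup L] [InnerProductSpace ℂ L] [CompleteSpace L]

/-- `y` solves `(B y)' = J† F - θ y` on `[0, T]` in integrated form, where `B = J† J`. With `J` the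
embedding `H¹₀ → L²`, so that `B⁻¹ = 1 - Δ`, this is the abstract form of `y' + θ (1 - Δ) y = F`. -/
structure SolvesLinear (J : H →L[ℂ] L) (θ : ℂ) (T : ℝ) (F : ℝ → L) (y : ℝ → H) : Prop where
  continuous : Continuous y
  eq : ∀ t ∈ Icc 0 T,
    gram J (y t) = gram J (y 0) + ∫ s in (0 : ℝ)..t, (adjoint J (F s) - θ • y s)

/-- `y` is a solution of `(B y)' = J† F - θ y` on `[0, T]` that is continuously differentiable as a
curve in `H`, with derivative `y'`. -/
structure SolvesSmooth (J : H →L[ℂ] L) (θ : ℂ) (T : ℝ) (F : ℝ → L) (y y' : ℝ → H) : Prop where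
  continuous : Continuous y
  continuous_deriv : Continuous y'
  hasDeriv : ∀ t ∈ Icc 0 T, HasDerivWithinAt y (y' t) (Icc 0 T) t
  eq : ∀ t ∈ Icc 0 T, gram J (y' t) = adjoint J (F t) - θ • y t

variable {J : H →L[ℂ] L} {θ : ℂ} {T : ℝ} {F G : ℝ → L} {y z y' z' : ℝ → H}

lemma SolvesSmooth.solvesLinear (h : SolvesSmooth J θ T F y y') :
    SolvesLinear J θ T F y := by
  refine ⟨h.continuous, fun t ht => ?_⟩
  have h1 : ∀ s ∈ Icc 0 T, HasDerivWithinAt (fun s => gram J (y s)) (gram J (y' s)) (Icc 0 T) s :=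
    fun s hs => ((gram J).restrictScalars ℝ).hasFDerivAt.comp_hasDerivWithinAt s (h.hasDeriv s hs)
  have h2 := integral_eq_sub_of_hasDerivWithinAt ht h1 ((gram J).continuous.comp h.continuous_deriv)
  rw [← intervalIntegral.integral_congr (f := fun s => gram J (y' s)), h2]
  · simp
  · intro s hs
    rw [uIcc_of_le ht.1] at hs
    exact h.eq s ⟨hs.1, hs.2.trans ht.2⟩

lemma SolvesSmooth.sub (hy : SolvesSmooth J θ T F y y') (hz : SolvesSmooth J θ T G z z') :
    SolvesSmooth J θ T (fun t => F t - G t) (fun t => y t - z t) (fun t => y' t - z' t) where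
  continuous := hy.continuous.sub hz.continuous
  continuous_deriv := hy.continuous_deriv.sub hz.continuous_deriv
  hasDeriv t ht := (hy.hasDeriv t ht).sub (hz.hasDeriv t ht)
  eq t ht := by
    rw [map_sub, map_sub, hy.eq t ht, hz.eq t ht, smul_sub]
    abel

lemma SolvesLinear.continuous_integrand (h : SolvesLinear J θ T F y) (hF : Continuous F) :
    Continuous fun s => adjoint J (F s) - θ • y s :=
  ((adjoint J).continuous.comp hF).sub (h.continuous.const_smul θ)

lemma SolvesLinear.sub (hF : Continuous F) (hG : Continuous G) (hy : SolvesLinear J θ T F y)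
    (hz : SolvesLinear J θ T G z) :
    SolvesLinear J θ T (fun t => F t - G t) (fun t => y t - z t) where
  continuous := hy.continuous.sub hz.continuous
  eq t ht := by
    have h1 : ∀ s, adjoint J (F s - G s) - θ • (y s - z s)
        = (adjoint J (F s) - θ • y s) - (adjoint J (G s) - θ • z s) := fun s => by
      rw [map_sub, smul_sub]; abel
    simp_rw [h1]
    rw [intervalIntegral.integral_sub ((hy.continuous_integrand hF).intervalIntegrable _ _)
      ((hz.continuous_integrand hG).intervalIntegrable _ _), map_sub, map_sub, hy.eq t ht,
      hz.eq t ht]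
    abel

lemma SolvesLinear.congr_right (h : SolvesLinear J θ T F y) (hFG : EqOn F G (Icc 0 T)) :
    SolvesLinear J θ T G y where
  continuous := h.continuous
  eq t ht := by
    rw [h.eq t ht, intervalIntegral.integral_congr]
    intro s hs
    rw [uIcc_of_le ht.1] at hs
    simp only [hFG ⟨hs.1, hs.2.trans ht.2⟩]

lemma SolvesLinear.mono {T' : ℝ} (h : SolvesLinear J θ T F y) (hT : T' ≤ T) :
    SolvesLinear J θ T' F y :=
  ⟨h.continuous, fun t ht => h.eq t ⟨ht.1, ht.2.trans hT⟩⟩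

/-- A spectral cutoff turns a solution into a continuously differentiable one. -/
lemma SolvesLinear.cutoff {Q A : H →L[ℂ] H} (hQ : IsCutoff J Q A) (hF : Continuous F)
    (h : SolvesLinear J θ T F y) :
    SolvesSmooth J θ T (fun t => cutoffL J Q A (F t)) (fun t => Q (y t))
      (fun t => A (Q (adjoint J (F t) - θ • y t))) where
  continuous := Q.continuous.comp h.continuous
  continuous_deriv := (A.comp Q).continuous.comp (h.continuous_integrand hF)
  hasDeriv t ht := by
    have hc := h.continuous_integrand hF
    have h1 : HasDerivAt (fun t => gram J (y 0) + ∫ s in (0 : ℝ)..t, (adjoint J (F s) - θ • y s))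
        (adjoint J (F t) - θ • y t) t :=
      (intervalIntegral.integral_hasDerivAt_right (hc.intervalIntegrable _ _)
        hc.stronglyMeasurable.stronglyMeasurableAtFilter hc.continuousAt).const_add _
    have h2 := (((A.comp Q).restrictScalars ℝ).hasFDerivAt.comp_hasDerivAt t h1).hasDerivWithinAt
      (s := Icc 0 T)
    refine h2.congr_of_mem (fun s hs => ?_) ht
    simp only [Function.comp_apply]
    -- On `[0, T]` the primitive is `B y`, and `A Q B y = Q y`.
    rw [← h.eq s hs]
    change Q (y s) = A (Q (gram J (y s)))
    rw [← hQ.gram_Q, ← hQ.gram_A, hQ.gram_inv]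
  eq t _ := by rw [hQ.gram_inv, hQ.adjoint_cutoffL, map_sub, map_smul]

/-- The parabolic energy estimate, obtained by testing the equation with the time derivative of the
solution. It uses that `θ⁻¹` has positive real part. -/
lemma SolvesSmooth.energy_le (hθ : 0 < (θ⁻¹).re) (hF : Continuous F)
    (h : SolvesSmooth J θ T F y y') {t : ℝ} (ht : t ∈ Icc 0 T) :
    ‖y t‖ ^ 2 + (θ⁻¹).re * ∫ s in (0 : ℝ)..t, ‖J (y' s)‖ ^ 2
      ≤ ‖y 0‖ ^ 2 + ‖θ⁻¹‖ ^ 2 / (θ⁻¹).re * ∫ s in (0 : ℝ)..t, ‖F s‖ ^ 2 := by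
  set r := (θ⁻¹).re with hr
  have hθ0 : θ ≠ 0 := by
    rintro rfl
    simp at hr
    exact hθ.ne' hr
  have hd := fun s hs => hasDerivWithinAt_norm_sq (h.hasDeriv s hs)
  have hyc := h.continuous
  have hyc' := h.continuous_deriv
  have h1 := integral_eq_sub_of_hasDerivWithinAt ht hd
    (continuous_const.mul (Complex.continuous_re.comp (hyc.inner hyc')))
  have hJc : Continuous fun s => ‖J (y' s)‖ ^ 2 := by fun_prop
  have hFc : Continuous fun s => ‖F s‖ ^ 2 := by fun_prop
  have h2 : ∫ s in (0 : ℝ)..t, (2 * (⟪y s, y' s⟫_ℂ).re + r * ‖J (y' s)‖ ^ 2)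
      ≤ ∫ s in (0 : ℝ)..t, ‖θ⁻¹‖ ^ 2 / r * ‖F s‖ ^ 2 := by
    refine intervalIntegral.integral_mono_on ht.1 ?_ ((hFc.const_mul _).intervalIntegrable _ _)
      fun s hs => ?_
    · exact Continuous.intervalIntegrable ((continuous_const.mul
        (Complex.continuous_re.comp (hyc.inner hyc'))).add (hJc.const_mul _)) _ _
    · have e1 : y s = θ⁻¹ • (adjoint J (F s) - gram J (y' s)) := by
        rw [h.eq s ⟨hs.1, hs.2.trans ht.2⟩, sub_sub_cancel, smul_smul,
          inv_mul_cancel₀ hθ0, one_smul]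
      have e2 : (⟪y s, y' s⟫_ℂ).re = (θ⁻¹ * ⟪J (y' s), F s⟫_ℂ).re - r * ‖J (y' s)‖ ^ 2 := by
        have e4 : (⟪y s, y' s⟫_ℂ).re = (⟪y' s, y s⟫_ℂ).re := by
          rw [← inner_conj_symm, Complex.conj_re]
        rw [e4]
        nth_rewrite 1 [e1]
        rw [inner_smul_right, inner_sub_right, adjoint_inner_right, inner_gram,
          inner_self_eq_norm_sq_to_K, mul_sub, Complex.sub_re]
        congr 1
        rw [Complex.mul_re]
        simp [← Complex.ofReal_pow, hr]
      have e3 : (θ⁻¹ * ⟪J (y' s), F s⟫_ℂ).re ≤ ‖θ⁻¹‖ * (‖J (y' s)‖ * ‖F s‖) := by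
        refine (Complex.re_le_norm _).trans ?_
        rw [norm_mul]
        gcongr
        exact norm_inner_le_norm _ _
      have e5 : 2 * (‖θ⁻¹‖ * (‖J (y' s)‖ * ‖F s‖))
          ≤ r * ‖J (y' s)‖ ^ 2 + ‖θ⁻¹‖ ^ 2 / r * ‖F s‖ ^ 2 := by
        have : 0 ≤ (r * ‖J (y' s)‖ - ‖θ⁻¹‖ * ‖F s‖) ^ 2 / r := by positivity
        have e6 : (r * ‖J (y' s)‖ - ‖θ⁻¹‖ * ‖F s‖) ^ 2 / r = r * ‖J (y' s)‖ ^ 2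
          + ‖θ⁻¹‖ ^ 2 / r * ‖F s‖ ^ 2 - 2 * (‖θ⁻¹‖ * (‖J (y' s)‖ * ‖F s‖)) := by
          field_simp
          ring
        linarith
      linarith
  rw [intervalIntegral.integral_add, h1, intervalIntegral.integral_const_mul,
    intervalIntegral.integral_const_mul] at h2
  · linarith
  · exact (continuous_const.mul
      (Complex.continuous_re.comp (hyc.inner hyc'))).intervalIntegrable _ _
  · exact (hJc.const_mul _).intervalIntegrable _ _

/-- The parabolic energy estimate for a solution without any time regularity, obtained from
`SolvesSmooth.energy_le` by spectral cutoffs. -/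
lemma SolvesLinear.norm_sq_le (hJ : Function.Injective J) (hθ : 0 < (θ⁻¹).re) (hF : Continuous F)
    (h : SolvesLinear J θ T F y) {t : ℝ} (ht : t ∈ Icc 0 T) :
    ‖y t‖ ^ 2 ≤ ‖y 0‖ ^ 2 + ‖θ⁻¹‖ ^ 2 / (θ⁻¹).re * ∫ s in (0 : ℝ)..t, ‖F s‖ ^ 2 := by
  obtain ⟨Q, A, hQ, hlim⟩ := exists_isCutoff_tendsto hJ
  refine le_of_tendsto' ((hlim (y t)).norm.pow 2) fun n => ?_
  have hc : Continuous fun s => cutoffL J (Q n) (A n) (F s) :=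
    (cutoffL J (Q n) (A n)).continuous.comp hF
  have h1 := (h.cutoff (hQ n) hF).energy_le hθ hc ht
  have h2 : 0 ≤ (θ⁻¹).re * ∫ s in (0 : ℝ)..t,
      ‖J (A n (Q n (adjoint J (F s) - θ • y s)))‖ ^ 2 :=
    mul_nonneg hθ.le (intervalIntegral.integral_nonneg ht.1 fun s _ => by positivity)
  have h3 := integral_norm_sq_mono ht.1 hc hF fun s => (hQ n).norm_cutoffL_le (F s)
  have h4 := pow_le_pow_left₀ (norm_nonneg _) ((hQ n).norm_le (y 0)) 2
  have h5 := mul_le_mul_of_nonneg_left h3 (show 0 ≤ ‖θ⁻¹‖ ^ 2 / (θ⁻¹).re by positivity)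
  linarith

/-- The energy estimate together with its bound on the time derivative. -/
lemma SolvesLinear.norm_sq_add_integral_le (hJ : Function.Injective J) (hJd : DenseRange J)
    (hθ : 0 < (θ⁻¹).re) (hF : Continuous F) (h : SolvesLinear J θ T F y) {w : ℝ → L}
    (hw : HasL2TimeDeriv T (fun t => J (y t)) w) {t : ℝ} (ht : t ∈ Icc 0 T) :
    ‖y t‖ ^ 2 + (θ⁻¹).re * ∫ s in (0 : ℝ)..t, ‖w s‖ ^ 2
      ≤ ‖y 0‖ ^ 2 + ‖θ⁻¹‖ ^ 2 / (θ⁻¹).re * ∫ s in (0 : ℝ)..t, ‖F s‖ ^ 2 := by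
  obtain ⟨Q, A, hQ, hlim⟩ := exists_isCutoff_tendsto hJ
  have hsub : Ioo 0 t ⊆ Ioo 0 T := Ioo_subset_Ioo_right ht.2
  have hwt : MemLp w 2 (volume.restrict (Ioo 0 t)) :=
    hw.memLp.mono_measure (Measure.restrict_mono hsub le_rfl)
  have hlimC : Tendsto (fun n => ∫ s in (0 : ℝ)..t, ‖cutoffL J (Q n) (A n) (w s)‖ ^ 2) atTop
      (𝓝 (∫ s in (0 : ℝ)..t, ‖w s‖ ^ 2)) := by
    simp_rw [← setIntegral_Ioo_eq ht.1]
    refine tendsto_integral_of_dominated_convergence (fun s => ‖w s‖ ^ 2)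
      (fun n => ?_) hwt.integrable_norm_pow' (fun n => ?_) ?_
    · exact (((cutoffL J (Q n) (A n)).continuous.comp_aestronglyMeasurable hwt.1).norm).pow 2
    · refine Eventually.of_forall fun s => ?_
      rw [Real.norm_of_nonneg (by positivity)]
      exact pow_le_pow_left₀ (norm_nonneg _) ((hQ n).norm_cutoffL_le _) 2
    · exact Eventually.of_forall fun s => (tendsto_cutoffL hJd hQ hlim (w s)).norm.pow 2
  refine le_of_tendsto' (((hlim (y t)).norm.pow 2).add (hlimC.const_mul _)) fun n => ?_
  have hc : Continuous fun s => cutoffL J (Q n) (A n) (F s) :=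
    (cutoffL J (Q n) (A n)).continuous.comp hF
  have hs := h.cutoff (hQ n) hF
  have h1 := hs.energy_le hθ hc ht
  have hJy : ContinuousOn (fun t => J (y t)) (Icc 0 T) :=
    (J.continuous.comp h.continuous).continuousOn
  have d1 : HasL2TimeDeriv T (fun t => J (Q n (y t)))
      (fun t => cutoffL J (Q n) (A n) (w t)) := by
    have := hw.clm_comp hJy ((cutoffL J (Q n) (A n)).restrictScalars ℝ)
    simpa [(hQ n).cutoffL_J] using this
  have d2 : HasL2TimeDeriv T (fun t => J (Q n (y t)))
      (fun t => J (A n (Q n (adjoint J (F t) - θ • y t)))) :=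
    HasL2TimeDeriv.of_hasDerivWithinAt (J.continuous.comp hs.continuous_deriv) fun t ht =>
      (J.restrictScalars ℝ).hasFDerivAt.comp_hasDerivWithinAt t (hs.hasDeriv t ht)
  have d3 : ∫ s in (0 : ℝ)..t, ‖cutoffL J (Q n) (A n) (w s)‖ ^ 2
      = ∫ s in (0 : ℝ)..t, ‖J (A n (Q n (adjoint J (F s) - θ • y s)))‖ ^ 2 := by
    rw [← setIntegral_Ioo_eq ht.1, ← setIntegral_Ioo_eq ht.1]
    refine integral_congr_ae ?_
    filter_upwards [ae_restrict_of_ae_restrict_of_subset hsub (d1.ae_eq d2)] with s hs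
    rw [hs]
  have h3 := integral_norm_sq_mono ht.1 hc hF fun s => (hQ n).norm_cutoffL_le (F s)
  have h4 := pow_le_pow_left₀ (norm_nonneg _) ((hQ n).norm_le (y 0)) 2
  have h5 := mul_le_mul_of_nonneg_left h3 (show 0 ≤ ‖θ⁻¹‖ ^ 2 / (θ⁻¹).re by positivity)
  rw [d3]
  linarith

/-- The estimate in `H` for the dispersive equation, where `θ` is imaginary and the force takes its
values in `H`. -/
lemma SolvesLinear.norm_sq_le_of_re_eq_zero (hJ : Function.Injective J) (hθ : θ.re = 0)
    {g : ℝ → H} (hg : Continuous g) (h : SolvesLinear J θ T (fun t => J (g t)) y) {t : ℝ}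
    (ht : t ∈ Icc 0 T) :
    ‖y t‖ ^ 2 ≤ ‖y 0‖ ^ 2 + ∫ s in (0 : ℝ)..t, (‖y s‖ ^ 2 + ‖g s‖ ^ 2) := by
  obtain ⟨Q, A, hQ, hlim⟩ := exists_isCutoff_tendsto hJ
  refine le_of_tendsto' ((hlim (y t)).norm.pow 2) fun n => ?_
  have hF : Continuous fun t => J (g t) := J.continuous.comp hg
  have hs := h.cutoff (hQ n) hF
  have hd := fun s hs' => hasDerivWithinAt_norm_sq (hs.hasDeriv s hs')
  have hyc := h.continuous
  have hcc := continuous_const (y := (2 : ℝ)) |>.mul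
    (Complex.continuous_re.comp (hs.continuous.inner hs.continuous_deriv))
  have h1 := integral_eq_sub_of_hasDerivWithinAt ht hd hcc
  have h2 : ∫ s in (0 : ℝ)..t, (2 * (⟪Q n (y s), A n (Q n (adjoint J (J (g s)) - θ • y s))⟫_ℂ).re)
      ≤ ∫ s in (0 : ℝ)..t, (‖y s‖ ^ 2 + ‖g s‖ ^ 2) := by
    refine intervalIntegral.integral_mono_on ht.1 (hcc.intervalIntegrable _ _)
      (Continuous.intervalIntegrable (by fun_prop) _ _) fun s _ => ?_
    have e1 : A n (Q n (adjoint J (J (g s)) - θ • y s)) = Q n (g s) - θ • A n (Q n (y s)) := by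
      rw [← gram_apply, map_sub, map_sub, ← (hQ n).gram_Q, ← (hQ n).gram_A, (hQ n).gram_inv,
        map_smul, map_smul]
    have e2 : (⟪Q n (y s), A n (Q n (y s))⟫_ℂ).im = 0 := by
      have := (hQ n).symm_A (Q n (y s)) (Q n (y s))
      rw [← inner_conj_symm, Complex.conj_eq_iff_im] at this
      exact this
    -- The term with `θ` drops out because `θ` is imaginary and `A` is symmetric.
    have e3 : (⟪Q n (y s), A n (Q n (adjoint J (J (g s)) - θ • y s))⟫_ℂ).re
        = (⟪Q n (y s), Q n (g s)⟫_ℂ).re := by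
      rw [e1, inner_sub_right, inner_smul_right, Complex.sub_re, Complex.mul_re, hθ, e2]
      ring
    have e4 : (⟪Q n (y s), Q n (g s)⟫_ℂ).re ≤ ‖y s‖ * ‖g s‖ :=
      (Complex.re_le_norm _).trans ((norm_inner_le_norm _ _).trans
        (mul_le_mul ((hQ n).norm_le _) ((hQ n).norm_le _) (norm_nonneg _) (norm_nonneg _)))
    rw [e3]
    nlinarith [sq_nonneg (‖y s‖ - ‖g s‖)]
  have h4 := pow_le_pow_left₀ (norm_nonneg _) ((hQ n).norm_le (y 0)) 2
  rw [h1] at h2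
  linarith

end LinearEvolution

noncomputable section LinearExistence

open ContinuousLinearMap Filter

/-! ### Solving the linear equation -/

/-- The projection of the real line onto `[0, T]`. -/
def clamp (T t : ℝ) : ℝ := max 0 (min t T)

lemma continuous_clamp (T : ℝ) : Continuous (clamp T) := by unfold clamp; fun_prop

lemma clamp_mem {T : ℝ} (hT : 0 ≤ T) (t : ℝ) : clamp T t ∈ Icc 0 T :=
  ⟨le_max_left _ _, max_le hT (min_le_right _ _)⟩

lemma clamp_of_mem {T t : ℝ} (ht : t ∈ Icc 0 T) : clamp T t = t := by
  unfold clamp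
  rw [min_eq_left ht.2, max_eq_right ht.1]

lemma continuous_comp_clamp {X : Type*} [TopologicalSpace X] {T : ℝ} (hT : 0 ≤ T) {f : ℝ → X}
    (hf : ContinuousOn f (Icc 0 T)) : Continuous fun t => f (clamp T t) :=
  hf.comp_continuous (continuous_clamp T) (clamp_mem hT)

lemma lt_of_sq_le_add {β : ℕ → ℝ} (hβ : Tendsto β atTop (𝓝 0)) {ε : ℝ} (hε : 0 < ε) :
    ∃ N, ∀ n ≥ N, ∀ m ≥ N, ∀ r : ℝ, r ^ 2 ≤ β n + β m → r < ε := by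
  obtain ⟨N, hN⟩ := eventually_atTop.1
    (hβ.eventually (gt_mem_nhds (show 0 < ε ^ 2 / 2 by positivity)))
  refine ⟨N, fun n hn m hm r hr => lt_of_pow_lt_pow_left₀ 2 hε.le ?_⟩
  linarith [hN n hn, hN m hm]

lemma cauchySeq_of_norm_sub_sq_le {E : Type*} [NormedAddCommGroup E] {u : ℕ → E} {β : ℕ → ℝ}
    (hβ : Tendsto β atTop (𝓝 0)) (h : ∀ n m, ‖u n - u m‖ ^ 2 ≤ β n + β m) : CauchySeq u := by
  rw [Metric.cauchySeq_iff]
  intro ε hε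
  obtain ⟨N, hN⟩ := lt_of_sq_le_add hβ hε
  exact ⟨N, fun m hm n hn => by rw [dist_eq_norm]; exact hN m hm n hn _ (h m n)⟩

lemma norm_sub_sq_le_two {E : Type*} [NormedAddCommGroup E] (a b c : E) :
    ‖a - b‖ ^ 2 ≤ 2 * ‖a - c‖ ^ 2 + 2 * ‖b - c‖ ^ 2 := by
  have h1 : ‖a - b‖ ≤ ‖a - c‖ + ‖b - c‖ := by
    rw [← norm_neg (b - c), neg_sub]
    calc ‖a - b‖ = ‖(a - c) + (c - b)‖ := by rw [sub_add_sub_cancel]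
      _ ≤ _ := norm_add_le _ _
  nlinarith [norm_nonneg (a - b), sq_nonneg (‖a - c‖ - ‖b - c‖)]

lemma integral_norm_sub_sq_le_two {E : Type*} [NormedAddCommGroup E] {t : ℝ} (ht : 0 ≤ t)
    {a b c : ℝ → E} (ha : Continuous a) (hb : Continuous b) (hc : Continuous c) :
    ∫ s in (0 : ℝ)..t, ‖a s - b s‖ ^ 2
      ≤ 2 * (∫ s in (0 : ℝ)..t, ‖a s - c s‖ ^ 2) + 2 * ∫ s in (0 : ℝ)..t, ‖b s - c s‖ ^ 2 := by
  rw [← intervalIntegral.integral_const_mul, ← intervalIntegral.integral_const_mul,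
    ← intervalIntegral.integral_add]
  · refine intervalIntegral.integral_mono_on ht ?_ ?_ fun s _ => norm_sub_sq_le_two _ _ _
    all_goals exact Continuous.intervalIntegrable (by fun_prop) _ _
  all_goals exact Continuous.intervalIntegrable (by fun_prop) _ _

lemma tendsto_integral_norm_sub_sq {E : Type*} [NormedAddCommGroup E] {t : ℝ}
    {a : ℕ → ℝ → E} {b : ℝ → E} (ha : ∀ n, Continuous (a n)) (hb : Continuous b)
    (hle : ∀ n s, ‖a n s‖ ≤ ‖b s‖) (hlim : ∀ s, Tendsto (fun n => a n s) atTop (𝓝 (b s))) :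
    Tendsto (fun n => ∫ s in (0 : ℝ)..t, ‖a n s - b s‖ ^ 2) atTop (𝓝 0) := by
  suffices h : Tendsto (fun n => ∫ s in (0 : ℝ)..t, ‖a n s - b s‖ ^ 2) atTop
      (𝓝 (∫ s in (0 : ℝ)..t, (0 : ℝ))) by simpa using h
  refine intervalIntegral.tendsto_integral_filter_of_dominated_convergence
    (fun s => (2 * ‖b s‖) ^ 2) (Eventually.of_forall fun n => ?_)
    (Eventually.of_forall fun n => Eventually.of_forall fun s _ => ?_) ?_
    (Eventually.of_forall fun s _ => ?_)
  · have := ha n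
    exact Continuous.aestronglyMeasurable (by fun_prop)
  · rw [Real.norm_of_nonneg (by positivity)]
    refine pow_le_pow_left₀ (norm_nonneg _) ?_ 2
    linarith [norm_sub_le (a n s) (b s), hle n s]
  · exact Continuous.intervalIntegrable (by fun_prop) _ _
  · have := ((hlim s).sub_const (b s)).norm.pow 2
    simpa using this

variable {H L : Type*} [NormedAddCommGroup H] [InnerProductSpace ℂ H] [CompleteSpace H]
  [NormedAddCommGroup L] [InnerProductSpace ℂ L] [CompleteSpace L]
  {J : H →L[ℂ] L} {θ : ℂ} {T : ℝ} {F : ℝ → L} {y : ℝ → H}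

/-- Solutions whose mutual distances tend to zero uniformly in time converge to a solution. The
limit is extended by constants outside `[0, T]`, since `SolvesLinear` asks for a continuous curve on the
real line. -/
lemma exists_solvesLinear_of_cauchy (hT : 0 ≤ T) {f : ℕ → ℝ → L} {u : ℕ → ℝ → H}
    (hf : ∀ n, Continuous (f n)) (hu : ∀ n, SolvesLinear J θ T (f n) (u n))
    {β : ℕ → ℝ} (hβ : Tendsto β atTop (𝓝 0))
    (hcauchy : ∀ n m, ∀ t ∈ Icc 0 T, ‖u n t - u m t‖ ^ 2 ≤ β n + β m)
    {g : ℝ → ℝ} (hg : Continuous g) (hfg : ∀ n s, ‖f n s‖ ≤ g s)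
    (hlim : ∀ s, Tendsto (fun n => f n s) atTop (𝓝 (F s))) :
    ∃ y, SolvesLinear J θ T F y ∧ Tendsto (fun n => u n 0) atTop (𝓝 (y 0)) := by
  have hc : ∀ t ∈ Icc 0 T, ∃ x, Tendsto (fun n => u n t) atTop (𝓝 x) := fun t ht =>
    cauchySeq_tendsto_of_complete (cauchySeq_of_norm_sub_sq_le hβ fun n m => hcauchy n m t ht)
  choose! Y hY using hc
  have hunif : TendstoUniformlyOn u Y atTop (Icc 0 T) := by
    refine UniformCauchySeqOn.tendstoUniformlyOn_of_tendsto ?_ hY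
    rw [Metric.uniformCauchySeqOn_iff]
    intro ε hε
    obtain ⟨N, hN⟩ := lt_of_sq_le_add hβ hε
    exact ⟨N, fun m hm n hn t ht => by
      rw [dist_eq_norm]; exact hN m hm n hn _ (hcauchy m n t ht)⟩
  have hYc : ContinuousOn Y (Icc 0 T) :=
    hunif.continuousOn (Frequently.of_forall fun n => (hu n).continuous.continuousOn)
  have h0 : (0 : ℝ) ∈ Icc 0 T := ⟨le_rfl, hT⟩
  have hyY : ∀ t ∈ Icc 0 T, Tendsto (fun n => u n t) atTop (𝓝 (Y (clamp T t))) := fun t ht => by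
    rw [clamp_of_mem ht]; exact hY t ht
  refine ⟨fun t => Y (clamp T t), ⟨continuous_comp_clamp hT hYc, fun t ht => ?_⟩, hyY 0 h0⟩
  obtain ⟨C, hC⟩ := (isCompact_Icc (a := (0 : ℝ)) (b := T)).exists_bound_of_continuousOn hYc
  have hev : ∀ᶠ n in atTop, ∀ s ∈ Icc 0 T, ‖u n s‖ ≤ C + 1 := by
    filter_upwards [Metric.tendstoUniformlyOn_iff.1 hunif 1 one_pos] with n hn s hs
    have h1 := hn s hs
    rw [dist_eq_norm] at h1
    have h2 := norm_sub_norm_le (u n s) (Y s)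
    rw [norm_sub_rev] at h2
    linarith [hC s hs]
  have hint : Tendsto (fun n => ∫ s in (0 : ℝ)..t, (adjoint J (f n s) - θ • u n s)) atTop
      (𝓝 (∫ s in (0 : ℝ)..t, (adjoint J (F s) - θ • Y (clamp T s)))) := by
    refine intervalIntegral.tendsto_integral_filter_of_dominated_convergence
      (fun s => ‖adjoint J‖ * g s + ‖θ‖ * (C + 1)) (Eventually.of_forall fun n => ?_) ?_ ?_ ?_
    · exact ((hu n).continuous_integrand (hf n)).aestronglyMeasurable
    · filter_upwards [hev] with n hn
      refine Eventually.of_forall fun s hs => ?_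
      rw [uIoc_of_le ht.1] at hs
      refine (norm_sub_le _ _).trans (add_le_add ?_ ?_)
      · exact (le_opNorm _ _).trans (mul_le_mul_of_nonneg_left (hfg n s) (norm_nonneg _))
      · rw [norm_smul]
        exact mul_le_mul_of_nonneg_left (hn s ⟨hs.1.le, hs.2.trans ht.2⟩) (norm_nonneg _)
    · exact Continuous.intervalIntegrable (by fun_prop) _ _
    · refine Eventually.of_forall fun s hs => ?_
      rw [uIoc_of_le ht.1] at hs
      exact (((adjoint J).continuous.tendsto _).comp (hlim s)).sub
        ((hyY s ⟨hs.1.le, hs.2.trans ht.2⟩).const_smul θ)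
  refine tendsto_nhds_unique (((gram J).continuous.tendsto _).comp (hyY t ht)) ?_
  refine ((((gram J).continuous.tendsto _).comp (hyY 0 h0)).add hint).congr fun n => ?_
  exact ((hu n).eq t ht).symm

/-- Cutting off a linear equation with bounded operator produces exact solutions of the evolution
equation with modified data. -/
lemma exists_solvesSmooth_cutoff {Q A : H →L[ℂ] H} (hQ : IsCutoff J Q A) (θ : ℂ) (T : ℝ)
    {g : ℝ → H} (hg : Continuous g) {f : ℝ → L}
    (hfg : ∀ t, adjoint J (f t) = gram J (Q (g t))) (x : H) :
    ∃ y y', y 0 = Q x ∧ SolvesSmooth J θ T f y y' := by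
  obtain ⟨z, hz0, hz⟩ := exists_hasDerivAt_linear ((-(θ • A)).restrictScalars ℝ) hg x
  have hzc : Continuous z := continuous_iff_continuousAt.2 fun t => (hz t).continuousAt
  refine ⟨fun t => Q (z t), fun t => Q (-(θ • A (z t)) + g t), by simp [hz0], ?_⟩
  refine ⟨by fun_prop, by fun_prop, fun t _ => ?_, fun t _ => ?_⟩
  · exact ((Q.restrictScalars ℝ).hasFDerivAt.comp_hasDerivAt t (hz t)).hasDerivWithinAt
  · rw [map_add, map_add, map_neg, map_neg, map_smul, map_smul, hfg, ← hQ.comm, hQ.gram_inv]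
    abel

/-- The parabolic equation with a force in `L` is solvable: the solutions of the cut-off problems
form a Cauchy sequence by the energy estimate. -/
lemma exists_solvesLinear_parabolic (hJ : Function.Injective J) (hJd : DenseRange J) (hT : 0 ≤ T)
    (hθ : 0 < (θ⁻¹).re) (hF : Continuous F) (x : H) :
    ∃ y, SolvesLinear J θ T F y ∧ y 0 = x := by
  obtain ⟨Q, A, hQ, hlim⟩ := exists_isCutoff_tendsto hJ
  have hc : ∀ n, Continuous fun s => cutoffL J (Q n) (A n) (F s) := fun n =>
    (cutoffL J (Q n) (A n)).continuous.comp hF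
  have hex := fun n => exists_solvesSmooth_cutoff (hQ n) θ T
    (g := fun t => A n (adjoint J (F t))) (f := fun t => cutoffL J (Q n) (A n) (F t))
    ((A n).continuous.comp ((adjoint J).continuous.comp hF))
    (fun t => by rw [(hQ n).adjoint_cutoffL, ← (hQ n).comm, (hQ n).gram_inv]) x
  choose u u' hu0 hu using hex
  set k := ‖θ⁻¹‖ ^ 2 / (θ⁻¹).re with hk
  have hk0 : 0 ≤ k := by positivity
  let β : ℕ → ℝ := fun n => 2 * ‖Q n x - x‖ ^ 2
    + k * (2 * ∫ s in (0 : ℝ)..T, ‖cutoffL J (Q n) (A n) (F s) - F s‖ ^ 2)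
  have hβ : Tendsto β atTop (𝓝 0) := by
    have h1 : Tendsto (fun n => ‖Q n x - x‖ ^ 2) atTop (𝓝 0) := by
      simpa using ((hlim x).sub_const x).norm.pow 2
    have h2 := tendsto_integral_norm_sub_sq (t := T) hc hF
      (fun n s => (hQ n).norm_cutoffL_le (F s)) fun s => tendsto_cutoffL hJd hQ hlim (F s)
    simpa using (h1.const_mul 2).add ((h2.const_mul 2).const_mul k)
  obtain ⟨y, hy, hy0⟩ := exists_solvesLinear_of_cauchy hT hc (fun n => (hu n).solvesLinear) hβ
    (fun n m t ht => by
      have hcd : Continuous fun s => cutoffL J (Q n) (A n) (F s) - cutoffL J (Q m) (A m) (F s) :=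
        (hc n).sub (hc m)
      have h1 := ((hu n).sub (hu m)).solvesLinear.norm_sq_le hJ hθ hcd ht
      simp only [hu0] at h1
      have h2 := norm_sub_sq_le_two (Q n x) (Q m x) x
      have h3 := integral_norm_sub_sq_le_two hT (hc n) (hc m) hF
      have h4 : ∫ s in (0 : ℝ)..t, ‖cutoffL J (Q n) (A n) (F s) - cutoffL J (Q m) (A m) (F s)‖ ^ 2
          ≤ ∫ s in (0 : ℝ)..T, ‖cutoffL J (Q n) (A n) (F s) - cutoffL J (Q m) (A m) (F s)‖ ^ 2 :=
        intervalIntegral.integral_mono_interval le_rfl ht.1 ht.2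
          (Eventually.of_forall fun s => by positivity)
          ((hcd.norm.pow 2).intervalIntegrable _ _)
      have h5 := mul_le_mul_of_nonneg_left (h4.trans h3) hk0
      simp only [β]
      linarith)
    hF.norm (fun n s => (hQ n).norm_cutoffL_le (F s)) fun s => tendsto_cutoffL hJd hQ hlim (F s)
  refine ⟨y, hy, tendsto_nhds_unique hy0 ?_⟩
  simp only [hu0]
  exact hlim x

/-- The dispersive equation is solvable, for a force with values in `H`. -/
lemma exists_solvesLinear_dispersive (hJ : Function.Injective J) (hT : 0 ≤ T)
    (hθ : θ.re = 0) {g : ℝ → H} (hg : Continuous g) (x : H) :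
    ∃ y, SolvesLinear J θ T (fun t => J (g t)) y ∧ y 0 = x := by
  obtain ⟨Q, A, hQ, hlim⟩ := exists_isCutoff_tendsto hJ
  have hc : ∀ n, Continuous fun s => Q n (g s) := fun n => (Q n).continuous.comp hg
  have hex := fun n => exists_solvesSmooth_cutoff (hQ n) θ T
    (f := fun t => J (Q n (g t))) hg (fun t => rfl) x
  choose u u' hu0 hu using hex
  let β : ℕ → ℝ := fun n => (2 * ‖Q n x - x‖ ^ 2
    + 2 * ∫ s in (0 : ℝ)..T, ‖Q n (g s) - g s‖ ^ 2) * Real.exp (1 * T)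
  have hβ : Tendsto β atTop (𝓝 0) := by
    have h1 : Tendsto (fun n => ‖Q n x - x‖ ^ 2) atTop (𝓝 0) := by
      simpa using ((hlim x).sub_const x).norm.pow 2
    have h2 := tendsto_integral_norm_sub_sq (t := T) hc hg
      (fun n s => (hQ n).norm_le (g s)) fun s => hlim (g s)
    simpa only [mul_zero, add_zero, zero_mul] using
      ((h1.const_mul 2).add (h2.const_mul 2)).mul_const (Real.exp (1 * T))
  obtain ⟨y, hy, hy0⟩ := exists_solvesLinear_of_cauchy hT
    (fun n => J.continuous.comp (hc n)) (fun n => (hu n).solvesLinear) hβ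
    (fun n m t ht => by
      have hd : SolvesLinear J θ T (fun t => J (Q n (g t) - Q m (g t)))
          (fun t => u n t - u m t) := by
        have := ((hu n).sub (hu m)).solvesLinear
        simpa only [map_sub] using this
      have hcd : Continuous fun t => Q n (g t) - Q m (g t) := (hc n).sub (hc m)
      have hI : ∀ t ∈ Icc 0 T, ∫ s in (0 : ℝ)..t, ‖Q n (g s) - Q m (g s)‖ ^ 2
          ≤ ∫ s in (0 : ℝ)..T, ‖Q n (g s) - Q m (g s)‖ ^ 2 := fun t ht =>
        intervalIntegral.integral_mono_interval le_rfl ht.1 ht.2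
          (Eventually.of_forall fun s => by positivity) ((hcd.norm.pow 2).intervalIntegrable _ _)
      have hcu : Continuous fun t => ‖u n t - u m t‖ ^ 2 := hd.continuous.norm.pow 2
      have hle : ∀ t ∈ Icc 0 T, ‖u n t - u m t‖ ^ 2 ≤ (‖Q n x - Q m x‖ ^ 2
          + ∫ s in (0 : ℝ)..T, ‖Q n (g s) - Q m (g s)‖ ^ 2)
          + 1 * ∫ s in (0 : ℝ)..t, ‖u n s - u m s‖ ^ 2 := fun t ht => by
        have h1 := hd.norm_sq_le_of_re_eq_zero hJ hθ hcd ht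
        have h0 : Continuous fun s => ‖Q n (g s) - Q m (g s)‖ ^ 2 := hcd.norm.pow 2
        rw [intervalIntegral.integral_add (hcu.intervalIntegrable _ _)
          (h0.intervalIntegrable _ _)] at h1
        simp only [hu0] at h1
        linarith [hI t ht]
      have h6 := (hle t ht).trans (le_mul_exp_of_le_add_integral zero_le_one hcu hle t ht)
      have h2 := norm_sub_sq_le_two (Q n x) (Q m x) x
      have h3 := integral_norm_sub_sq_le_two hT (hc n) (hc m) hg
      have h7 : Real.exp (1 * t) ≤ Real.exp (1 * T) := Real.exp_le_exp.2 (by linarith [ht.2])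
      simp only [β]
      rw [← add_mul]
      refine h6.trans (mul_le_mul (by linarith) h7 (Real.exp_pos _).le ?_)
      have := intervalIntegral.integral_nonneg (μ := volume)
        (f := fun s => ‖Q n (g s) - Q m (g s)‖ ^ 2) hT fun s _ => by positivity
      linarith [sq_nonneg ‖Q n x - Q m x‖])
    (hg.norm.const_mul ‖J‖) (fun n s => (J.le_opNorm _).trans
      (mul_le_mul_of_nonneg_left ((hQ n).norm_le _) (norm_nonneg _)))
    fun s => (J.continuous.tendsto _).comp (hlim (g s))
  refine ⟨y, hy, tendsto_nhds_unique hy0 ?_⟩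
  simp only [hu0]
  exact hlim x

/-- Maximal regularity: the solutions of the parabolic equation have a time derivative in
`L²((0, T), L)`. -/
lemma SolvesLinear.exists_hasL2TimeDeriv (hJ : Function.Injective J) (hJd : DenseRange J)
    (hT : 0 ≤ T) (hθ : 0 < (θ⁻¹).re) (hF : Continuous F) (h : SolvesLinear J θ T F y) :
    ∃ w, HasL2TimeDeriv T (fun t => J (y t)) w := by
  obtain ⟨Q, A, hQ, hlim⟩ := exists_isCutoff_tendsto hJ
  have hc : ∀ n, Continuous fun s => cutoffL J (Q n) (A n) (F s) := fun n =>
    (cutoffL J (Q n) (A n)).continuous.comp hF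
  let u' : ℕ → ℝ → H := fun n t => A n (Q n (adjoint J (F t) - θ • y t))
  have hu : ∀ n, SolvesSmooth J θ T _ (fun t => Q n (y t)) (u' n) := fun n => h.cutoff (hQ n) hF
  have hJu : ∀ n, Continuous fun t => J (u' n t) := fun n =>
    J.continuous.comp (hu n).continuous_deriv
  have hd : ∀ n, HasL2TimeDeriv T (fun t => J (Q n (y t))) (fun t => J (u' n t)) := fun n =>
    HasL2TimeDeriv.of_hasDerivWithinAt (hJu n) fun t ht =>
      (J.restrictScalars ℝ).hasFDerivAt.comp_hasDerivWithinAt t ((hu n).hasDeriv t ht)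
  set r := (θ⁻¹).re with hr
  set k := ‖θ⁻¹‖ ^ 2 / r with hk
  have hk0 : 0 ≤ k := by positivity
  let β : ℕ → ℝ := fun n => r⁻¹ * (2 * ‖Q n (y 0) - y 0‖ ^ 2
    + k * (2 * ∫ s in (0 : ℝ)..T, ‖cutoffL J (Q n) (A n) (F s) - F s‖ ^ 2))
  have hβ : Tendsto β atTop (𝓝 0) := by
    have h1 : Tendsto (fun n => ‖Q n (y 0) - y 0‖ ^ 2) atTop (𝓝 0) := by
      simpa using ((hlim (y 0)).sub_const (y 0)).norm.pow 2
    have h2 := tendsto_integral_norm_sub_sq (t := T) hc hF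
      (fun n s => (hQ n).norm_cutoffL_le (F s)) fun s => tendsto_cutoffL hJd hQ hlim (F s)
    simpa using ((h1.const_mul 2).add ((h2.const_mul 2).const_mul k)).const_mul r⁻¹
  let W : ℕ → Lp L 2 (volume.restrict (Ioo 0 T)) := fun n => (hd n).memLp.toLp
  have hW : CauchySeq W := by
    refine cauchySeq_of_norm_sub_sq_le hβ fun n m => ?_
    have e1 : ‖W n - W m‖ ^ 2 = ∫ s in (0 : ℝ)..T, ‖J (u' n s - u' m s)‖ ^ 2 := by
      rw [← MemLp.toLp_sub, Lp.norm_toLp, ← setIntegral_Ioo_eq hT]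
      rw [MemLp.eLpNorm_eq_integral_rpow_norm (by norm_num) (by norm_num)
        ((hd n).memLp.sub (hd m).memLp), ENNReal.toReal_ofReal (by positivity)]
      rw [← Real.rpow_natCast, ← Real.rpow_mul (by positivity)]
      simp
    have hcd : Continuous fun s => cutoffL J (Q n) (A n) (F s) - cutoffL J (Q m) (A m) (F s) :=
      (hc n).sub (hc m)
    have h1 := ((hu n).sub (hu m)).energy_le hθ hcd ⟨hT, le_rfl⟩
    have h2 := norm_sub_sq_le_two (Q n (y 0)) (Q m (y 0)) (y 0)
    have h3 := mul_le_mul_of_nonneg_left (integral_norm_sub_sq_le_two hT (hc n) (hc m) hF) hk0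
    rw [e1]
    simp only [β]
    rw [← mul_add, ← div_eq_inv_mul, le_div_iff₀ hθ]
    have h4 := sq_nonneg ‖Q n (y T) - Q m (y T)‖
    linarith
  obtain ⟨w, hw⟩ := cauchySeq_tendsto_of_complete hW
  refine ⟨w, Lp.memLp w, fun η hη hcη hs => ?_⟩
  have hη2 : Continuous (deriv η) := hη.continuous_deriv (by simp)
  have hl : Tendsto (fun n => ∫ t in Ioo 0 T, deriv η t • J (Q n (y t))) atTop
      (𝓝 (∫ t in Ioo 0 T, deriv η t • J (y t))) := by
    have hcy := h.continuous
    simp_rw [setIntegral_Ioo_eq hT]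
    refine intervalIntegral.tendsto_integral_filter_of_dominated_convergence
      (fun t => ‖deriv η t‖ * ‖J (y t)‖) (Eventually.of_forall fun n => ?_)
      (Eventually.of_forall fun n => Eventually.of_forall fun s _ => ?_) ?_
      (Eventually.of_forall fun s _ => ?_)
    · exact Continuous.aestronglyMeasurable (by fun_prop)
    · rw [norm_smul]
      exact mul_le_mul_of_nonneg_left ((hQ n).norm_J_le _) (norm_nonneg _)
    · exact Continuous.intervalIntegrable (by fun_prop) _ _
    · exact ((J.continuous.tendsto _).comp (hlim (y s))).const_smul _
  have hr : Tendsto (fun n => ∫ t in Ioo 0 T, η t • W n t) atTop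
      (𝓝 (∫ t in Ioo 0 T, η t • w t)) := by
    have hηL : MemLp η 2 (volume.restrict (Ioo 0 T)) :=
      memLp_restrict_Ioo_of_continuous hη.continuous T
    refine tendsto_integral_of_L1' _
      (HasL2TimeDeriv.integrable_smul (Lp.memLp w) hη.continuous).aestronglyMeasurable
      (Eventually.of_forall fun n =>
        HasL2TimeDeriv.integrable_smul (Lp.memLp (W n)) hη.continuous) ?_
    have h2 := (Lp.tendsto_Lp_iff_tendsto_eLpNorm' W w).1 hw
    have h3 : Tendsto (fun n => eLpNorm η 2 (volume.restrict (Ioo 0 T))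
        * eLpNorm (⇑(W n) - ⇑w) 2 (volume.restrict (Ioo 0 T))) atTop (𝓝 0) := by
      have := ENNReal.Tendsto.const_mul h2 (Or.inr hηL.eLpNorm_lt_top.ne)
      rwa [mul_zero] at this
    refine tendsto_of_tendsto_of_tendsto_of_le_of_le tendsto_const_nhds h3 (fun _ => zero_le)
      fun n => ?_
    have h4 : (fun t => η t • W n t) - (fun t => η t • w t) = η • (⇑(W n) - ⇑w) := by
      funext t; simp [smul_sub]
    rw [h4]
    exact eLpNorm_smul_le_mul_eLpNorm
      ((Lp.aestronglyMeasurable _).sub (Lp.aestronglyMeasurable _)) hηL.1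
  refine tendsto_nhds_unique hl (hr.neg.congr fun n => ?_)
  rw [(hd n).integral_eq η hη hcη hs]
  congr 1
  refine integral_congr_ae ?_
  filter_upwards [(hd n).memLp.coeFn_toLp] with t ht
  rw [ht]

end LinearExistence

noncomputable section Energy

open ContinuousLinearMap Filter

/-! ### The cubic nonlinearity -/

variable {H L : Type*} [NormedAddCommGroup H] [InnerProductSpace ℂ H]
  [NormedAddCommGroup L] [InnerProductSpace ℂ L]

/-- The properties of `N u = |u|² u` and of its potential `Ψ u = ¼ ∫ |u|⁴` that the well-posedness
proof uses: `N` is locally Lipschitz from `H` to `L`, the convex function `Ψ` has derivative `N`,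
and `Ψ` controls the norm of `L`, with a constant `V` coming from the volume of the domain. -/
structure IsCubic (J : H →L[ℂ] L) (N : H → L) (Ψ : H → ℝ) (k V : ℝ) : Prop where
  k_nonneg : 0 ≤ k
  V_nonneg : 0 ≤ V
  map_zero : N 0 = 0
  norm_sub_le : ∀ x y, ‖N x - N y‖ ≤ k * (‖x‖ + ‖y‖) ^ 2 * ‖x - y‖
  convex : ∀ x y, (⟪N y, J x - J y⟫_ℂ).re ≤ Ψ x - Ψ y
  euler : ∀ x, (⟪J x, N x⟫_ℂ).re = 4 * Ψ x
  norm_sq_le : ∀ x, ∀ ε > 0, ‖J x‖ ^ 2 ≤ ε * Ψ x + V / ε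

namespace IsCubic

variable {J : H →L[ℂ] L} {N : H → L} {Ψ : H → ℝ} {k V : ℝ}

lemma potential_zero (h : IsCubic J N Ψ k V) : Ψ 0 = 0 := by
  have := h.euler 0
  simp at this
  linarith

lemma potential_nonneg (h : IsCubic J N Ψ k V) (x : H) : 0 ≤ Ψ x := by
  have := h.convex x 0
  rw [h.map_zero, h.potential_zero] at this
  simpa using this

lemma norm_le (h : IsCubic J N Ψ k V) (x : H) : ‖N x‖ ≤ k * ‖x‖ ^ 3 := by
  have := h.norm_sub_le x 0
  rw [h.map_zero] at this
  simp only [sub_zero, norm_zero, add_zero] at this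
  linarith [pow_succ ‖x‖ 2]

lemma continuous (h : IsCubic J N Ψ k V) : Continuous N := by
  refine continuous_iff_continuousAt.2 fun x => ?_
  rw [ContinuousAt, tendsto_iff_norm_sub_tendsto_zero]
  refine squeeze_zero (fun _ => norm_nonneg _) (fun y => h.norm_sub_le y x) ?_
  have : Continuous fun y => k * (‖y‖ + ‖x‖) ^ 2 * ‖y - x‖ := by fun_prop
  have h2 := this.tendsto x
  simpa using h2

/-- The potential is differentiable: by convexity its difference quotients lie between values of the
continuous map `N`. -/
lemma hasFDerivAt (h : IsCubic J N Ψ k V) (x : H) :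
    HasFDerivAt Ψ (Complex.reCLM ∘L ((innerSL ℂ (N x)) ∘L J).restrictScalars ℝ) x := by
  rw [hasFDerivAt_iff_isLittleO_nhds_zero]
  have h1 : Tendsto (fun y => ‖N (x + y) - N x‖ * ‖J‖) (𝓝 0) (𝓝 0) := by
    have hN := h.continuous
    have : Continuous fun y => ‖N (x + y) - N x‖ * ‖J‖ := by fun_prop
    have h2 := this.tendsto 0
    simpa using h2
  rw [Asymptotics.isLittleO_iff]
  intro c hc
  filter_upwards [h1.eventually (gt_mem_nhds hc)] with y hy
  have h2 := h.convex (x + y) x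
  have h3 := h.convex x (x + y)
  have h4 : (⟪N (x + y) - N x, J y⟫_ℂ).re ≤ c * ‖y‖ := by
    refine (Complex.re_le_norm _).trans ((norm_inner_le_norm _ _).trans ?_)
    calc ‖N (x + y) - N x‖ * ‖J y‖ ≤ ‖N (x + y) - N x‖ * (‖J‖ * ‖y‖) := by
          gcongr; exact J.le_opNorm y
      _ = (‖N (x + y) - N x‖ * ‖J‖) * ‖y‖ := by ring
      _ ≤ c * ‖y‖ := by gcongr
  rw [map_add, add_sub_cancel_left] at h2
  rw [map_add, sub_add_cancel_left, inner_neg_right, Complex.neg_re] at h3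
  rw [inner_sub_left, Complex.sub_re] at h4
  change ‖Ψ (x + y) - Ψ x - (⟪N x, J y⟫_ℂ).re‖ ≤ _
  rw [Real.norm_eq_abs, abs_le]
  constructor
  · have : 0 ≤ c * ‖y‖ := by positivity
    linarith
  · linarith

lemma continuous_potential (h : IsCubic J N Ψ k V) : Continuous Ψ :=
  continuous_iff_continuousAt.2 fun x => (h.hasFDerivAt x).continuousAt

lemma hasDerivWithinAt_potential (h : IsCubic J N Ψ k V) {y : ℝ → H} {y' : H} {s : Set ℝ} {t : ℝ}
    (hy : HasDerivWithinAt y y' s t) :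
    HasDerivWithinAt (fun t => Ψ (y t)) (⟪J y', N (y t)⟫_ℂ).re s t := by
  refine ((h.hasFDerivAt (y t)).comp_hasDerivWithinAt t hy).congr_deriv ?_
  change (⟪N (y t), J y'⟫_ℂ).re = _
  rw [← inner_conj_symm, Complex.conj_re]

lemma potential_le (h : IsCubic J N Ψ k V) (hJ : ∀ x, ‖J x‖ ≤ ‖x‖) {x : H} {R : ℝ}
    (hx : ‖x‖ ≤ R) : Ψ x ≤ k * R ^ 4 := by
  have h1 : 4 * Ψ x ≤ ‖J x‖ * ‖N x‖ := by
    rw [← h.euler]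
    exact (Complex.re_le_norm _).trans (norm_inner_le_norm _ _)
  have h2 : ‖J x‖ * ‖N x‖ ≤ ‖x‖ * (k * ‖x‖ ^ 3) :=
    mul_le_mul (hJ x) (h.norm_le x) (norm_nonneg _) (norm_nonneg _)
  have h3 : k * ‖x‖ ^ 4 ≤ k * R ^ 4 :=
    mul_le_mul_of_nonneg_left (pow_le_pow_left₀ (norm_nonneg _) hx 4) h.k_nonneg
  have h4 := h.potential_nonneg x
  have h5 : ‖x‖ * (k * ‖x‖ ^ 3) = k * ‖x‖ ^ 4 := by ring
  linarith

end IsCubic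

/-! ### The coupled system in integrated form -/

namespace Coeffs

variable (p : Coeffs)

/-- The coefficient `c / 4m` of the Laplacian in the first equation. -/
def kappa : ℝ := p.c / (4 * p.m)

/-- The positive coefficient `1/U - a` of `v` in the energy. -/
def mass : ℝ := 1 / p.U - p.a

/-- The coupling constant `g / U`. -/
def coupling : ℝ := p.g / p.U

/-- The frequency `g²/U + 2ν - 2μ` in the second equation. -/
def freq : ℝ := p.g ^ 2 / p.U + 2 * p.ν - 2 * p.μ

/-- The first equation is parabolic: it reads `v_t = θ Δ v + …` with `Re θ⁻¹ > 0`. -/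
def thetaV : ℂ := Complex.I * p.kappa / p.d

/-- The second equation is dispersive: it reads `φ_t = θ Δ φ + …` with `Re θ = 0`. -/
def thetaPhi : ℂ := Complex.I * ((1 / (4 * p.m) : ℝ) : ℂ)

/-- The coefficient of `φ` on the right-hand side of the second equation written as
`φ_t + θ (1 - Δ) φ = …`. -/
def selfPhi : ℂ := -p.γ - Complex.I * p.freq + p.thetaPhi

/-- The right-hand side of the first equation written as `v_t + θ (1 - Δ) v = …`. -/
def forceV (J : H →L[ℂ] L) (N : H → L) (f v φ : H) : L :=
  p.d⁻¹ • ((Complex.I * ((p.kappa - p.mass : ℝ) : ℂ)) • J v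
    + (Complex.I * (p.coupling : ℂ)) • J φ - (Complex.I * (p.b : ℂ)) • N v + J f)

/-- The right-hand side of the second equation written as `φ_t + θ (1 - Δ) φ = …`. -/
def forcePhi (h v φ : H) : H :=
  p.selfPhi • φ + (Complex.I * (p.coupling : ℂ)) • v + h

variable {p}

lemma Admissible.kappa_pos (hp : p.Admissible) : 0 < p.kappa :=
  div_pos hp.c_pos (mul_pos four_pos hp.m_pos)

lemma Admissible.mass_pos (hp : p.Admissible) : 0 < p.mass := by
  rw [mass, sub_pos, lt_div_iff₀ hp.U_pos]
  exact hp.aU_lt_one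

lemma Admissible.d_ne_zero (hp : p.Admissible) : p.d ≠ 0 := by
  intro h
  have := hp.d_im_pos
  simp [h] at this

lemma Admissible.thetaV_inv_re_pos (hp : p.Admissible) : 0 < (p.thetaV⁻¹).re := by
  have h1 : p.thetaV⁻¹ = ((p.kappa⁻¹ : ℝ) : ℂ) * (-Complex.I * p.d) := by
    rw [thetaV]
    have := hp.kappa_pos.ne'
    push_cast
    rw [inv_div, div_eq_mul_inv, mul_inv, Complex.inv_I]
    ring
  rw [h1, Complex.re_ofReal_mul]
  have := hp.d_im_pos
  have := inv_pos.2 hp.kappa_pos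
  simp
  positivity

lemma thetaPhi_re : p.thetaPhi.re = 0 := by simp [thetaPhi]

end Coeffs

lemma continuous_forceV {p : Coeffs} {J : H →L[ℂ] L} {N : H → L} (hN : Continuous N) (f : H)
    {v φ : ℝ → H} (hv : Continuous v) (hφ : Continuous φ) :
    Continuous fun t => p.forceV J N f (v t) (φ t) := by
  unfold Coeffs.forceV
  fun_prop

lemma continuous_forcePhi {H : Type*} [NormedAddCommGroup H] [InnerProductSpace ℂ H]
    {p : Coeffs} (h : H) {v φ : ℝ → H} (hv : Continuous v) (hφ : Continuous φ) :
    Continuous fun t => p.forcePhi h (v t) (φ t) := by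
  unfold Coeffs.forcePhi
  fun_prop

variable [CompleteSpace H] [CompleteSpace L]

/-- The coupled system on `[0, T]` in integrated form. -/
structure IsMildSolution (p : Coeffs) (J : H →L[ℂ] L) (N : H → L) (f h : H) (T : ℝ)
    (v φ : ℝ → H) : Prop where
  solves_v : SolvesLinear J p.thetaV T (fun t => p.forceV J N f (v t) (φ t)) v
  solves_φ : SolvesLinear J p.thetaPhi T (fun t => J (p.forcePhi h (v t) (φ t))) φ

end Energy

noncomputable section Estimates

open ContinuousLinearMap Filter

/-! ### Lipschitz dependence on the data -/

namespace Coeffs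

variable (p : Coeffs)

/-- A Lipschitz constant of the first force, for a nonlinearity with Lipschitz constant `K`. -/
def lipV (K : ℝ) : ℝ :=
  ‖p.d⁻¹‖ * (|p.kappa - p.mass| + |p.coupling| + |p.b| * K)

/-- A Lipschitz constant of the second force. -/
def lipPhi : ℝ := ‖p.selfPhi‖ + |p.coupling|

/-- The constant in front of the squared force in the parabolic energy estimate. -/
def energyConst : ℝ := ‖p.thetaV⁻¹‖ ^ 2 / (p.thetaV⁻¹).re

/-- The exponential growth rate in the Lipschitz estimate, for a nonlinearity with Lipschitz
constant `K`. -/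
def growthRate (K : ℝ) : ℝ :=
  p.energyConst * (2 * p.lipV K ^ 2) + (1 + 2 * p.lipPhi ^ 2)

variable {p}

lemma Admissible.energyConst_nonneg (hp : p.Admissible) : 0 ≤ p.energyConst :=
  div_nonneg (by positivity) hp.thetaV_inv_re_pos.le

lemma Admissible.growthRate_pos (hp : p.Admissible) (K : ℝ) : 0 < p.growthRate K := by
  have := hp.energyConst_nonneg
  unfold growthRate
  positivity

end Coeffs

lemma add_sq_mul_le (C x y : ℝ) : (C * (x + y)) ^ 2 ≤ 2 * C ^ 2 * (x ^ 2 + y ^ 2) := by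
  nlinarith [mul_nonneg (sq_nonneg C) (sq_nonneg (x - y))]

lemma norm_I_mul_ofReal (x : ℝ) : ‖Complex.I * (x : ℂ)‖ = |x| := by simp

variable {H L : Type*} [NormedAddCommGroup H] [InnerProductSpace ℂ H]
  [NormedAddCommGroup L] [InnerProductSpace ℂ L]
  {p : Coeffs} {J : H →L[ℂ] L} {N : H → L} {Ψ : H → ℝ} {k V T : ℝ} {f h : H}

lemma norm_forceV_sub_le (hJ : ∀ x, ‖J x‖ ≤ ‖x‖) {K : ℝ} (hK : 0 ≤ K) (f v₁ φ₁ v₂ φ₂ : H)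
    (hN : ‖N v₁ - N v₂‖ ≤ K * ‖v₁ - v₂‖) :
    ‖p.forceV J N f v₁ φ₁ - p.forceV J N f v₂ φ₂‖ ≤ p.lipV K * (‖v₁ - v₂‖ + ‖φ₁ - φ₂‖) := by
  have h1 : p.forceV J N f v₁ φ₁ - p.forceV J N f v₂ φ₂
      = p.d⁻¹ • ((Complex.I * ((p.kappa - p.mass : ℝ) : ℂ)) • J (v₁ - v₂)
        + (Complex.I * (p.coupling : ℂ)) • J (φ₁ - φ₂)
        - (Complex.I * (p.b : ℂ)) • (N v₁ - N v₂)) := by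
    simp only [Coeffs.forceV, map_sub, smul_sub, smul_add]
    abel
  rw [h1, norm_smul, Coeffs.lipV, mul_assoc]
  refine mul_le_mul_of_nonneg_left ?_ (norm_nonneg _)
  refine (norm_sub_le _ _).trans ((add_le_add_left (norm_add_le _ _) _).trans ?_)
  rw [norm_smul, norm_smul, norm_smul, norm_I_mul_ofReal, norm_I_mul_ofReal, norm_I_mul_ofReal]
  have e1 := mul_le_mul_of_nonneg_left (hJ (v₁ - v₂)) (abs_nonneg (p.kappa - p.mass))
  have e2 := mul_le_mul_of_nonneg_left (hJ (φ₁ - φ₂)) (abs_nonneg p.coupling)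
  have e3 := mul_le_mul_of_nonneg_left hN (abs_nonneg p.b)
  have e4 : 0 ≤ |p.kappa - p.mass| * ‖φ₁ - φ₂‖ := by positivity
  have e5 : 0 ≤ |p.coupling| * ‖v₁ - v₂‖ := by positivity
  have e6 : 0 ≤ |p.b| * K * ‖φ₁ - φ₂‖ := by positivity
  linarith

lemma norm_forcePhi_sub_le (h v₁ φ₁ v₂ φ₂ : H) :
    ‖p.forcePhi h v₁ φ₁ - p.forcePhi h v₂ φ₂‖ ≤ p.lipPhi * (‖v₁ - v₂‖ + ‖φ₁ - φ₂‖) := by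
  have h1 : p.forcePhi h v₁ φ₁ - p.forcePhi h v₂ φ₂
      = p.selfPhi • (φ₁ - φ₂) + (Complex.I * (p.coupling : ℂ)) • (v₁ - v₂) := by
    simp only [Coeffs.forcePhi, smul_sub]
    abel
  rw [h1, Coeffs.lipPhi]
  refine (norm_add_le _ _).trans ?_
  rw [norm_smul, norm_smul, norm_I_mul_ofReal]
  have e4 : 0 ≤ ‖p.selfPhi‖ * ‖v₁ - v₂‖ := by positivity
  have e5 : 0 ≤ |p.coupling| * ‖φ₁ - φ₂‖ := by positivity
  linarith

variable [CompleteSpace H] [CompleteSpace L]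

/-- Two solutions whose first components stay in a set where `N` is `K`-Lipschitz depend
Lipschitz continuously on their initial data, the time derivative of the first component
included. -/
lemma IsMildSolution.norm_sub_sq_le (hp : p.Admissible) (hJ : Function.Injective J)
    (hJd : DenseRange J) (hJ1 : ∀ x, ‖J x‖ ≤ ‖x‖) (hN : Continuous N) {v₁ φ₁ v₂ φ₂ : ℝ → H}
    (h₁ : IsMildSolution p J N f h T v₁ φ₁) (h₂ : IsMildSolution p J N f h T v₂ φ₂)
    {K : ℝ} (hK : 0 ≤ K) (hlip : ∀ t ∈ Icc 0 T, ‖N (v₁ t) - N (v₂ t)‖ ≤ K * ‖v₁ t - v₂ t‖)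
    {w : ℝ → L} (hw : HasL2TimeDeriv T (fun t => J (v₁ t - v₂ t)) w) {t : ℝ} (ht : t ∈ Icc 0 T) :
    ‖v₁ t - v₂ t‖ ^ 2 + ‖φ₁ t - φ₂ t‖ ^ 2
      + (p.thetaV⁻¹).re * ∫ s in (0 : ℝ)..t, ‖w s‖ ^ 2
      ≤ (‖v₁ 0 - v₂ 0‖ ^ 2 + ‖φ₁ 0 - φ₂ 0‖ ^ 2) * Real.exp (p.growthRate K * t) := by
  have hv₁ := h₁.solves_v.continuous
  have hv₂ := h₂.solves_v.continuous
  have hφ₁ := h₁.solves_φ.continuous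
  have hφ₂ := h₂.solves_φ.continuous
  have hF₁ := continuous_forceV (p := p) (J := J) hN f hv₁ hφ₁
  have hF₂ := continuous_forceV (p := p) (J := J) hN f hv₂ hφ₂
  have hG₁ := continuous_forcePhi (p := p) h hv₁ hφ₁
  have hG₂ := continuous_forcePhi (p := p) h hv₂ hφ₂
  have hv := h₁.solves_v.sub hF₁ hF₂ h₂.solves_v
  have hφ : SolvesLinear J p.thetaPhi T
      (fun t => J (p.forcePhi h (v₁ t) (φ₁ t) - p.forcePhi h (v₂ t) (φ₂ t)))
      (fun t => φ₁ t - φ₂ t) := by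
    simp only [map_sub]
    exact h₁.solves_φ.sub (J.continuous.comp hG₁) (J.continuous.comp hG₂) h₂.solves_φ
  have hF : Continuous fun t => p.forceV J N f (v₁ t) (φ₁ t) - p.forceV J N f (v₂ t) (φ₂ t) :=
    hF₁.sub hF₂
  have hG : Continuous fun t => p.forcePhi h (v₁ t) (φ₁ t) - p.forcePhi h (v₂ t) (φ₂ t) :=
    hG₁.sub hG₂
  set X : ℝ → ℝ := fun t => ‖v₁ t - v₂ t‖ ^ 2 + ‖φ₁ t - φ₂ t‖ ^ 2 with hX
  have hXc : Continuous X := by fun_prop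
  have key : ∀ t ∈ Icc 0 T, X t + (p.thetaV⁻¹).re * ∫ s in (0 : ℝ)..t, ‖w s‖ ^ 2
      ≤ X 0 + p.growthRate K * ∫ s in (0 : ℝ)..t, X s := by
    intro t ht
    have e1 := hv.norm_sq_add_integral_le hJ hJd hp.thetaV_inv_re_pos hF hw ht
    have e2 := hφ.norm_sq_le_of_re_eq_zero hJ Coeffs.thetaPhi_re hG ht
    have e3 : ∫ s in (0 : ℝ)..t,
        ‖p.forceV J N f (v₁ s) (φ₁ s) - p.forceV J N f (v₂ s) (φ₂ s)‖ ^ 2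
        ≤ ∫ s in (0 : ℝ)..t, 2 * p.lipV K ^ 2 * X s := by
      refine intervalIntegral.integral_mono_on ht.1
        ((hF.norm.pow 2).intervalIntegrable _ _)
        ((hXc.const_mul _).intervalIntegrable _ _) fun s hs => ?_
      refine (pow_le_pow_left₀ (norm_nonneg _) (norm_forceV_sub_le hJ1 hK f _ _ _ _
        (hlip s ⟨hs.1, hs.2.trans ht.2⟩)) 2).trans (add_sq_mul_le _ _ _)
    have e4 : ∫ s in (0 : ℝ)..t, (‖φ₁ s - φ₂ s‖ ^ 2
        + ‖p.forcePhi h (v₁ s) (φ₁ s) - p.forcePhi h (v₂ s) (φ₂ s)‖ ^ 2)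
        ≤ ∫ s in (0 : ℝ)..t, (1 + 2 * p.lipPhi ^ 2) * X s := by
      refine intervalIntegral.integral_mono_on ht.1
        (Continuous.intervalIntegrable (by fun_prop) _ _)
        ((hXc.const_mul _).intervalIntegrable _ _) fun s hs => ?_
      have e5 := (pow_le_pow_left₀ (norm_nonneg _) (norm_forcePhi_sub_le (p := p) h (v₁ s) (φ₁ s)
        (v₂ s) (φ₂ s)) 2).trans (add_sq_mul_le _ _ _)
      have e6 := sq_nonneg ‖v₁ s - v₂ s‖
      simp only [hX]
      linarith
    rw [intervalIntegral.integral_const_mul] at e3 e4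
    have e7 := mul_le_mul_of_nonneg_left e3 hp.energyConst_nonneg
    have e8 : p.growthRate K * ∫ s in (0 : ℝ)..t, X s
        = p.energyConst * (2 * p.lipV K ^ 2 * ∫ s in (0 : ℝ)..t, X s)
          + (1 + 2 * p.lipPhi ^ 2) * ∫ s in (0 : ℝ)..t, X s := by
      rw [Coeffs.growthRate]; ring
    rw [e8]
    rw [← Coeffs.energyConst] at e1
    simp only [hX] at e4 e7 ⊢
    linarith
  have hle : ∀ t ∈ Icc 0 T, X t ≤ X 0 + p.growthRate K * ∫ s in (0 : ℝ)..t, X s := fun t ht => by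
    have e1 := key t ht
    have e2 : 0 ≤ (p.thetaV⁻¹).re * ∫ s in (0 : ℝ)..t, ‖w s‖ ^ 2 :=
      mul_nonneg hp.thetaV_inv_re_pos.le
        (intervalIntegral.integral_nonneg ht.1 fun s _ => by positivity)
    linarith
  exact (key t ht).trans
    (le_mul_exp_of_le_add_integral (hp.growthRate_pos K).le hXc hle t ht)

/-! ### The constants of the a priori bound -/

namespace Coeffs

variable (p : Coeffs)

/-- The weight of `‖φ‖²` in the Lyapunov functional. -/
def weight : ℝ := 2 * (p.coupling ^ 2 / p.d.im + p.coupling ^ 2 / 2) / p.γ + 1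

/-- The coefficient of `‖v‖²` in the dissipation inequality, to be absorbed by the quartic
potential. -/
def lowerOrder : ℝ := ‖p.d‖ ^ 2 / (2 * p.d.im) + 1 + 2 * p.weight * p.coupling ^ 2 / p.γ

/-- The constant term in the dissipation inequality. -/
def source (V K : ℝ) : ℝ := p.lowerOrder ^ 2 * V / (2 * p.b)
  + 2 * (1 / p.d.im + 1 / 2) * K ^ 2 + 2 * p.weight / p.γ * K ^ 2

/-- The decay rate of the Lyapunov functional. -/
def decay : ℝ := min 2 (p.γ / 2)

/-- A bound for the squared norm of the first component of a solution, uniform in time. -/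
def aprioriSq (k V K R : ℝ) : ℝ :=
  2 / min p.kappa p.mass * ((p.kappa / 2 + |p.kappa - p.mass| / 2) * R ^ 2
    + p.b * (k * R ^ 4) + p.weight * R ^ 2 + 2 * (p.source V K / p.decay))

variable {p}

lemma Admissible.weight_pos (hp : p.Admissible) : 0 < p.weight := by
  have := hp.d_im_pos
  have := hp.γ_pos
  unfold weight
  positivity

lemma Admissible.lowerOrder_pos (hp : p.Admissible) : 0 < p.lowerOrder := by
  have := hp.d_im_pos
  have := hp.γ_pos
  have := hp.weight_pos
  unfold lowerOrder
  positivity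

lemma Admissible.source_nonneg (hp : p.Admissible) {V : ℝ} (hV : 0 ≤ V) (K : ℝ) :
    0 ≤ p.source V K := by
  have := hp.d_im_pos
  have := hp.γ_pos
  have := hp.b_pos
  have := hp.weight_pos
  unfold source
  positivity

lemma Admissible.decay_pos (hp : p.Admissible) : 0 < p.decay :=
  lt_min two_pos (half_pos hp.γ_pos)

end Coeffs

end Estimates

noncomputable section Apriori

open ContinuousLinearMap Filter

/-! ### The Lyapunov functional -/

variable {H L : Type*} [NormedAddCommGroup H] [InnerProductSpace ℂ H]
  [NormedAddCommGroup L] [InnerProductSpace ℂ L]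

/-- The energy of the first equation, `κ/2 ‖∇v‖² + s/2 ‖v‖² + b/4 ∫ |v|⁴` with `κ` the coefficient
of the Laplacian and `s = 1/U - a`. -/
def Coeffs.energy (p : Coeffs) (J : H →L[ℂ] L) (Ψ : H → ℝ) (v : H) : ℝ :=
  p.kappa / 2 * ‖v‖ ^ 2 - (p.kappa - p.mass) / 2 * ‖J v‖ ^ 2 + p.b * Ψ v

/-- The Lyapunov functional of the coupled system. -/
def Coeffs.lyapunov (p : Coeffs) (J : H →L[ℂ] L) (Ψ : H → ℝ) (v φ : H) : ℝ :=
  p.energy J Ψ v + p.weight * ‖J φ‖ ^ 2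

variable {p : Coeffs} {J : H →L[ℂ] L} {N : H → L} {Ψ : H → ℝ} {k V T K : ℝ} {f h : H}

/-- The energy controls the norm of `H` because both `κ` and `1/U - a` are positive. -/
lemma energy_ge (hp : p.Admissible) (hN : IsCubic J N Ψ k V) (hJ1 : ∀ x, ‖J x‖ ≤ ‖x‖) (v : H) :
    min p.kappa p.mass / 2 * ‖v‖ ^ 2 ≤ p.energy J Ψ v := by
  have h1 := mul_nonneg hp.b_pos.le (hN.potential_nonneg v)
  have h2 := pow_le_pow_left₀ (norm_nonneg _) (hJ1 v) 2
  have h3 := mul_le_mul_of_nonneg_right (min_le_left p.kappa p.mass) (sub_nonneg.2 h2)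
  have h4 := mul_le_mul_of_nonneg_right (min_le_right p.kappa p.mass) (sq_nonneg ‖J v‖)
  unfold Coeffs.energy
  linarith

lemma energy_nonneg (hp : p.Admissible) (hN : IsCubic J N Ψ k V) (hJ1 : ∀ x, ‖J x‖ ≤ ‖x‖)
    (v : H) : 0 ≤ p.energy J Ψ v := by
  refine le_trans ?_ (energy_ge hp hN hJ1 v)
  have := lt_min hp.kappa_pos hp.mass_pos
  positivity

lemma mul_le_young {c : ℝ} (hc : 0 < c) (x y : ℝ) : x * y ≤ c / 4 * x ^ 2 + y ^ 2 / c := by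
  have h1 : 0 ≤ (c * x / 2 - y) ^ 2 / c := by positivity
  have h2 : (c * x / 2 - y) ^ 2 / c = c / 4 * x ^ 2 + y ^ 2 / c - x * y := by
    field_simp
    ring
  linarith

/-- The quartic potential absorbs the norm of `L`. -/
lemma lowerOrder_mul_le (hp : p.Admissible) (hN : IsCubic J N Ψ k V) (v : H) :
    p.lowerOrder * ‖J v‖ ^ 2 ≤ 2 * (p.b * Ψ v) + p.lowerOrder ^ 2 * V / (2 * p.b) := by
  have hlo := hp.lowerOrder_pos
  have hb0 := hp.b_pos
  have h1 := mul_le_mul_of_nonneg_left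
    (hN.norm_sq_le v (2 * p.b / p.lowerOrder) (by positivity)) hlo.le
  have h2 : p.lowerOrder * (2 * p.b / p.lowerOrder * Ψ v + V / (2 * p.b / p.lowerOrder))
      = 2 * (p.b * Ψ v) + p.lowerOrder ^ 2 * V / (2 * p.b) := by
    field_simp
  exact h1.trans h2.le

lemma decay_mul_lyapunov_le (hp : p.Admissible) (hN : IsCubic J N Ψ k V)
    (hJ1 : ∀ x, ‖J x‖ ≤ ‖x‖) (v φ : H) :
    p.decay * p.lyapunov J Ψ v φ
      ≤ 2 * p.energy J Ψ v + p.γ / 2 * (p.weight * ‖J φ‖ ^ 2) := by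
  have hM := hp.weight_pos
  have h1 := mul_le_mul_of_nonneg_right (min_le_left 2 (p.γ / 2)) (energy_nonneg hp hN hJ1 v)
  have h2 := mul_le_mul_of_nonneg_right (min_le_right 2 (p.γ / 2))
    (show 0 ≤ p.weight * ‖J φ‖ ^ 2 by positivity)
  rw [Coeffs.lyapunov, Coeffs.decay, mul_add]
  exact add_le_add h1 h2

lemma lyapunov_le_of_norm_le (hp : p.Admissible) (hN : IsCubic J N Ψ k V)
    (hJ1 : ∀ x, ‖J x‖ ≤ ‖x‖) {v φ : H} {R : ℝ} (hv : ‖v‖ ≤ R) (hφ : ‖φ‖ ≤ R) :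
    p.lyapunov J Ψ v φ ≤ (p.kappa / 2 + |p.kappa - p.mass| / 2) * R ^ 2
      + p.b * (k * R ^ 4) + p.weight * R ^ 2 := by
  have e2 := pow_le_pow_left₀ (norm_nonneg _) hv 2
  have e3 := pow_le_pow_left₀ (norm_nonneg _) ((hJ1 _).trans hv) 2
  have e4 := pow_le_pow_left₀ (norm_nonneg _) ((hJ1 _).trans hφ) 2
  have e5 := mul_le_mul_of_nonneg_left (hN.potential_le hJ1 hv) hp.b_pos.le
  have e6 := mul_le_mul_of_nonneg_left e2 (half_pos hp.kappa_pos).le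
  have e7 := mul_le_mul_of_nonneg_left e4 hp.weight_pos.le
  have e8 : -(p.kappa - p.mass) / 2 * ‖J v‖ ^ 2 ≤ |p.kappa - p.mass| / 2 * R ^ 2 := by
    have := neg_le_abs (p.kappa - p.mass)
    exact mul_le_mul (by linarith) e3 (by positivity) (by positivity)
  unfold Coeffs.lyapunov Coeffs.energy
  linarith only [e5, e6, e7, e8]

lemma tendsto_lyapunov (hΨ : Continuous Ψ) {v φ : ℕ → H} {v₀ φ₀ : H}
    (hv : Tendsto v atTop (𝓝 v₀)) (hφ : Tendsto φ atTop (𝓝 φ₀)) :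
    Tendsto (fun n => p.lyapunov J Ψ (v n) (φ n)) atTop (𝓝 (p.lyapunov J Ψ v₀ φ₀)) := by
  have hJv := (J.continuous.tendsto v₀).comp hv
  have hJφ := (J.continuous.tendsto φ₀).comp hφ
  have hΨv := (hΨ.tendsto v₀).comp hv
  exact ((((hv.norm.pow 2).const_mul _).sub ((hJv.norm.pow 2).const_mul _)).add
    (hΨv.const_mul _)).add ((hJφ.norm.pow 2).const_mul _)

variable [CompleteSpace H] [CompleteSpace L]

lemma re_inner_comm {E : Type*} [NormedAddCommGroup E] [InnerProductSpace ℂ E] (x y : E) :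
    (⟪x, y⟫_ℂ).re = (⟪y, x⟫_ℂ).re := by
  rw [← inner_conj_symm, Complex.conj_re]

lemma re_inner_self {E : Type*} [NormedAddCommGroup E] [InnerProductSpace ℂ E] (x : E) :
    (⟪x, x⟫_ℂ).re = ‖x‖ ^ 2 := by
  rw [inner_self_eq_norm_sq_to_K]
  simp [← Complex.ofReal_pow]

lemma mul_re_inner_le_young {E : Type*} [NormedAddCommGroup E] [InnerProductSpace ℂ E] {c : ℝ}
    (hc : 0 < c) (r : ℝ) (x y : E) :
    r * (⟪x, y⟫_ℂ).re ≤ c / 4 * ‖x‖ ^ 2 + r ^ 2 * ‖y‖ ^ 2 / c := by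
  have h1 : r * (⟪x, y⟫_ℂ).re ≤ ‖x‖ * (|r| * ‖y‖) := by
    refine (le_abs_self _).trans ?_
    rw [abs_mul, mul_left_comm]
    exact mul_le_mul_of_nonneg_left ((Complex.abs_re_le_norm _).trans (norm_inner_le_norm _ _))
      (abs_nonneg _)
  have h2 := mul_le_young hc ‖x‖ (|r| * ‖y‖)
  rw [mul_pow, sq_abs] at h2
  exact h1.trans h2

/-- The first equation, multiplied by `-i d` and tested with `z`. -/
lemma inner_forceV (hp : p.Admissible) {v v' φ : H} {e : L}
    (hv : gram J v' = adjoint J (p.forceV J N f v φ + (Complex.I * p.d⁻¹) • e) - p.thetaV • v)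
    (z : H) :
    ((-Complex.I * p.d) * ⟪J z, J v'⟫_ℂ).re
      = (p.kappa - p.mass) * (⟪J z, J v⟫_ℂ).re + p.coupling * (⟪J z, J φ⟫_ℂ).re
        - p.b * (⟪J z, N v⟫_ℂ).re + (⟪J z, e - Complex.I • J f⟫_ℂ).re
        - p.kappa * (⟪z, v⟫_ℂ).re := by
  have hd := hp.d_ne_zero
  set X : L := ((p.kappa - p.mass : ℝ) : ℂ) • J v + (p.coupling : ℂ) • J φ - (p.b : ℂ) • N v
    + (e - Complex.I • J f) with hX
  have h1 : (-Complex.I * p.d) • gram J v' = adjoint J X - (p.kappa : ℂ) • v := by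
    rw [hv, smul_sub, ← map_smul, smul_smul]
    congr 2
    · rw [Coeffs.forceV, smul_add, smul_smul, mul_assoc, mul_inv_cancel₀ hd, mul_one, smul_smul,
        hX]
      have e1 : -Complex.I * p.d * (Complex.I * p.d⁻¹) = 1 := by
        rw [mul_mul_mul_comm, mul_inv_cancel₀ hd, neg_mul, Complex.I_mul_I]; simp
      rw [e1]
      simp only [smul_add, smul_sub, smul_smul, ← mul_assoc, neg_mul, Complex.I_mul_I, neg_neg,
        one_mul, one_smul, neg_smul]
      abel
    · rw [Coeffs.thetaV]
      rw [div_eq_mul_inv, mul_comm _ p.d⁻¹, ← mul_assoc, mul_assoc (-Complex.I),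
        mul_inv_cancel₀ hd, mul_one, ← mul_assoc, neg_mul, Complex.I_mul_I]
      simp
  have h2 := congrArg (fun x => ⟪z, x⟫_ℂ) h1
  simp only [inner_smul_right, inner_sub_right, inner_gram, adjoint_inner_right] at h2
  rw [h2, hX]
  simp only [inner_add_right, inner_sub_right, inner_smul_right, Complex.add_re,
    Complex.sub_re, Complex.re_ofReal_mul]

/-- The energy inequality for the first equation: it is tested with the time derivative of `v`. -/
lemma energy_deriv_le (hp : p.Admissible) {v v' φ : H} {e : L}
    (hv : gram J v' = adjoint J (p.forceV J N f v φ + (Complex.I * p.d⁻¹) • e) - p.thetaV • v) :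
    p.kappa * (⟪v, v'⟫_ℂ).re - (p.kappa - p.mass) * (⟪J v, J v'⟫_ℂ).re + p.b * (⟪J v', N v⟫_ℂ).re
      ≤ -(p.d.im / 2 * ‖J v'‖ ^ 2) + p.coupling ^ 2 * ‖J φ‖ ^ 2 / p.d.im
        + ‖e - Complex.I • J f‖ ^ 2 / p.d.im := by
  have h1 := inner_forceV hp hv v'
  have h2 : ((-Complex.I * p.d) * ⟪J v', J v'⟫_ℂ).re = p.d.im * ‖J v'‖ ^ 2 := by
    rw [inner_self_eq_norm_sq_to_K]
    simp [← Complex.ofReal_pow]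
  have h3 := mul_re_inner_le_young hp.d_im_pos p.coupling (J v') (J φ)
  have h4 := mul_re_inner_le_young hp.d_im_pos 1 (J v') (e - Complex.I • J f)
  rw [one_mul, one_pow, one_mul] at h4
  rw [re_inner_comm v, re_inner_comm (J v)]
  linarith only [h1, h2, h3, h4]

/-- The first equation tested with `v`. -/
lemma energy_le_of_eq (hp : p.Admissible) (hN : IsCubic J N Ψ k V) {v v' φ : H} {e : L}
    (hv : gram J v' = adjoint J (p.forceV J N f v φ + (Complex.I * p.d⁻¹) • e) - p.thetaV • v) :
    2 * p.energy J Ψ v + 2 * (p.b * Ψ v)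
      ≤ p.d.im / 2 * ‖J v'‖ ^ 2 + ‖p.d‖ ^ 2 * ‖J v‖ ^ 2 / (2 * p.d.im) + ‖J v‖ ^ 2
        + p.coupling ^ 2 * ‖J φ‖ ^ 2 / 2 + ‖e - Complex.I • J f‖ ^ 2 / 2 := by
  have h1 := inner_forceV hp hv v
  have hρ := hp.d_im_pos
  have h2 : -((-Complex.I * p.d) * ⟪J v, J v'⟫_ℂ).re
      ≤ 2 * p.d.im / 4 * ‖J v'‖ ^ 2 + ‖p.d‖ ^ 2 * ‖J v‖ ^ 2 / (2 * p.d.im) := by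
    have h1 : -((-Complex.I * p.d) * ⟪J v, J v'⟫_ℂ).re ≤ ‖J v'‖ * (‖p.d‖ * ‖J v‖) := by
      refine (neg_le_abs _).trans ((Complex.abs_re_le_norm _).trans ?_)
      rw [norm_mul]
      have : ‖-Complex.I * p.d‖ = ‖p.d‖ := by simp
      rw [this, mul_left_comm, mul_comm ‖J v'‖]
      exact mul_le_mul_of_nonneg_left (norm_inner_le_norm _ _) (norm_nonneg _)
    have h2 := mul_le_young (show 0 < 2 * p.d.im by positivity) ‖J v'‖ (‖p.d‖ * ‖J v‖)
    rw [mul_pow] at h2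
    exact h1.trans h2
  have h3 := mul_re_inner_le_young two_pos p.coupling (J v) (J φ)
  have h4 := mul_re_inner_le_young two_pos 1 (J v) (e - Complex.I • J f)
  rw [one_mul, one_pow, one_mul] at h4
  rw [re_inner_self, re_inner_self, hN.euler] at h1
  rw [Coeffs.energy]
  linarith only [h1, h2, h3, h4]

/-- The second equation tested with `φ`. -/
lemma norm_phi_deriv_le (hp : p.Admissible) {v φ φ' : H} (hh : ‖J h‖ ≤ K)
    (hφ : gram J φ' = gram J (p.forcePhi h v φ) - p.thetaPhi • φ) :
    2 * (⟪J φ, J φ'⟫_ℂ).re ≤ -(p.γ * ‖J φ‖ ^ 2) + 2 / p.γ * (p.coupling ^ 2 * ‖J v‖ ^ 2)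
      + 2 / p.γ * K ^ 2 := by
  have hγ := hp.γ_pos
  have hc : (⟪J φ, J φ'⟫_ℂ).re
      ≤ -p.γ * ‖J φ‖ ^ 2 + ‖J φ‖ * (|p.coupling| * ‖J v‖ + ‖J h‖) := by
    have h1 : ⟪J φ, J φ'⟫_ℂ = ⟪J φ, J (p.forcePhi h v φ)⟫_ℂ - p.thetaPhi * ⟪φ, φ⟫_ℂ := by
      have := congrArg (fun x => ⟪φ, x⟫_ℂ) hφ
      simpa only [inner_gram, inner_sub_right, inner_smul_right] using this
    have h2 : (p.thetaPhi * ⟪φ, φ⟫_ℂ).re = 0 := by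
      rw [inner_self_eq_norm_sq_to_K, Complex.mul_re, Coeffs.thetaPhi_re]
      simp [← Complex.ofReal_pow]
    have h3 : (p.selfPhi * ⟪J φ, J φ⟫_ℂ).re = -p.γ * ‖J φ‖ ^ 2 := by
      rw [inner_self_eq_norm_sq_to_K, Complex.mul_re, Coeffs.selfPhi]
      simp [← Complex.ofReal_pow, Coeffs.thetaPhi_re]
    have h4 : ((Complex.I * (p.coupling : ℂ)) * ⟪J φ, J v⟫_ℂ).re
        ≤ |p.coupling| * (‖J φ‖ * ‖J v‖) := by
      refine (Complex.re_le_norm _).trans ?_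
      rw [norm_mul, norm_I_mul_ofReal]
      exact mul_le_mul_of_nonneg_left (norm_inner_le_norm _ _) (abs_nonneg _)
    have h5 : (⟪J φ, J h⟫_ℂ).re ≤ ‖J φ‖ * ‖J h‖ :=
      (Complex.re_le_norm _).trans (norm_inner_le_norm _ _)
    rw [h1, Complex.sub_re, h2, Coeffs.forcePhi, map_add, map_add, map_smul, map_smul,
      inner_add_right, inner_add_right, inner_smul_right, inner_smul_right, Complex.add_re,
      Complex.add_re, h3]
    linarith only [h4, h5]
  have h1 := mul_le_young (show 0 < 2 * p.γ by positivity) ‖J φ‖ (|p.coupling| * ‖J v‖ + ‖J h‖)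
  have h2 : (|p.coupling| * ‖J v‖ + ‖J h‖) ^ 2
      ≤ 2 * (p.coupling ^ 2 * ‖J v‖ ^ 2) + 2 * K ^ 2 := by
    have e1 := pow_le_pow_left₀ (norm_nonneg _) hh 2
    have e2 := sq_nonneg (|p.coupling| * ‖J v‖ - ‖J h‖)
    have e3 : p.coupling ^ 2 = |p.coupling| ^ 2 := (sq_abs _).symm
    rw [e3]
    linarith only [e1, e2]
  have h3 := div_le_div_of_nonneg_right h2 (show 0 ≤ 2 * p.γ by positivity)
  have h4 : (2 * (p.coupling ^ 2 * ‖J v‖ ^ 2) + 2 * K ^ 2) / (2 * p.γ)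
      = 1 / p.γ * (p.coupling ^ 2 * ‖J v‖ ^ 2) + 1 / p.γ * K ^ 2 := by
    field_simp
  have h5 : 2 / p.γ = 2 * (1 / p.γ) := by ring
  rw [h4] at h3
  rw [h5]
  linarith only [hc, h1, h3]

/-- The dissipation inequality for the Lyapunov functional. The first equation is tested with the
time derivative of `v` and with `v`, the second one with `φ`; the quartic potential absorbs the
terms of lower order. The term `e` is the error made by a spectral cutoff. -/
lemma dissipation_le (hp : p.Admissible) (hN : IsCubic J N Ψ k V) (hJ1 : ∀ x, ‖J x‖ ≤ ‖x‖)
    {v v' φ φ' : H} {e : L} (hf : ‖J f‖ ≤ K) (hh : ‖J h‖ ≤ K)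
    (hv : gram J v' = adjoint J (p.forceV J N f v φ + (Complex.I * p.d⁻¹) • e) - p.thetaV • v)
    (hφ : gram J φ' = gram J (p.forcePhi h v φ) - p.thetaPhi • φ) :
    p.kappa * (⟪v, v'⟫_ℂ).re - (p.kappa - p.mass) * (⟪J v, J v'⟫_ℂ).re
        + p.b * (⟪J v', N v⟫_ℂ).re + p.weight * (2 * (⟪J φ, J φ'⟫_ℂ).re)
      ≤ -p.decay * p.lyapunov J Ψ v φ
        + p.source V K + 2 * (1 / p.d.im + 1 / 2) * ‖e‖ ^ 2 := by
  have hρ := hp.d_im_pos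
  have hγ := hp.γ_pos
  have hF : ‖e - Complex.I • J f‖ ^ 2 ≤ 2 * ‖e‖ ^ 2 + 2 * K ^ 2 := by
    have h1 : ‖e - Complex.I • J f‖ ≤ ‖e‖ + K := by
      refine (norm_sub_le _ _).trans ?_
      rw [norm_smul, Complex.norm_I, one_mul]
      linarith only [hf]
    have h2 := pow_le_pow_left₀ (norm_nonneg _) h1 2
    linarith only [h2, sq_nonneg (‖e‖ - K)]
  have hF2 := mul_le_mul_of_nonneg_left hF (show 0 ≤ 1 / p.d.im + 1 / 2 by positivity)
  have hV := energy_deriv_le hp hv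
  have hE := energy_le_of_eq hp hN hv
  have hΦ := mul_le_mul_of_nonneg_left (norm_phi_deriv_le hp hh hφ) hp.weight_pos.le
  have hvol := lowerOrder_mul_le hp hN v
  have hdec := decay_mul_lyapunov_le hp hN hJ1 v φ
  have hMγ : p.weight * (p.γ * ‖J φ‖ ^ 2) = 2 * (p.coupling ^ 2 * ‖J φ‖ ^ 2 / p.d.im
      + p.coupling ^ 2 * ‖J φ‖ ^ 2 / 2) + p.γ * ‖J φ‖ ^ 2 := by
    rw [Coeffs.weight]
    field_simp
  have hlow : p.lowerOrder * ‖J v‖ ^ 2 = ‖p.d‖ ^ 2 * ‖J v‖ ^ 2 / (2 * p.d.im) + ‖J v‖ ^ 2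
      + p.weight * (2 / p.γ * (p.coupling ^ 2 * ‖J v‖ ^ 2)) := by
    rw [Coeffs.lowerOrder]; ring
  have hsrc : p.source V K = p.lowerOrder ^ 2 * V / (2 * p.b)
      + 2 * (1 / p.d.im + 1 / 2) * K ^ 2 + p.weight * (2 / p.γ * K ^ 2) := by
    rw [Coeffs.source]; ring
  have hγq : 0 ≤ p.γ * ‖J φ‖ ^ 2 := by positivity
  have hF4 : ‖e - Complex.I • J f‖ ^ 2 / p.d.im + ‖e - Complex.I • J f‖ ^ 2 / 2
      = (1 / p.d.im + 1 / 2) * ‖e - Complex.I • J f‖ ^ 2 := by ring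
  rw [hsrc]
  rw [hlow] at hvol
  linarith only [hV, hE, hΦ, hvol, hdec, hMγ, hγq, hF2, hF4]

/-- The error that a spectral cutoff makes in the nonlinear term. -/
def cutoffError (p : Coeffs) (J : H →L[ℂ] L) (N : H → L) (Q A : H →L[ℂ] H) (v : H) : L :=
  (p.b : ℂ) • (N (Q v) - cutoffL J Q A (N v))

lemma continuous_cutoffError (hN : Continuous N) (Q A : H →L[ℂ] H) :
    Continuous (cutoffError p J N Q A) := by
  unfold cutoffError
  fun_prop

lemma norm_cutoffError_le (hN : IsCubic J N Ψ k V) {Q A : H →L[ℂ] H} (hQ : IsCutoff J Q A)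
    (v : H) : ‖cutoffError p J N Q A v‖ ≤ |p.b| * (k * ‖v‖ ^ 3 + k * ‖v‖ ^ 3) := by
  rw [cutoffError, norm_smul, Complex.norm_real, Real.norm_eq_abs]
  refine mul_le_mul_of_nonneg_left ((norm_sub_le _ _).trans (add_le_add ?_ ?_)) (abs_nonneg _)
  · exact (hN.norm_le _).trans (mul_le_mul_of_nonneg_left
      (pow_le_pow_left₀ (norm_nonneg _) (hQ.norm_le _) 3) hN.k_nonneg)
  · exact (hQ.norm_cutoffL_le _).trans (hN.norm_le _)

/-- A spectral cutoff commutes with the linear part of the force; the nonlinear part contributes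
`cutoffError`. -/
lemma cutoffL_forceV {Q A : H →L[ℂ] H} (hQ : IsCutoff J Q A) (v φ : H) :
    cutoffL J Q A (p.forceV J N f v φ) = p.forceV J N (Q f) (Q v) (Q φ)
      + (Complex.I * p.d⁻¹) • cutoffError p J N Q A v := by
  simp only [Coeffs.forceV, cutoffError, map_smul, map_add, map_sub, hQ.cutoffL_J]
  module

lemma cutoffL_J_forcePhi {Q A : H →L[ℂ] H} (hQ : IsCutoff J Q A) (v φ : H) :
    cutoffL J Q A (J (p.forcePhi h v φ)) = J (p.forcePhi (Q h) (Q v) (Q φ)) := by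
  rw [hQ.cutoffL_J]
  simp only [Coeffs.forcePhi, map_add, map_smul]

/-- The bound on the Lyapunov functional of a solution after a spectral cutoff. -/
lemma IsMildSolution.lyapunov_cutoff_le (hp : p.Admissible) (hN : IsCubic J N Ψ k V)
    (hJ1 : ∀ x, ‖J x‖ ≤ ‖x‖) {v φ : ℝ → H} (hs : IsMildSolution p J N f h T v φ)
    (hf : ‖f‖ ≤ K) (hh : ‖h‖ ≤ K) {Q A : H →L[ℂ] H} (hQ : IsCutoff J Q A) {t : ℝ}
    (ht : t ∈ Icc 0 T) :
    p.lyapunov J Ψ (Q (v t)) (Q (φ t))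
      ≤ |p.lyapunov J Ψ (Q (v 0)) (Q (φ 0))| + |p.source V K / p.decay|
        + p.source V K / p.decay + ∫ s in (0 : ℝ)..t,
          2 * (1 / p.d.im + 1 / 2) * ‖cutoffError p J N Q A (v s)‖ ^ 2 := by
  have hvc := hs.solves_v.continuous
  have hφc := hs.solves_φ.continuous
  have hFV := continuous_forceV (p := p) (J := J) hN.continuous f hvc hφc
  have hFφ := continuous_forcePhi (p := p) h hvc hφc
  have hec := continuous_cutoffError (p := p) (J := J) hN.continuous Q A
  have hρ := hp.d_im_pos
  have h1 := hs.solves_v.cutoff hQ hFV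
  have h2 := hs.solves_φ.cutoff hQ (J.continuous.comp hFφ)
  let V' : ℝ → H := fun s => A (Q (adjoint J (p.forceV J N f (v s) (φ s)) - p.thetaV • v s))
  let Φ' : ℝ → H := fun s =>
    A (Q (adjoint J (J (p.forcePhi h (v s) (φ s))) - p.thetaPhi • φ s))
  refine le_of_deriv_le_neg_mul_add (T := T) hp.decay_pos
    (y := fun t => p.lyapunov J Ψ (Q (v t)) (Q (φ t)))
    (e := fun s => 2 * (1 / p.d.im + 1 / 2) * ‖cutoffError p J N Q A (v s)‖ ^ 2)
    (y' := fun s => p.kappa * (⟪Q (v s), V' s⟫_ℂ).re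
      - (p.kappa - p.mass) * (⟪J (Q (v s)), J (V' s)⟫_ℂ).re
      + p.b * (⟪J (V' s), N (Q (v s))⟫_ℂ).re
      + p.weight * (2 * (⟪J (Q (φ s)), J (Φ' s)⟫_ℂ).re))
    (by fun_prop) (fun s => by positivity) (fun s hs' => ?_)
    (fun s hs' => ?_) t ht
  · have d1 : HasDerivWithinAt (fun t => Q (v t)) (V' s) (Icc 0 T) s := h1.hasDeriv s hs'
    have d2 : HasDerivWithinAt (fun t => Q (φ t)) (Φ' s) (Icc 0 T) s := h2.hasDeriv s hs'
    have d3 := hasDerivWithinAt_norm_sq d1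
    have d4 := hasDerivWithinAt_norm_sq
      ((J.restrictScalars ℝ).hasFDerivAt.comp_hasDerivWithinAt s d1)
    have d5 := hN.hasDerivWithinAt_potential d1
    have d6 := hasDerivWithinAt_norm_sq
      ((J.restrictScalars ℝ).hasFDerivAt.comp_hasDerivWithinAt s d2)
    refine ((((d3.const_mul (p.kappa / 2)).sub (d4.const_mul ((p.kappa - p.mass) / 2))).add
      (d5.const_mul p.b)).add (d6.const_mul p.weight)).congr_deriv ?_
    simp only [Function.comp_apply, ContinuousLinearMap.coe_restrictScalars']
    ring
  · refine dissipation_le hp hN hJ1 (f := Q f) (h := Q h) (K := K)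
      (e := cutoffError p J N Q A (v s))
      (((hJ1 _).trans (hQ.norm_le _)).trans hf)
      (((hJ1 _).trans (hQ.norm_le _)).trans hh) ?_ ?_
    · refine (h1.eq s hs').trans ?_
      rw [cutoffL_forceV hQ]
    · refine (h2.eq s hs').trans ?_
      simp only [Function.comp_apply, cutoffL_J_forcePhi hQ]
      rfl

lemma tendsto_integral_cutoffError (hN : IsCubic J N Ψ k V) (hJd : DenseRange J)
    {Q A : ℕ → H →L[ℂ] H} (hQ : ∀ n, IsCutoff J (Q n) (A n))
    (hlim : ∀ x, Tendsto (fun n => Q n x) atTop (𝓝 x)) {C : ℝ} (hC : 0 ≤ C) {v : ℝ → H}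
    (hv : Continuous v) (t : ℝ) :
    Tendsto (fun n => ∫ s in (0 : ℝ)..t, C * ‖cutoffError p J N (Q n) (A n) (v s)‖ ^ 2) atTop
      (𝓝 0) := by
  have hNc := hN.continuous
  suffices hlim0 : Tendsto
      (fun n => ∫ s in (0 : ℝ)..t, C * ‖cutoffError p J N (Q n) (A n) (v s)‖ ^ 2) atTop
      (𝓝 (∫ s in (0 : ℝ)..t, (0 : ℝ))) by simpa using hlim0
  refine intervalIntegral.tendsto_integral_filter_of_dominated_convergence
    (fun s => C * (|p.b| * (k * ‖v s‖ ^ 3 + k * ‖v s‖ ^ 3)) ^ 2)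
    (Eventually.of_forall fun n => ?_)
    (Eventually.of_forall fun n => Eventually.of_forall fun s _ => ?_) ?_
    (Eventually.of_forall fun s _ => ?_)
  · have := continuous_cutoffError (p := p) (J := J) hNc (Q n) (A n)
    exact Continuous.aestronglyMeasurable (by fun_prop)
  · rw [Real.norm_of_nonneg (by positivity)]
    exact mul_le_mul_of_nonneg_left
      (pow_le_pow_left₀ (norm_nonneg _) (norm_cutoffError_le hN (hQ n) _) 2) hC
  · exact Continuous.intervalIntegrable (by fun_prop) _ _
  · have l1 := (hNc.tendsto _).comp (hlim (v s))
    have l2 := tendsto_cutoffL hJd hQ hlim (N (v s))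
    have l3 := ((((l1.sub l2).const_smul (p.b : ℂ)).norm.pow 2).const_mul C)
    simpa [cutoffError] using l3

/-- The Lyapunov functional of a solution stays bounded, uniformly in time. -/
lemma IsMildSolution.lyapunov_le (hp : p.Admissible) (hN : IsCubic J N Ψ k V)
    (hJ : Function.Injective J) (hJd : DenseRange J) (hJ1 : ∀ x, ‖J x‖ ≤ ‖x‖) {v φ : ℝ → H}
    (hs : IsMildSolution p J N f h T v φ) (hf : ‖f‖ ≤ K) (hh : ‖h‖ ≤ K) {t : ℝ}
    (ht : t ∈ Icc 0 T) :
    p.lyapunov J Ψ (v t) (φ t)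
      ≤ p.lyapunov J Ψ (v 0) (φ 0) + 2 * (p.source V K / p.decay) := by
  obtain ⟨Q, A, hQ, hlim⟩ := exists_isCutoff_tendsto hJ
  have hC0 : 0 ≤ 2 * (1 / p.d.im + 1 / 2) := by have := hp.d_im_pos; positivity
  have he := tendsto_integral_cutoffError (p := p) hN hJd hQ hlim hC0 hs.solves_v.continuous t
  have hl : ∀ s, Tendsto (fun n => p.lyapunov J Ψ (Q n (v s)) (Q n (φ s))) atTop
      (𝓝 (p.lyapunov J Ψ (v s) (φ s))) := fun s =>
    tendsto_lyapunov hN.continuous_potential (hlim (v s)) (hlim (φ s))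
  have hr := (((hl 0).abs.add_const |p.source V K / p.decay|).add_const
    (p.source V K / p.decay)).add he
  have hle : ∀ n, p.lyapunov J Ψ (Q n (v t)) (Q n (φ t))
      ≤ |p.lyapunov J Ψ (Q n (v 0)) (Q n (φ 0))| + |p.source V K / p.decay|
        + p.source V K / p.decay + ∫ s in (0 : ℝ)..t,
          2 * (1 / p.d.im + 1 / 2) * ‖cutoffError p J N (Q n) (A n) (v s)‖ ^ 2 :=
    fun n => hs.lyapunov_cutoff_le hp hN hJ1 hf hh (hQ n) ht
  have hfin := le_of_tendsto_of_tendsto' (hl t) hr hle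
  have hsrc : |p.source V K / p.decay| = p.source V K / p.decay :=
    abs_of_nonneg (div_nonneg (hp.source_nonneg hN.V_nonneg K) hp.decay_pos.le)
  have h0 : 0 ≤ p.lyapunov J Ψ (v 0) (φ 0) :=
    add_nonneg (energy_nonneg hp hN hJ1 _) (mul_nonneg hp.weight_pos.le (by positivity))
  rw [hsrc, abs_of_nonneg h0] at hfin
  linarith only [hfin]

/-- Every solution satisfies a bound on its first component that does not depend on the length of
the time interval. -/
lemma IsMildSolution.norm_v_sq_le (hp : p.Admissible) (hN : IsCubic J N Ψ k V)
    (hJ : Function.Injective J) (hJd : DenseRange J) (hJ1 : ∀ x, ‖J x‖ ≤ ‖x‖) {v φ : ℝ → H}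
    (hs : IsMildSolution p J N f h T v φ) {R : ℝ} (hf : ‖f‖ ≤ K) (hh : ‖h‖ ≤ K)
    (hv0 : ‖v 0‖ ≤ R) (hφ0 : ‖φ 0‖ ≤ R) {t : ℝ} (ht : t ∈ Icc 0 T) :
    ‖v t‖ ^ 2 ≤ p.aprioriSq k V K R := by
  have h1 := hs.lyapunov_le hp hN hJ hJd hJ1 hf hh ht
  have h2 := lyapunov_le_of_norm_le hp hN hJ1 hv0 hφ0
  have hge := energy_ge hp hN hJ1 (v t)
  have hmin := lt_min hp.kappa_pos hp.mass_pos
  have hw : 0 ≤ p.weight * ‖J (φ t)‖ ^ 2 := mul_nonneg hp.weight_pos.le (by positivity)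
  have h3 : min p.kappa p.mass / 2 * ‖v t‖ ^ 2 ≤ p.lyapunov J Ψ (v t) (φ t) := by
    rw [Coeffs.lyapunov]
    linarith only [hge, hw]
  have h4 := mul_le_mul_of_nonneg_left ((h3.trans h1).trans (add_le_add_left h2 _))
    (show 0 ≤ 2 / min p.kappa p.mass by positivity)
  rw [Coeffs.aprioriSq]
  refine le_trans (le_of_eq ?_) h4
  field_simp

end Apriori

noncomputable section Existence

open ContinuousLinearMap Filter

/-! ### Existence for a globally Lipschitz nonlinearity -/

lemma integral_exp_mul_le {lam t : ℝ} (hlam : 0 < lam) :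
    ∫ s in (0 : ℝ)..t, Real.exp (lam * s) ≤ Real.exp (lam * t) / lam := by
  have h1 : ∀ s ∈ uIcc 0 t, HasDerivAt (fun s => Real.exp (lam * s) / lam)
      (Real.exp (lam * s)) s := fun s _ => by
    have := ((hasDerivAt_id s).const_mul lam).exp.div_const lam
    simpa [hlam.ne'] using this
  rw [intervalIntegral.integral_eq_sub_of_hasDerivAt h1
    (Continuous.intervalIntegrable (by fun_prop) _ _)]
  have : 0 ≤ Real.exp (lam * 0) / lam := by positivity
  linarith

/-- A fixed point theorem for Volterra maps on curves. After multiplication of the curves by a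
decreasing exponential the map is a contraction for the supremum norm. -/
lemma exists_fixedPoint_of_integral_le {E : Type*} [NormedAddCommGroup E] [NormedSpace ℝ E]
    [CompleteSpace E] {T C : ℝ} (hT : 0 ≤ T) (hC : 0 ≤ C) (Φ : (ℝ → E) → ℝ → E)
    (hΦ : ∀ u, Continuous u → Continuous (Φ u))
    (hle : ∀ u w, Continuous u → Continuous w → ∀ t ∈ Icc 0 T,
      ‖Φ u t - Φ w t‖ ^ 2 ≤ C * ∫ s in (0 : ℝ)..t, ‖u s - w s‖ ^ 2) :
    ∃ u, Continuous u ∧ EqOn (Φ u) u (Icc 0 T) := by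
  -- With weight `exp (-lam t)` the square of the Lipschitz constant is `C / (2 lam) ≤ 1 / 4`.
  set lam : ℝ := 2 * C + 1 with hlam
  have hlam0 : 0 < lam := by positivity
  let ext : C(Icc (0 : ℝ) T, E) → ℝ → E := fun z t =>
    Real.exp (lam * t) • z ⟨clamp T t, clamp_mem hT t⟩
  have hext : ∀ z, Continuous (ext z) := fun z =>
    (by fun_prop : Continuous fun t => Real.exp (lam * t)).smul
      (z.continuous.comp ((continuous_clamp T).subtype_mk _))
  let G : C(Icc (0 : ℝ) T, E) → C(Icc (0 : ℝ) T, E) := fun z =>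
    ⟨fun t => Real.exp (-(lam * t)) • Φ (ext z) t, by
      have := hΦ _ (hext z)
      fun_prop⟩
  have hG : ContractingWith (1 / 2) G := by
    refine ⟨by norm_num, LipschitzWith.of_dist_le_mul fun z z' => ?_⟩
    rw [ContinuousMap.dist_le (by positivity)]
    rintro ⟨t, ht⟩
    have hd : ∀ s, ‖ext z s - ext z' s‖ ^ 2
        ≤ dist z z' ^ 2 * Real.exp (2 * lam * s) := fun s => by
      simp only [ext]
      rw [← smul_sub, norm_smul, mul_pow, Real.norm_of_nonneg (Real.exp_pos _).le,
        ← Real.exp_nat_mul, mul_comm, ← dist_eq_norm]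
      have e : ((2 : ℕ) : ℝ) * (lam * s) = 2 * lam * s := by push_cast; ring
      rw [e]
      exact mul_le_mul_of_nonneg_right
        (pow_le_pow_left₀ dist_nonneg (ContinuousMap.dist_apply_le_dist _) 2) (Real.exp_pos _).le
    have h1 : ∫ s in (0 : ℝ)..t, ‖ext z s - ext z' s‖ ^ 2
        ≤ dist z z' ^ 2 * (Real.exp (2 * lam * t) / (2 * lam)) := by
      have hz := hext z
      have hz' := hext z'
      refine (intervalIntegral.integral_mono_on ht.1
        (Continuous.intervalIntegrable (by fun_prop) _ _)
        (Continuous.intervalIntegrable (by fun_prop) _ _) fun s _ => hd s).trans ?_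
      rw [intervalIntegral.integral_const_mul]
      exact mul_le_mul_of_nonneg_left (integral_exp_mul_le (by positivity)) (sq_nonneg _)
    have h2 := (hle _ _ (hext z) (hext z') t ht).trans (mul_le_mul_of_nonneg_left h1 hC)
    change dist (Real.exp (-(lam * t)) • Φ (ext z) t) (Real.exp (-(lam * t)) • Φ (ext z') t) ≤ _
    rw [dist_eq_norm, ← smul_sub, norm_smul, Real.norm_of_nonneg (Real.exp_pos _).le]
    refine (pow_le_pow_iff_left₀ (by positivity) (by positivity) two_ne_zero).1 ?_
    rw [mul_pow, ← Real.exp_nat_mul]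
    have e1 : ((2 : ℕ) : ℝ) * (-(lam * t)) = -(2 * lam * t) := by push_cast; ring
    rw [e1]
    have h3 := mul_le_mul_of_nonneg_left h2 (Real.exp_pos (-(2 * lam * t))).le
    have e2 : Real.exp (-(2 * lam * t)) * (C * (dist z z' ^ 2 *
        (Real.exp (2 * lam * t) / (2 * lam)))) = C / (2 * lam) * dist z z' ^ 2 := by
      have : Real.exp (-(2 * lam * t)) * Real.exp (2 * lam * t) = 1 := by
        rw [← Real.exp_add]; simp
      calc _ = (Real.exp (-(2 * lam * t)) * Real.exp (2 * lam * t))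
            * (C / (2 * lam) * dist z z' ^ 2) := by ring
        _ = _ := by rw [this, one_mul]
    have e3 : C / (2 * lam) ≤ 1 / 4 := by
      rw [div_le_div_iff₀ (by positivity) (by positivity)]
      rw [hlam]; linarith
    have e4 := mul_le_mul_of_nonneg_right e3 (sq_nonneg (dist z z'))
    rw [e2] at h3
    push_cast
    refine (h3.trans e4).trans (le_of_eq ?_)
    ring
  obtain ⟨z, hz⟩ : ∃ z, G z = z := ⟨hG.fixedPoint, hG.fixedPoint_isFixedPt⟩
  refine ⟨ext z, hext z, fun t ht => ?_⟩
  have h1 : Real.exp (-(lam * t)) • Φ (ext z) t = z ⟨t, ht⟩ :=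
    congrArg (fun y : C(Icc (0 : ℝ) T, E) => y ⟨t, ht⟩) hz
  have h2 : ext z t = Real.exp (lam * t) • z ⟨t, ht⟩ := by
    simp only [ext, clamp_of_mem ht]
  rw [h2, ← h1, smul_smul, ← Real.exp_add, add_neg_cancel, Real.exp_zero, one_smul]

variable {H L : Type*} [NormedAddCommGroup H] [InnerProductSpace ℂ H]
  [NormedAddCommGroup L] [InnerProductSpace ℂ L]
  {p : Coeffs} {J : H →L[ℂ] L} {N : H → L} {Ψ : H → ℝ} {k V T K : ℝ} {f h : H}

lemma norm_prod_sq_le {E F : Type*} [SeminormedAddCommGroup E] [SeminormedAddCommGroup F]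
    (z : E × F) : ‖z‖ ^ 2 ≤ ‖z.1‖ ^ 2 + ‖z.2‖ ^ 2 := by
  rw [Prod.norm_def]
  rcases max_cases ‖z.1‖ ‖z.2‖ with h | h <;> rw [h.1] <;>
    linarith [sq_nonneg ‖z.1‖, sq_nonneg ‖z.2‖]

lemma add_norm_sq_le_two_mul {E F : Type*} [SeminormedAddCommGroup E] [SeminormedAddCommGroup F]
    (z : E × F) : ‖z.1‖ ^ 2 + ‖z.2‖ ^ 2 ≤ 2 * ‖z‖ ^ 2 := by
  have h1 := pow_le_pow_left₀ (norm_nonneg _) (norm_fst_le z) 2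
  have h2 := pow_le_pow_left₀ (norm_nonneg _) (norm_snd_le z) 2
  linarith

variable [CompleteSpace H] [CompleteSpace L]

/-- The constant in the Lipschitz estimate for the linear solution operator on `[0, T]`. -/
def Coeffs.volterraConst (p : Coeffs) (K T : ℝ) : ℝ :=
  p.energyConst * (4 * p.lipV K ^ 2) + Real.exp T * (4 * p.lipPhi ^ 2)

/-- The estimate for the map that solves the linear equations with the forces computed from given
curves. -/
lemma volterra_le (hp : p.Admissible) (hJ : Function.Injective J)
    (hJ1 : ∀ x, ‖J x‖ ≤ ‖x‖) (hN : Continuous N) (hK : 0 ≤ K)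
    (hlip : ∀ x y, ‖N x - N y‖ ≤ K * ‖x - y‖) {u w : ℝ → H × H} (hu : Continuous u)
    (hw : Continuous w) {v₁ φ₁ v₂ φ₂ : ℝ → H}
    (hv₁ : SolvesLinear J p.thetaV T (fun t => p.forceV J N f (u t).1 (u t).2) v₁)
    (hφ₁ : SolvesLinear J p.thetaPhi T (fun t => J (p.forcePhi h (u t).1 (u t).2)) φ₁)
    (hv₂ : SolvesLinear J p.thetaV T (fun t => p.forceV J N f (w t).1 (w t).2) v₂)
    (hφ₂ : SolvesLinear J p.thetaPhi T (fun t => J (p.forcePhi h (w t).1 (w t).2)) φ₂)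
    (hv0 : v₁ 0 = v₂ 0) (hφ0 : φ₁ 0 = φ₂ 0) {t : ℝ} (ht : t ∈ Icc 0 T) :
    ‖(v₁ t, φ₁ t) - (v₂ t, φ₂ t)‖ ^ 2
      ≤ p.volterraConst K T * ∫ s in (0 : ℝ)..t, ‖u s - w s‖ ^ 2 := by
  have hF₁ := continuous_forceV (p := p) (J := J) hN f hu.fst hu.snd
  have hF₂ := continuous_forceV (p := p) (J := J) hN f hw.fst hw.snd
  have hG₁ := continuous_forcePhi (p := p) h hu.fst hu.snd
  have hG₂ := continuous_forcePhi (p := p) h hw.fst hw.snd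
  have hF : Continuous fun t => p.forceV J N f (u t).1 (u t).2 - p.forceV J N f (w t).1 (w t).2 :=
    hF₁.sub hF₂
  have hG : Continuous fun t => p.forcePhi h (u t).1 (u t).2 - p.forcePhi h (w t).1 (w t).2 :=
    hG₁.sub hG₂
  have hsum : ∀ C : ℝ, ∀ s, (C * (‖(u s).1 - (w s).1‖ + ‖(u s).2 - (w s).2‖)) ^ 2
      ≤ 4 * C ^ 2 * ‖u s - w s‖ ^ 2 := fun C s => by
    refine (add_sq_mul_le _ _ _).trans ?_
    have := mul_le_mul_of_nonneg_left (add_norm_sq_le_two_mul (u s - w s))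
      (show 0 ≤ 2 * C ^ 2 by positivity)
    simp only [Prod.fst_sub, Prod.snd_sub] at this
    linarith
  have hv := (hv₁.sub hF₁ hF₂ hv₂).norm_sq_le hJ hp.thetaV_inv_re_pos hF ht
  have hφ : SolvesLinear J p.thetaPhi T
      (fun t => J (p.forcePhi h (u t).1 (u t).2 - p.forcePhi h (w t).1 (w t).2))
      (fun t => φ₁ t - φ₂ t) := by
    simp only [map_sub]
    exact hφ₁.sub (J.continuous.comp hG₁) (J.continuous.comp hG₂) hφ₂
  have hφc : Continuous fun t => ‖φ₁ t - φ₂ t‖ ^ 2 :=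
    (hφ₁.continuous.sub hφ₂.continuous).norm.pow 2
  have hGc : Continuous fun s =>
      ‖p.forcePhi h (u s).1 (u s).2 - p.forcePhi h (w s).1 (w s).2‖ ^ 2 := hG.norm.pow 2
  have hA : ∫ s in (0 : ℝ)..t, ‖p.forceV J N f (u s).1 (u s).2 - p.forceV J N f (w s).1 (w s).2‖ ^ 2
      ≤ 4 * p.lipV K ^ 2 * ∫ s in (0 : ℝ)..t, ‖u s - w s‖ ^ 2 := by
    rw [← intervalIntegral.integral_const_mul]
    refine intervalIntegral.integral_mono_on ht.1 ((hF.norm.pow 2).intervalIntegrable _ _)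
      (Continuous.intervalIntegrable (by fun_prop) _ _) fun s _ => ?_
    exact (pow_le_pow_left₀ (norm_nonneg _)
      (norm_forceV_sub_le hJ1 hK f _ _ _ _ (hlip _ _)) 2).trans (hsum _ s)
  have hB : ∫ s in (0 : ℝ)..t, ‖p.forcePhi h (u s).1 (u s).2 - p.forcePhi h (w s).1 (w s).2‖ ^ 2
      ≤ 4 * p.lipPhi ^ 2 * ∫ s in (0 : ℝ)..t, ‖u s - w s‖ ^ 2 := by
    rw [← intervalIntegral.integral_const_mul]
    refine intervalIntegral.integral_mono_on ht.1 (hGc.intervalIntegrable _ _)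
      (Continuous.intervalIntegrable (by fun_prop) _ _) fun s _ => ?_
    exact (pow_le_pow_left₀ (norm_nonneg _) (norm_forcePhi_sub_le h _ _ _ _) 2).trans (hsum _ s)
  have hB0 : 0 ≤ ∫ s in (0 : ℝ)..t,
      ‖p.forcePhi h (u s).1 (u s).2 - p.forcePhi h (w s).1 (w s).2‖ ^ 2 :=
    intervalIntegral.integral_nonneg ht.1 fun s _ => by positivity
  have hgr : ∀ r ∈ Icc 0 t, ‖φ₁ r - φ₂ r‖ ^ 2
      ≤ (∫ s in (0 : ℝ)..t, ‖p.forcePhi h (u s).1 (u s).2 - p.forcePhi h (w s).1 (w s).2‖ ^ 2)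
        + 1 * ∫ s in (0 : ℝ)..r, ‖φ₁ s - φ₂ s‖ ^ 2 := fun r hr => by
    have e1 := hφ.norm_sq_le_of_re_eq_zero hJ Coeffs.thetaPhi_re hG ⟨hr.1, hr.2.trans ht.2⟩
    rw [intervalIntegral.integral_add (hφc.intervalIntegrable _ _)
      (hGc.intervalIntegrable _ _), hφ0, sub_self, norm_zero] at e1
    have e2 := intervalIntegral.integral_mono_interval (μ := volume) le_rfl hr.1 hr.2
      (Eventually.of_forall fun s => sq_nonneg
        ‖p.forcePhi h (u s).1 (u s).2 - p.forcePhi h (w s).1 (w s).2‖)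
      (hGc.intervalIntegrable _ _)
    linarith only [e1, e2]
  have hφt := (hgr t ⟨ht.1, le_rfl⟩).trans
    (le_mul_exp_of_le_add_integral zero_le_one hφc hgr t ⟨ht.1, le_rfl⟩)
  have hexp : Real.exp (1 * t) ≤ Real.exp T := Real.exp_le_exp.2 (by linarith [ht.2])
  have e3 := mul_le_mul hB hexp (Real.exp_pos _).le (hB0.trans hB)
  have e4 := mul_le_mul_of_nonneg_left hA hp.energyConst_nonneg
  refine (norm_prod_sq_le _).trans ?_
  rw [hv0, sub_self, norm_zero, ← Coeffs.energyConst] at hv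
  simp only [Prod.fst_sub, Prod.snd_sub]
  rw [Coeffs.volterraConst]
  linarith only [hv, e3, e4, hφt]

/-- Existence for a globally Lipschitz nonlinearity: a solution is a fixed point of the map that
solves the linear equations with the forces computed from a given pair of curves. -/
lemma exists_isMildSolution_of_lipschitz (hp : p.Admissible) (hJ : Function.Injective J)
    (hJd : DenseRange J) (hJ1 : ∀ x, ‖J x‖ ≤ ‖x‖) (hK : 0 ≤ K)
    (hlip : ∀ x y, ‖N x - N y‖ ≤ K * ‖x - y‖) (hT : 0 ≤ T) (f h x y : H) :
    ∃ v φ, IsMildSolution p J N f h T v φ ∧ v 0 = x ∧ φ 0 = y := by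
  have hN : Continuous N :=
    (LipschitzWith.of_dist_le_mul (K := ⟨K, hK⟩) fun a b => by
      rw [dist_eq_norm, dist_eq_norm]; exact hlip a b).continuous
  have hsol : ∀ u : ℝ → H × H, ∃ z : (ℝ → H) × (ℝ → H), Continuous u →
      (SolvesLinear J p.thetaV T (fun t => p.forceV J N f (u t).1 (u t).2) z.1 ∧ z.1 0 = x) ∧
      SolvesLinear J p.thetaPhi T (fun t => J (p.forcePhi h (u t).1 (u t).2)) z.2 ∧ z.2 0 = y := by
    intro u
    by_cases hu : Continuous u
    · obtain ⟨v, hv⟩ := exists_solvesLinear_parabolic hJ hJd hT hp.thetaV_inv_re_pos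
        (continuous_forceV (p := p) (J := J) hN f hu.fst hu.snd) x
      obtain ⟨φ, hφ⟩ := exists_solvesLinear_dispersive hJ hT (Coeffs.thetaPhi_re (p := p))
        (continuous_forcePhi (p := p) h hu.fst hu.snd) y
      exact ⟨(v, φ), fun _ => ⟨hv, hφ⟩⟩
    · exact ⟨0, fun hu' => absurd hu' hu⟩
  choose z hz using hsol
  have hC : 0 ≤ p.volterraConst K T := by
    have := hp.energyConst_nonneg
    unfold Coeffs.volterraConst
    positivity
  obtain ⟨u, hu, hfix⟩ := exists_fixedPoint_of_integral_le hT hC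
    (fun u t => ((z u).1 t, (z u).2 t))
    (fun u hu => (hz u hu).1.1.continuous.prodMk (hz u hu).2.1.continuous)
    (fun u w hu hw t ht => volterra_le hp hJ hJ1 hN hK hlip hu hw (hz u hu).1.1 (hz u hu).2.1
      (hz w hw).1.1 (hz w hw).2.1 ((hz u hu).1.2.trans (hz w hw).1.2.symm)
      ((hz u hu).2.2.trans (hz w hw).2.2.symm) ht)
  have hfix' : ∀ t ∈ Icc 0 T, u t = ((z u).1 t, (z u).2 t) := fun t ht => (hfix ht).symm
  refine ⟨(z u).1, (z u).2, ⟨(hz u hu).1.1.congr_right fun t ht => ?_,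
    (hz u hu).2.1.congr_right fun t ht => ?_⟩, (hz u hu).1.2, (hz u hu).2.2⟩
  · simp only [hfix' t ht]
  · simp only [hfix' t ht]

end Existence

noncomputable section Global

open ContinuousLinearMap Filter

/-! ### Global existence and the semigroup -/

/-- The radial retraction of a normed space onto the ball of radius `R`. -/
def retract {E : Type*} [NormedAddCommGroup E] [NormedSpace ℂ E] (R : ℝ) (x : E) : E :=
  ((R / max R ‖x‖ : ℝ) : ℂ) • x

section Retract

variable {E : Type*} [NormedAddCommGroup E] [NormedSpace ℂ E] {R : ℝ}

lemma retract_of_norm_le (hR : 0 < R) {x : E} (hx : ‖x‖ ≤ R) : retract R x = x := by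
  rw [retract, max_eq_left hx, div_self hR.ne', Complex.ofReal_one, one_smul]

lemma norm_retract_le (hR : 0 < R) (x : E) : ‖retract R x‖ ≤ R := by
  have hM : 0 < max R ‖x‖ := lt_max_of_lt_left hR
  rw [retract, norm_smul, Complex.norm_real, Real.norm_of_nonneg (by positivity),
    div_mul_eq_mul_div, div_le_iff₀ hM]
  exact mul_le_mul_of_nonneg_left (le_max_right _ _) hR.le

lemma norm_retract_sub_le (hR : 0 < R) (x y : E) :
    ‖retract R x - retract R y‖ ≤ 2 * ‖x - y‖ := by
  have hMx : 0 < max R ‖x‖ := lt_max_of_lt_left hR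
  have hMy : 0 < max R ‖y‖ := lt_max_of_lt_left hR
  have h1 : retract R x - retract R y = ((R / max R ‖x‖ : ℝ) : ℂ) • (x - y)
      + ((R / max R ‖x‖ - R / max R ‖y‖ : ℝ) : ℂ) • y := by
    rw [retract, retract, Complex.ofReal_sub, sub_smul, smul_sub]
    abel
  have h2 : ‖((R / max R ‖x‖ : ℝ) : ℂ) • (x - y)‖ ≤ ‖x - y‖ := by
    rw [norm_smul, Complex.norm_real, Real.norm_of_nonneg (by positivity)]
    exact mul_le_of_le_one_left (norm_nonneg _) ((div_le_one hMx).2 (le_max_left _ _))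
  have h3 : ‖((R / max R ‖x‖ - R / max R ‖y‖ : ℝ) : ℂ) • y‖ ≤ ‖x - y‖ := by
    rw [norm_smul, Complex.norm_real, Real.norm_eq_abs]
    have e1 : R / max R ‖x‖ - R / max R ‖y‖
        = R / max R ‖x‖ * (max R ‖y‖ - max R ‖x‖) / max R ‖y‖ := by
      field_simp
    have e2 : |max R ‖y‖ - max R ‖x‖| ≤ ‖x - y‖ := by
      rw [norm_sub_rev, max_comm R, max_comm R]
      exact (abs_max_sub_max_le_abs _ _ _).trans (abs_norm_sub_norm_le _ _)
    have e3 : R / max R ‖x‖ ≤ 1 := (div_le_one hMx).2 (le_max_left _ _)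
    rw [e1, abs_div, abs_mul, abs_of_pos hMy, abs_of_pos (div_pos hR hMx), div_mul_eq_mul_div,
      div_le_iff₀ hMy]
    exact mul_le_mul ((mul_le_of_le_one_left (abs_nonneg _) e3).trans e2) (le_max_right _ _)
      (norm_nonneg _) (norm_nonneg _)
  rw [h1]
  linarith [norm_add_le (((R / max R ‖x‖ : ℝ) : ℂ) • (x - y))
    (((R / max R ‖x‖ - R / max R ‖y‖ : ℝ) : ℂ) • y)]

end Retract

/-- A continuity argument: a bound that follows from a weaker bound on every initial segment
propagates to the whole interval. -/
lemma norm_le_of_continuity {E : Type*} [NormedAddCommGroup E] {y : ℝ → E} (hy : Continuous y)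
    {T R : ℝ} (h0 : ‖y 0‖ ≤ R)
    (himp : ∀ t ∈ Icc 0 T, (∀ s ∈ Icc 0 t, ‖y s‖ ≤ R) → ‖y t‖ < R) :
    ∀ t ∈ Icc 0 T, ‖y t‖ ≤ R := by
  -- Rescaling `[0, t]` to the fixed interval `[0, 1]` makes it evident that this set is closed.
  let s : Set ℝ := {t | ∀ q ∈ Icc (0 : ℝ) 1, ‖y (q * t)‖ ≤ R}
  have hs : ∀ t, 0 ≤ t → (t ∈ s ↔ ∀ r ∈ Icc 0 t, ‖y r‖ ≤ R) := by
    intro t ht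
    refine ⟨fun h r hr => ?_, fun h q hq => h _ ⟨mul_nonneg hq.1 ht, mul_le_of_le_one_left ht hq.2⟩⟩
    rcases ht.eq_or_lt with rfl | ht
    · have := h 0 ⟨le_rfl, zero_le_one⟩
      rwa [zero_mul, ← le_antisymm hr.2 hr.1] at this
    · have := h (r / t) ⟨div_nonneg hr.1 ht.le, (div_le_one ht).2 hr.2⟩
      rwa [div_mul_cancel₀ _ ht.ne'] at this
  have hclosed : IsClosed s := by
    have : s = ⋂ q ∈ Icc (0 : ℝ) 1, {t | ‖y (q * t)‖ ≤ R} := by ext; simp [s]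
    rw [this]
    exact isClosed_biInter fun q _ => isClosed_le (by fun_prop) continuous_const
  have hsub : Icc 0 T ⊆ s := by
    refine (hclosed.inter isClosed_Icc).Icc_subset_of_forall_exists_gt ?_ ?_
    · rw [hs 0 le_rfl]
      intro r hr
      rwa [le_antisymm hr.2 hr.1]
    · rintro t ⟨hts, ht⟩ z hz
      have h1 := (hs t ht.1).1 hts
      have h2 := himp t ⟨ht.1, ht.2.le⟩ h1
      obtain ⟨ε, hε, hball⟩ := Metric.eventually_nhds_iff.1
        (hy.norm.continuousAt.eventually (gt_mem_nhds h2) : ∀ᶠ r in 𝓝 t, ‖y r‖ < R)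
      have hz' : t < z := hz
      refine ⟨min z (t + ε / 2), ?_, lt_min hz' (by linarith), min_le_left _ _⟩
      rw [hs _ (le_min (ht.1.trans hz'.le) (by linarith [ht.1]))]
      intro r hr
      rcases le_total r t with hrt | hrt
      · exact h1 r ⟨hr.1, hrt⟩
      · refine (hball ?_).le
        have := hr.2.trans (min_le_right _ _)
        rw [Real.dist_eq, abs_of_nonneg (by linarith)]
        linarith
  exact fun t ht => (hs t ht.1).1 (hsub ht) t ⟨ht.1, le_rfl⟩

variable {H L : Type*} [NormedAddCommGroup H] [InnerProductSpace ℂ H]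
  [NormedAddCommGroup L] [InnerProductSpace ℂ L] [CompleteSpace H] [CompleteSpace L]
  {p : Coeffs} {J : H →L[ℂ] L} {N : H → L} {Ψ : H → ℝ} {k V T K : ℝ} {f h : H}

lemma IsMildSolution.mono {T' : ℝ} {v φ : ℝ → H} (hs : IsMildSolution p J N f h T v φ)
    (hT : T' ≤ T) : IsMildSolution p J N f h T' v φ :=
  ⟨hs.solves_v.mono hT, hs.solves_φ.mono hT⟩

lemma IsMildSolution.congr_nonlinearity {N' : H → L} {v φ : ℝ → H}
    (hs : IsMildSolution p J N f h T v φ) (hN : ∀ t ∈ Icc 0 T, N (v t) = N' (v t)) :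
    IsMildSolution p J N' f h T v φ :=
  ⟨hs.solves_v.congr_right fun t ht => by simp only [Coeffs.forceV, hN t ht], hs.solves_φ⟩

lemma SolvesLinear.congr {θ : ℂ} {F G : ℝ → L} {y z : ℝ → H} (hy : SolvesLinear J θ T F y)
    (hz : Continuous z) (hyz : EqOn y z (Icc 0 T)) (hFG : EqOn F G (Icc 0 T)) :
    SolvesLinear J θ T G z where
  continuous := hz
  eq t ht := by
    rw [← hyz ht, ← hyz ⟨le_rfl, ht.1.trans ht.2⟩, hy.eq t ht]
    congr 1
    refine intervalIntegral.integral_congr fun s hs => ?_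
    rw [uIcc_of_le ht.1] at hs
    have hs' : s ∈ Icc 0 T := ⟨hs.1, hs.2.trans ht.2⟩
    simp only [hFG hs', hyz hs']

lemma IsMildSolution.congr {v φ v' φ' : ℝ → H} (hs : IsMildSolution p J N f h T v φ)
    (hv' : Continuous v') (hφ' : Continuous φ') (hv : EqOn v v' (Icc 0 T))
    (hφ : EqOn φ φ' (Icc 0 T)) : IsMildSolution p J N f h T v' φ' :=
  ⟨hs.solves_v.congr hv' hv fun t ht => by simp only [hv ht, hφ ht],
    hs.solves_φ.congr hφ' hφ fun t ht => by simp only [hv ht, hφ ht]⟩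

lemma SolvesLinear.shift {θ : ℂ} {F : ℝ → L} {y : ℝ → H} {s : ℝ} (hs : 0 ≤ s) (hF : Continuous F)
    (hy : SolvesLinear J θ (T + s) F y) :
    SolvesLinear J θ T (fun t => F (t + s)) (fun t => y (t + s)) where
  continuous := hy.continuous.comp (continuous_add_const s)
  eq t ht := by
    have hc := hy.continuous_integrand hF
    have hT := ht.1.trans ht.2
    rw [hy.eq (t + s) ⟨by linarith [ht.1], by linarith [ht.2]⟩, zero_add,
      hy.eq s ⟨hs, by linarith⟩,
      intervalIntegral.integral_comp_add_right (fun r => adjoint J (F r) - θ • y r) s, zero_add,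
      add_assoc, intervalIntegral.integral_add_adjacent_intervals (hc.intervalIntegrable _ _)
        (hc.intervalIntegrable _ _)]

lemma IsMildSolution.shift (hN : Continuous N) {v φ : ℝ → H} {s : ℝ} (hs : 0 ≤ s)
    (h1 : IsMildSolution p J N f h (T + s) v φ) :
    IsMildSolution p J N f h T (fun t => v (t + s)) (fun t => φ (t + s)) :=
  ⟨h1.solves_v.shift hs (continuous_forceV hN f h1.solves_v.continuous h1.solves_φ.continuous),
    h1.solves_φ.shift hs (J.continuous.comp
      (continuous_forcePhi h h1.solves_v.continuous h1.solves_φ.continuous))⟩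

/-- Global existence. The nonlinearity is made globally Lipschitz by a retraction onto a ball so
large that, by the a priori bound, the solution does not leave it. -/
lemma exists_isMildSolution (hp : p.Admissible) (hN : IsCubic J N Ψ k V)
    (hJ : Function.Injective J) (hJd : DenseRange J) (hJ1 : ∀ x, ‖J x‖ ≤ ‖x‖) (hT : 0 ≤ T)
    (f h x y : H) : ∃ v φ, IsMildSolution p J N f h T v φ ∧ v 0 = x ∧ φ 0 = y := by
  set A := p.aprioriSq k V (max ‖f‖ ‖h‖) (max ‖x‖ ‖y‖) with hA
  -- `√A` is the a priori bound; `R` has to be strictly larger for the continuity argument.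
  set R := √A + ‖x‖ + 1 with hRdef
  have hR : 0 < R := by positivity
  have hlip : ∀ a b, ‖N (retract R a) - N (retract R b)‖
      ≤ (k * (2 * R) ^ 2 * 2) * ‖a - b‖ := fun a b => by
    refine (hN.norm_sub_le _ _).trans ?_
    have e1 : ‖retract R a‖ + ‖retract R b‖ ≤ 2 * R := by
      linarith [norm_retract_le hR a, norm_retract_le hR b]
    have e2 := mul_le_mul_of_nonneg_left (pow_le_pow_left₀ (by positivity) e1 2) hN.k_nonneg
    rw [mul_assoc (k * _)]
    exact mul_le_mul e2 (norm_retract_sub_le hR a b) (norm_nonneg _)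
      (mul_nonneg hN.k_nonneg (by positivity))
  obtain ⟨v, φ, hs, hv0, hφ0⟩ := exists_isMildSolution_of_lipschitz
    (N := fun a => N (retract R a)) hp hJ hJd hJ1
    (mul_nonneg (mul_nonneg hN.k_nonneg (by positivity)) zero_le_two) hlip hT f h x y
  have hle : ∀ t ∈ Icc 0 T, ‖v t‖ ≤ R := by
    refine norm_le_of_continuity hs.solves_v.continuous ?_ fun t ht hb => ?_
    · rw [hv0]
      linarith [Real.sqrt_nonneg A]
    · have h1 := (hs.mono ht.2).congr_nonlinearity (N' := N) fun r hr => by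
        rw [retract_of_norm_le hR (hb r hr)]
      have h2 := h1.norm_v_sq_le hp hN hJ hJd hJ1 (le_max_left ‖f‖ ‖h‖) (le_max_right _ _)
        (R := max ‖x‖ ‖y‖) (hv0 ▸ le_max_left _ _) (hφ0 ▸ le_max_right _ _)
        (t := t) ⟨ht.1, le_rfl⟩
      have h3 : ‖v t‖ ≤ √A := Real.le_sqrt_of_sq_le h2
      linarith [norm_nonneg x]
  exact ⟨v, φ, hs.congr_nonlinearity fun t ht => by rw [retract_of_norm_le hR (hle t ht)], hv0, hφ0⟩

/-- The exponential rate in the continuous dependence estimate for data bounded by `R` and forces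
bounded by `K`. -/
def Coeffs.dependenceRate (p : Coeffs) (k V K R : ℝ) : ℝ :=
  p.growthRate (k * (2 * √(p.aprioriSq k V K R)) ^ 2)

/-- Lipschitz dependence on the data, with a rate that does not depend on the length of the time
interval. -/
lemma IsMildSolution.dependence (hp : p.Admissible) (hN : IsCubic J N Ψ k V)
    (hJ : Function.Injective J) (hJd : DenseRange J) (hJ1 : ∀ x, ‖J x‖ ≤ ‖x‖)
    {v₁ φ₁ v₂ φ₂ : ℝ → H} (h₁ : IsMildSolution p J N f h T v₁ φ₁)
    (h₂ : IsMildSolution p J N f h T v₂ φ₂) {R : ℝ} (hf : ‖f‖ ≤ K) (hh : ‖h‖ ≤ K)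
    (hv₁ : ‖v₁ 0‖ ≤ R) (hφ₁ : ‖φ₁ 0‖ ≤ R) (hv₂ : ‖v₂ 0‖ ≤ R) (hφ₂ : ‖φ₂ 0‖ ≤ R) {w : ℝ → L}
    (hw : HasL2TimeDeriv T (fun t => J (v₁ t - v₂ t)) w) {t : ℝ} (ht : t ∈ Icc 0 T) :
    ‖v₁ t - v₂ t‖ ^ 2 + ‖φ₁ t - φ₂ t‖ ^ 2
      + (p.thetaV⁻¹).re * ∫ s in (0 : ℝ)..t, ‖w s‖ ^ 2
      ≤ (‖v₁ 0 - v₂ 0‖ ^ 2 + ‖φ₁ 0 - φ₂ 0‖ ^ 2) * Real.exp (p.dependenceRate k V K R * t) := by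
  refine h₁.norm_sub_sq_le hp hJ hJd hJ1 hN.continuous h₂
    (mul_nonneg hN.k_nonneg (by positivity)) (fun s hs => ?_) hw ht
  have e1 := Real.le_sqrt_of_sq_le (h₁.norm_v_sq_le hp hN hJ hJd hJ1 hf hh hv₁ hφ₁ hs)
  have e2 := Real.le_sqrt_of_sq_le (h₂.norm_v_sq_le hp hN hJ hJd hJ1 hf hh hv₂ hφ₂ hs)
  refine (hN.norm_sub_le _ _).trans (mul_le_mul_of_nonneg_right ?_ (norm_nonneg _))
  exact mul_le_mul_of_nonneg_left (pow_le_pow_left₀ (by positivity) (by linarith) 2) hN.k_nonneg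

/-- `IsMildSolution.dependence` without the time derivative. -/
lemma IsMildSolution.norm_sub_sq_le_exp (hp : p.Admissible) (hN : IsCubic J N Ψ k V)
    (hJ : Function.Injective J) (hJd : DenseRange J) (hJ1 : ∀ x, ‖J x‖ ≤ ‖x‖)
    {v₁ φ₁ v₂ φ₂ : ℝ → H} (h₁ : IsMildSolution p J N f h T v₁ φ₁)
    (h₂ : IsMildSolution p J N f h T v₂ φ₂) {R : ℝ}
    (hv₁ : ‖v₁ 0‖ ≤ R) (hφ₁ : ‖φ₁ 0‖ ≤ R) (hv₂ : ‖v₂ 0‖ ≤ R) (hφ₂ : ‖φ₂ 0‖ ≤ R)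
    {t : ℝ} (ht : t ∈ Icc 0 T) :
    ‖v₁ t - v₂ t‖ ^ 2 + ‖φ₁ t - φ₂ t‖ ^ 2 ≤ (‖v₁ 0 - v₂ 0‖ ^ 2 + ‖φ₁ 0 - φ₂ 0‖ ^ 2)
      * Real.exp (p.dependenceRate k V (max ‖f‖ ‖h‖) R * t) := by
  have hF₁ := continuous_forceV (p := p) (J := J) hN.continuous f h₁.solves_v.continuous
    h₁.solves_φ.continuous
  have hF₂ := continuous_forceV (p := p) (J := J) hN.continuous f h₂.solves_v.continuous
    h₂.solves_φ.continuous
  obtain ⟨w, hw⟩ := (h₁.solves_v.sub hF₁ hF₂ h₂.solves_v).exists_hasL2TimeDeriv hJ hJd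
    (ht.1.trans ht.2) hp.thetaV_inv_re_pos (hF₁.sub hF₂)
  have e1 := h₁.dependence hp hN hJ hJd hJ1 h₂ (le_max_left ‖f‖ ‖h‖) (le_max_right _ _)
    hv₁ hφ₁ hv₂ hφ₂ hw ht
  have e2 : 0 ≤ (p.thetaV⁻¹).re * ∫ s in (0 : ℝ)..t, ‖w s‖ ^ 2 :=
    mul_nonneg hp.thetaV_inv_re_pos.le
      (intervalIntegral.integral_nonneg ht.1 fun s _ => by positivity)
  linarith

lemma IsMildSolution.unique (hp : p.Admissible) (hN : IsCubic J N Ψ k V)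
    (hJ : Function.Injective J) (hJd : DenseRange J) (hJ1 : ∀ x, ‖J x‖ ≤ ‖x‖)
    {v₁ φ₁ v₂ φ₂ : ℝ → H} (h₁ : IsMildSolution p J N f h T v₁ φ₁)
    (h₂ : IsMildSolution p J N f h T v₂ φ₂) (hv : v₁ 0 = v₂ 0) (hφ : φ₁ 0 = φ₂ 0) {t : ℝ}
    (ht : t ∈ Icc 0 T) : v₁ t = v₂ t ∧ φ₁ t = φ₂ t := by
  have e1 := h₁.norm_sub_sq_le_exp hp hN hJ hJd hJ1 h₂ (le_max_left ‖v₁ 0‖ ‖φ₁ 0‖)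
    (le_max_right _ _) (hv ▸ le_max_left _ _) (hφ ▸ le_max_right _ _) ht
  rw [hv, hφ, sub_self, sub_self, norm_zero] at e1
  have e2 : ‖v₁ t - v₂ t‖ ^ 2 ≤ 0 := by nlinarith [sq_nonneg ‖φ₁ t - φ₂ t‖]
  have e3 : ‖φ₁ t - φ₂ t‖ ^ 2 ≤ 0 := by nlinarith [sq_nonneg ‖v₁ t - v₂ t‖]
  constructor
  · exact sub_eq_zero.1 (norm_eq_zero.1 (pow_eq_zero_iff two_ne_zero |>.1
      (le_antisymm e2 (sq_nonneg _))))
  · exact sub_eq_zero.1 (norm_eq_zero.1 (pow_eq_zero_iff two_ne_zero |>.1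
      (le_antisymm e3 (sq_nonneg _))))

/-- There is one pair of curves that solves the system on all intervals `[0, T]`. -/
lemma exists_global_isMildSolution (hp : p.Admissible) (hN : IsCubic J N Ψ k V)
    (hJ : Function.Injective J) (hJd : DenseRange J) (hJ1 : ∀ x, ‖J x‖ ≤ ‖x‖) (f h x y : H) :
    ∃ v φ, (∀ T, IsMildSolution p J N f h T v φ) ∧ v 0 = x ∧ φ 0 = y := by
  have hex : ∀ T : ℝ, ∃ z : (ℝ → H) × (ℝ → H), 0 ≤ T →
      IsMildSolution p J N f h T z.1 z.2 ∧ z.1 0 = x ∧ z.2 0 = y := fun T => by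
    by_cases hT : 0 ≤ T
    · obtain ⟨v, φ, hs⟩ := exists_isMildSolution hp hN hJ hJd hJ1 hT f h x y
      exact ⟨(v, φ), fun _ => hs⟩
    · exact ⟨0, fun h => absurd h hT⟩
  choose z hz using hex
  -- `z T` solves on `[0, T]`; by uniqueness its value at `t` does not depend on `T ≥ t`.
  have hcons : ∀ T, 0 ≤ T → ∀ t ≤ T, (z (max t 0)).1 (max t 0) = (z T).1 (max t 0) ∧
      (z (max t 0)).2 (max t 0) = (z T).2 (max t 0) := fun T hT t ht => by
    have h0 : 0 ≤ max t 0 := le_max_right _ _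
    have h1 := hz _ h0
    have h2 := hz _ hT
    exact h1.1.unique hp hN hJ hJd hJ1 (h2.1.mono (max_le ht hT)) (h1.2.1.trans h2.2.1.symm)
      (h1.2.2.trans h2.2.2.symm) ⟨h0, le_rfl⟩
  have hcont : ∀ g : ℝ → H, (∀ T, 0 ≤ T → ∃ G : ℝ → H, Continuous G ∧ ∀ t ≤ T, g t = G (max t 0)) →
      Continuous g := fun g hg => by
    refine continuous_iff_continuousAt.2 fun t => ?_
    obtain ⟨G, hG, hgG⟩ := hg (|t| + 1) (by positivity)
    have h1 : ContinuousAt (fun t => G (max t 0)) t :=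
      (hG.comp (continuous_id.max continuous_const)).continuousAt
    refine h1.congr ?_
    filter_upwards [Iio_mem_nhds (show t < |t| + 1 by linarith [le_abs_self t])] with s hs
    exact (hgG s (le_of_lt hs)).symm
  have hv : Continuous fun t => (z (max t 0)).1 (max t 0) := hcont _ fun T hT =>
    ⟨(z T).1, (hz T hT).1.solves_v.continuous, fun t ht => (hcons T hT t ht).1⟩
  have hφ : Continuous fun t => (z (max t 0)).2 (max t 0) := hcont _ fun T hT =>
    ⟨(z T).2, (hz T hT).1.solves_φ.continuous, fun t ht => (hcons T hT t ht).2⟩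
  refine ⟨fun t => (z (max t 0)).1 (max t 0), fun t => (z (max t 0)).2 (max t 0), fun T => ?_,
    ?_, ?_⟩
  · refine IsMildSolution.mono (T := max T 0) ?_ (le_max_left _ _)
    have h0 : 0 ≤ max T 0 := le_max_right _ _
    refine (hz _ h0).1.congr hv hφ (fun t ht => ?_) fun t ht => ?_
    · have := (hcons _ h0 t ht.2).1
      rw [max_eq_left ht.1] at this
      simp only [max_eq_left ht.1, this]
    · have := (hcons _ h0 t ht.2).2
      rw [max_eq_left ht.1] at this
      simp only [max_eq_left ht.1, this]
  · simpa using (hz 0 le_rfl).2.1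
  · simpa using (hz 0 le_rfl).2.2

/-- The solutions of the system are the trajectories of a strongly continuous semigroup. -/
lemma exists_semigroup (hp : p.Admissible) (hN : IsCubic J N Ψ k V)
    (hJ : Function.Injective J) (hJd : DenseRange J) (hJ1 : ∀ x, ‖J x‖ ≤ ‖x‖) (f h : H) :
    ∃ S : ℝ≥0 → H × H → H × H, IsStronglyContinuousSemigroup S ∧ ∀ z T,
      IsMildSolution p J N f h T (fun t => (S t.toNNReal z).1) (fun t => (S t.toNNReal z).2) := by
  choose v φ hs hv0 hφ0 using fun z : H × H =>
    exists_global_isMildSolution hp hN hJ hJd hJ1 f h z.1 z.2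
  have hvc : ∀ z, Continuous (v z) := fun z => (hs z 0).solves_v.continuous
  have hφc : ∀ z, Continuous (φ z) := fun z => (hs z 0).solves_φ.continuous
  refine ⟨fun t z => (v z t, φ z t), ⟨fun z => ?_, fun s t z => ?_, fun z => ?_, fun t => ?_⟩,
    fun z T => ?_⟩
  · simp [hv0, hφ0]
  · have h1 := ((hs z (s + t)).shift hN.continuous t.coe_nonneg).unique hp hN hJ hJd hJ1
      (hs (v z t, φ z t) s) (by simp [hv0]) (by simp [hφ0]) (t := s) ⟨s.coe_nonneg, le_rfl⟩
    simp only [NNReal.coe_add]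
    exact Prod.ext h1.1 h1.2
  · exact ((hvc z).comp NNReal.continuous_coe).prodMk ((hφc z).comp NNReal.continuous_coe)
  · refine continuous_iff_continuousAt.2 fun z => ?_
    -- Near `z` all data are bounded by `‖z‖ + 1`, so that one rate serves for all of them.
    set C := Real.exp (p.dependenceRate k V (max ‖f‖ ‖h‖) (‖z‖ + 1) * t) with hC
    have hle : ∀ᶠ z' in 𝓝 z, ‖(v z' t, φ z' t) - (v z t, φ z t)‖ ^ 2 ≤ 2 * ‖z' - z‖ ^ 2 * C := by
      have hb : ∀ᶠ z' in 𝓝 z, ‖z'‖ < ‖z‖ + 1 :=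
        continuous_norm.continuousAt.eventually (gt_mem_nhds (lt_add_one _))
      filter_upwards [hb] with z' hz'
      have e1 := (hs z' t).norm_sub_sq_le_exp hp hN hJ hJd hJ1 (hs z t) (R := ‖z‖ + 1)
        ((hv0 z').symm ▸ (norm_fst_le z').trans hz'.le)
        ((hφ0 z').symm ▸ (norm_snd_le z').trans hz'.le)
        ((hv0 z).symm ▸ (norm_fst_le z).trans (lt_add_one _).le)
        ((hφ0 z).symm ▸ (norm_snd_le z).trans (lt_add_one _).le) (t := t) ⟨t.coe_nonneg, le_rfl⟩
      rw [hv0, hφ0, hv0, hφ0] at e1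
      refine (norm_prod_sq_le _).trans (e1.trans ?_)
      exact mul_le_mul_of_nonneg_right (add_norm_sq_le_two_mul (z' - z)) (Real.exp_pos _).le
    have hlim : Tendsto (fun z' => 2 * ‖z' - z‖ ^ 2 * C) (𝓝 z) (𝓝 0) := by
      have : Continuous fun z' => 2 * ‖z' - z‖ ^ 2 * C := by fun_prop
      simpa using this.tendsto z
    have h2 : Tendsto (fun z' => ‖(v z' t, φ z' t) - (v z t, φ z t)‖ ^ 2) (𝓝 z) (𝓝 0) :=
      squeeze_zero' (Eventually.of_forall fun _ => sq_nonneg _) hle hlim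
    rw [ContinuousAt, tendsto_iff_norm_sub_tendsto_zero]
    have h3 := (Real.continuous_sqrt.tendsto 0).comp h2
    simpa [Function.comp_def, Real.sqrt_sq] using h3
  · refine (hs z T).congr ((hvc z).comp (by fun_prop)) ((hφc z).comp (by fun_prop))
      (fun t ht => ?_) fun t ht => ?_
    · simp [Real.coe_toNNReal _ ht.1]
    · simp [Real.coe_toNNReal _ ht.1]

end Global

noncomputable section FunctionSpaces

open ContinuousLinearMap Filter

/-! ### The space `H¹₀` -/

variable {Ω : Set E3}

instance : CompleteSpace (H10 Ω) :=
  (Submodule.isClosed_topologicalClosure (testGraph Ω)).completeSpace_coe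

lemma inner_H10 (u ψ : H10 Ω) :
    ⟪ψ, u⟫_ℂ = ⟪toL2 Ω ψ, toL2 Ω u⟫_ℂ + ⟪gradL Ω ψ, gradL Ω u⟫_ℂ := rfl

lemma norm_sq_H10 (u : H10 Ω) : ‖u‖ ^ 2 = ‖toL2 Ω u‖ ^ 2 + ‖gradL Ω u‖ ^ 2 :=
  WithLp.prod_norm_sq_eq_of_L2 (u : Pair Ω)

lemma norm_toL2_le (u : H10 Ω) : ‖toL2 Ω u‖ ≤ ‖u‖ := by
  refine (pow_le_pow_iff_left₀ (norm_nonneg _) (norm_nonneg _) two_ne_zero).1 ?_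
  rw [norm_sq_H10]
  linarith [sq_nonneg ‖gradL Ω u‖]

namespace IsTestFunction

variable {θ χ : E3 → ℂ}

lemma contDiff_one (h : IsTestFunction Ω θ) : ContDiff ℝ 1 θ := h.contDiff.of_le (by simp)

lemma differentiable (h : IsTestFunction Ω θ) : Differentiable ℝ θ :=
  h.contDiff.differentiable (by simp)

lemma continuous_fderiv_apply (h : IsTestFunction Ω θ) (v : E3) :
    Continuous fun x => fderiv ℝ θ x v :=
  (h.contDiff.continuous_fderiv (by simp)).clm_apply continuous_const

lemma hasCompactSupport_fderiv_apply (h : IsTestFunction Ω θ) (v : E3) :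
    HasCompactSupport fun x => fderiv ℝ θ x v :=
  h.hasCompactSupport.fderiv_apply (𝕜 := ℝ) v

lemma eq_zero_of_notMem (h : IsTestFunction Ω θ) {x : E3} (hx : x ∉ Ω) : θ x = 0 :=
  image_eq_zero_of_notMem_tsupport fun h' => hx (h.tsupport_subset h')

lemma fderiv_eq_zero_of_notMem (h : IsTestFunction Ω θ) {x : E3} (hx : x ∉ Ω) :
    fderiv ℝ θ x = 0 :=
  image_eq_zero_of_notMem_tsupport fun h' =>
    hx (h.tsupport_subset (tsupport_fderiv_subset ℝ h'))

lemma continuous_grad (h : IsTestFunction Ω θ) : Continuous (grad θ) := by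
  refine (PiLp.continuous_toLp 2 _).comp (continuous_pi fun j => ?_)
  exact h.continuous_fderiv_apply _

lemma hasCompactSupport_grad (h : IsTestFunction Ω θ) : HasCompactSupport (grad θ) := by
  refine h.hasCompactSupport.mono' fun x hx => ?_
  by_contra hx'
  refine hx ?_
  have : fderiv ℝ θ x = 0 :=
    image_eq_zero_of_notMem_tsupport fun h' => hx' (tsupport_fderiv_subset ℝ h')
  ext j
  simp [grad, this]

lemma memLp (h : IsTestFunction Ω θ) : MemLp θ 2 (volume.restrict Ω) :=
  h.contDiff.continuous.memLp_of_hasCompactSupport h.hasCompactSupport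

lemma memLp_grad (h : IsTestFunction Ω θ) : MemLp (grad θ) 2 (volume.restrict Ω) :=
  h.continuous_grad.memLp_of_hasCompactSupport h.hasCompactSupport_grad

/-- A test function as an element of `H¹₀`. -/
def toH10 (h : IsTestFunction Ω θ) : H10 Ω :=
  ⟨WithLp.toLp 2 (h.memLp.toLp θ, h.memLp_grad.toLp (grad θ)),
    Submodule.le_topologicalClosure _ ⟨θ, h, h.memLp.coeFn_toLp, h.memLp_grad.coeFn_toLp⟩⟩

lemma coeFn_toL2_toH10 (h : IsTestFunction Ω θ) : toL2 Ω h.toH10 =ᵐ[volume.restrict Ω] θ :=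
  h.memLp.coeFn_toLp

/-- Integration by parts of two test functions. -/
lemma integral_mul_fderiv (hθ : IsTestFunction Ω θ) (hχ : IsTestFunction Ω χ) (v : E3) :
    ∫ x in Ω, θ x * fderiv ℝ χ x v = - ∫ x in Ω, fderiv ℝ θ x v * χ x := by
  rw [setIntegral_eq_integral_of_forall_compl_eq_zero,
    setIntegral_eq_integral_of_forall_compl_eq_zero]
  · refine integral_mul_fderiv_eq_neg_fderiv_mul_of_integrable ?_ ?_ ?_
      (fun x _ => hθ.differentiable x) fun x _ => hχ.differentiable x
    · exact ((hθ.continuous_fderiv_apply v).mul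
        hχ.contDiff.continuous).integrable_of_hasCompactSupport (hχ.hasCompactSupport.mul_left)
    · exact (hθ.contDiff.continuous.mul
        (hχ.continuous_fderiv_apply v)).integrable_of_hasCompactSupport
        hθ.hasCompactSupport.mul_right
    · exact (hθ.contDiff.continuous.mul hχ.contDiff.continuous).integrable_of_hasCompactSupport
        (hθ.hasCompactSupport.mul_right)
  · intro x hx
    rw [hχ.eq_zero_of_notMem hx, mul_zero]
  · intro x hx
    rw [hθ.eq_zero_of_notMem hx, zero_mul]

end IsTestFunction

/-- The second component of an element of `H¹₀` is the weak gradient of the first one. -/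
lemma integral_gradL_mul {χ : E3 → ℂ} (hχ : IsTestFunction Ω χ) (u : H10 Ω) (j : Fin 3) :
    ∫ x in Ω, gradL Ω u x j * χ x
      = - ∫ x in Ω, toL2 Ω u x * fderiv ℝ χ x (EuclideanSpace.single j 1) := by
  have ha : MemLp (fun x => conj (fderiv ℝ χ x (EuclideanSpace.single j 1))) 2
      (volume.restrict Ω) :=
    (Complex.continuous_conj.comp (hχ.continuous_fderiv_apply _)).memLp_of_hasCompactSupport
      ((hχ.hasCompactSupport_fderiv_apply _).comp_left (map_zero (starRingEnd ℂ)))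
  have hA : MemLp (fun x => EuclideanSpace.single j (conj (χ x))) 2 (volume.restrict Ω) := by
    refine Continuous.memLp_of_hasCompactSupport ?_ ?_
    · refine (PiLp.continuous_toLp 2 _).comp ?_
      exact (continuous_single j).comp (Complex.continuous_conj.comp hχ.contDiff.continuous)
    · exact hχ.hasCompactSupport.comp_left (g := fun z => EuclideanSpace.single j (conj z))
        (by simp)
  -- The identity says that `u` is orthogonal to `z`, so that it passes to the closure of the test
  -- functions.
  set z : Pair Ω := WithLp.toLp 2 (ha.toLp _, hA.toLp _) with hz
  have hinner : ∀ w : Pair Ω, ⟪z, w⟫_ℂ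
      = (∫ x in Ω, w.fst x * fderiv ℝ χ x (EuclideanSpace.single j 1))
        + ∫ x in Ω, w.snd x j * χ x := fun w => by
    rw [WithLp.prod_inner_apply, L2.inner_def, L2.inner_def]
    congr 1
    · refine integral_congr_ae ?_
      filter_upwards [ha.coeFn_toLp] with x hx
      simp only [hz]
      rw [hx]
      simp
    · refine integral_congr_ae ?_
      filter_upwards [hA.coeFn_toLp] with x hx
      simp only [hz]
      rw [hx]
      simp [EuclideanSpace.inner_single_left, mul_comm]
  have horth : z ∈ (testGraph Ω)ᗮ := by
    rw [Submodule.mem_orthogonal']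
    rintro w ⟨θ, hθ, h1, h2⟩
    rw [hinner]
    have e1 : ∫ x in Ω, w.fst x * fderiv ℝ χ x (EuclideanSpace.single j 1)
        = ∫ x in Ω, θ x * fderiv ℝ χ x (EuclideanSpace.single j 1) :=
      integral_congr_ae (by filter_upwards [h1] with x hx; rw [hx])
    have e2 : ∫ x in Ω, w.snd x j * χ x
        = ∫ x in Ω, fderiv ℝ θ x (EuclideanSpace.single j 1) * χ x :=
      integral_congr_ae (by filter_upwards [h2] with x hx; rw [hx, grad])
    rw [e1, e2, hθ.integral_mul_fderiv hχ, neg_add_cancel]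
  have h3 : ⟪z, (u : Pair Ω)⟫_ℂ = 0 := by
    rw [← Submodule.orthogonal_closure] at horth
    exact Submodule.inner_left_of_mem_orthogonal u.2 horth
  rw [hinner] at h3
  exact eq_neg_of_add_eq_zero_right h3

lemma isTestFunction_ofReal {g : E3 → ℝ} (hg : ContDiff ℝ ∞ g) (hc : HasCompactSupport g)
    (hs : tsupport g ⊆ Ω) : IsTestFunction Ω fun x => (g x : ℂ) where
  contDiff := Complex.ofRealCLM.contDiff.comp hg
  hasCompactSupport := hc.comp_left (g := fun r : ℝ => (r : ℂ)) Complex.ofReal_zero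
  tsupport_subset := by
    refine (closure_mono fun x hx => ?_).trans hs
    simpa using hx

/-- The embedding `H¹₀ → L²` is injective because the gradient component of an element of `H¹₀` is
the weak gradient of the function component, so it vanishes with it. -/
lemma injective_toL2 (hΩ : IsOpen Ω) : Function.Injective (toL2 Ω) := by
  rw [injective_iff_map_eq_zero]
  intro u hu
  have hgrad : gradL Ω u = 0 := by
    have hj : ∀ j, ∀ᵐ x ∂volume.restrict Ω, x ∈ Ω → gradL Ω u x j = 0 := fun j => by
      have hmem : MemLp (fun x => gradL Ω u x j) 2 (volume.restrict Ω) :=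
        (Lp.memLp (gradL Ω u)).continuousLinearMap_comp
          (EuclideanSpace.proj j : EuclideanSpace ℂ (Fin 3) →L[ℂ] ℂ)
      refine hΩ.ae_eq_zero_of_integral_contDiff_smul_eq_zero
        ((hmem.locallyIntegrable one_le_two).locallyIntegrableOn _) fun g hg hc hs => ?_
      have h1 := integral_gradL_mul (isTestFunction_ofReal hg hc hs) u j
      have h2 : ∫ x in Ω, toL2 Ω u x
          * fderiv ℝ (fun x => (g x : ℂ)) x (EuclideanSpace.single j 1) = 0 := by
        rw [← integral_zero E3 ℂ (μ := volume.restrict Ω)]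
        refine integral_congr_ae ?_
        rw [hu]
        filter_upwards [Lp.coeFn_zero ℂ 2 (volume.restrict Ω)] with x hx
        rw [hx, Pi.zero_apply, zero_mul]
      rw [h2, neg_zero] at h1
      rw [← h1]
      refine integral_congr_ae (Eventually.of_forall fun x => ?_)
      simp [mul_comm]
    rw [Lp.eq_zero_iff_ae_eq_zero]
    filter_upwards [ae_all_iff.2 hj, ae_restrict_mem hΩ.measurableSet] with x hx hxΩ
    ext j
    exact hx j hxΩ
  have h := norm_sq_H10 u
  rw [hu, hgrad] at h
  simpa using h

/-- The test functions already have dense range in `L²`. -/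
lemma denseRange_toL2 (hΩ : IsOpen Ω) : DenseRange (toL2 Ω) := by
  have h : ((toL2 Ω).range : Submodule ℂ (L2 Ω)).topologicalClosure = ⊤ := by
    rw [Submodule.topologicalClosure_eq_top_iff, Submodule.eq_bot_iff]
    intro w hw
    rw [Lp.eq_zero_iff_ae_eq_zero]
    have hmem : LocallyIntegrableOn w Ω (volume.restrict Ω) :=
      ((Lp.memLp w).locallyIntegrable one_le_two).locallyIntegrableOn _
    have h1 := hΩ.ae_eq_zero_of_integral_contDiff_smul_eq_zero hmem fun g hg hc hs => by
      have h2 := (Submodule.mem_orthogonal _ _).1 hw _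
        (LinearMap.mem_range_self _ (isTestFunction_ofReal hg hc hs).toH10)
      rw [← h2]
      refine (integral_congr_ae ?_).trans (L2.inner_def _ _).symm
      filter_upwards [(isTestFunction_ofReal hg hc hs).coeFn_toL2_toH10] with x hx
      have hx' : (toL2 Ω (isTestFunction_ofReal hg hc hs).toH10) x = (g x : ℂ) := hx
      change _ = ⟪(toL2 Ω (isTestFunction_ofReal hg hc hs).toH10) x, w x⟫_ℂ
      rw [hx']
      simp [mul_comm]
    filter_upwards [h1, ae_restrict_mem hΩ.measurableSet] with x hx hxΩ
    exact hx hxΩ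
  have h2 := congrArg (fun s : Submodule ℂ (L2 Ω) => (s : Set (L2 Ω))) h
  simp only [Submodule.topologicalClosure_coe, Submodule.top_coe] at h2
  exact dense_iff_closure_eq.2 h2

/-! ### The Sobolev inequality -/

/-- The constant in the Sobolev inequality `‖u‖_{L⁶} ≤ C ‖∇u‖` in `ℝ³`. -/
def sobolevConst : ℝ≥0 := SNormLESNormFDerivOfEqConst ℂ (volume : Measure E3) 2

lemma norm_fderiv_le_norm_grad (θ : E3 → ℂ) (x : E3) : ‖fderiv ℝ θ x‖ ≤ ‖grad θ x‖ := by
  refine ContinuousLinearMap.opNorm_le_bound _ (norm_nonneg _) fun v => ?_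
  have h1 : fderiv ℝ θ x v = ∑ j, (v j : ℂ) * grad θ x j := by
    conv_lhs => rw [← (EuclideanSpace.basisFun (Fin 3) ℝ).sum_repr v]
    simp [grad]
  have h2 : ∑ j, (v j : ℂ) * grad θ x j
      = ⟪(WithLp.toLp 2 fun j => (v j : ℂ) : EuclideanSpace ℂ (Fin 3)), grad θ x⟫_ℂ := by
    simp [PiLp.inner_apply, mul_comm]
  rw [h1, h2]
  refine (norm_inner_le_norm _ _).trans (le_of_eq ?_)
  rw [mul_comm]
  congr 1
  simp [EuclideanSpace.norm_eq]

/-- The Gagliardo–Nirenberg–Sobolev inequality for a test function. The gradient norm bounds the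
operator norm of the real derivative, see `norm_fderiv_le_norm_grad`. -/
lemma IsTestFunction.eLpNorm_six_le {θ : E3 → ℂ} (h : IsTestFunction Ω θ) :
    eLpNorm θ 6 (volume.restrict Ω) ≤ sobolevConst * eLpNorm (grad θ) 2 (volume.restrict Ω) := by
  have h1 := eLpNorm_le_eLpNorm_fderiv_of_eq (volume : Measure E3) (p := 2) (p' := 6)
    h.contDiff_one h.hasCompactSupport one_le_two (by simp) (by simp; norm_num)
  have h2 : eLpNorm θ 6 (volume.restrict Ω) ≤ eLpNorm θ 6 volume :=
    eLpNorm_mono_measure _ Measure.restrict_le_self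
  have h3 : eLpNorm (fderiv ℝ θ) 2 volume ≤ eLpNorm (grad θ) 2 (volume.restrict Ω) := by
    rw [← eLpNorm_restrict_eq_of_support_subset (s := Ω) (f := fderiv ℝ θ)]
    · exact eLpNorm_mono fun x => norm_fderiv_le_norm_grad θ x
    · intro x hx
      by_contra hx'
      exact hx (h.fderiv_eq_zero_of_notMem hx')
  exact (h2.trans h1).trans (mul_le_mul_right h3 _)

/-- The Sobolev inequality on `H¹₀`, by approximation with test functions and lower semicontinuity
of the `L⁶` norm. The constant does not depend on the domain. -/
lemma eLpNorm_toL2_six_le (u : H10 Ω) :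
    eLpNorm (toL2 Ω u) 6 (volume.restrict Ω) ≤ sobolevConst * ENNReal.ofReal ‖u‖ := by
  obtain ⟨x, hx, hlim⟩ := mem_closure_iff_seq_limit.1
    (show (u : Pair Ω) ∈ closure (testGraph Ω : Set (Pair Ω)) from u.2)
  have hfst : Tendsto (fun n => (x n).fst) atTop (𝓝 (toL2 Ω u)) :=
    ((WithLp.fstL 2 ℂ (L2 Ω) (L2Vec Ω)).continuous.tendsto _).comp hlim
  have hbound : ∀ n, eLpNorm (x n).fst 6 (volume.restrict Ω)
      ≤ sobolevConst * ENNReal.ofReal ‖x n‖ := fun n => by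
    obtain ⟨θ, hθ, h1, h2⟩ := hx n
    rw [eLpNorm_congr_ae h1]
    refine hθ.eLpNorm_six_le.trans (mul_le_mul_right ?_ _)
    rw [← eLpNorm_congr_ae h2]
    refine le_trans (le_of_eq ?_) (ENNReal.ofReal_le_ofReal (show ‖(x n).snd‖ ≤ ‖x n‖ from
      WithLp.norm_snd_le _ _))
    rw [Lp.norm_def, ENNReal.ofReal_toReal (Lp.eLpNorm_ne_top _)]
  obtain ⟨ns, hns, hae⟩ := (tendstoInMeasure_of_tendsto_Lp hfst).exists_seq_tendsto_ae
  refine (Lp.eLpNorm_lim_le_liminf_eLpNorm (fun n => Lp.aestronglyMeasurable _) _ hae).trans ?_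
  have hn : Tendsto (fun n => (sobolevConst : ENNReal) * ENNReal.ofReal ‖x (ns n)‖) atTop
      (𝓝 (sobolevConst * ENNReal.ofReal ‖u‖)) := by
    refine ENNReal.Tendsto.const_mul ?_ (Or.inr ENNReal.coe_ne_top)
    exact ENNReal.tendsto_ofReal ((hlim.comp hns.tendsto_atTop).norm)
  rw [← hn.liminf_eq]
  exact liminf_le_liminf (Eventually.of_forall fun n => hbound (ns n))

end FunctionSpaces

noncomputable section CubicTerm

open ContinuousLinearMap Filter

/-! ### The cubic term as a map from `H¹₀` to `L²` -/

/-- The function `z ↦ |z|² z`. -/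
def cube (z : ℂ) : ℂ := ((‖z‖ ^ 2 : ℝ) : ℂ) * z

lemma norm_cube (z : ℂ) : ‖cube z‖ = ‖z‖ * ‖z‖ * ‖z‖ := by
  rw [cube, norm_mul, Complex.norm_real, Real.norm_of_nonneg (by positivity), sq]

lemma continuous_cube : Continuous cube := by unfold cube; fun_prop

lemma norm_cube_sub_le (x y : ℂ) :
    ‖cube x - cube y‖ ≤ 2 * ((‖x‖ + ‖y‖) * (‖x‖ + ‖y‖)) * ‖x - y‖ := by
  have h1 : cube x - cube y
      = ((‖x‖ ^ 2 : ℝ) : ℂ) * (x - y) + (((‖x‖ - ‖y‖) * (‖x‖ + ‖y‖) : ℝ) : ℂ) * y := by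
    rw [cube, cube]
    push_cast
    ring
  have h2 : ‖((‖x‖ ^ 2 : ℝ) : ℂ) * (x - y)‖ = ‖x‖ ^ 2 * ‖x - y‖ := by
    rw [norm_mul, Complex.norm_real, Real.norm_of_nonneg (by positivity)]
  have h3 : ‖(((‖x‖ - ‖y‖) * (‖x‖ + ‖y‖) : ℝ) : ℂ) * y‖ ≤ ‖x - y‖ * (‖x‖ + ‖y‖) * ‖y‖ := by
    rw [norm_mul, Complex.norm_real, Real.norm_eq_abs, abs_mul,
      abs_of_nonneg (show 0 ≤ ‖x‖ + ‖y‖ by positivity)]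
    gcongr
    exact abs_norm_sub_norm_le x y
  have h4 := norm_add_le (((‖x‖ ^ 2 : ℝ) : ℂ) * (x - y))
    ((((‖x‖ - ‖y‖) * (‖x‖ + ‖y‖) : ℝ) : ℂ) * y)
  rw [← h1] at h4
  have h5 : 0 ≤ (‖x‖ ^ 2 + 3 * (‖x‖ * ‖y‖) + ‖y‖ ^ 2) * ‖x - y‖ := by positivity
  linarith

lemma re_inner_cube (z : ℂ) : (⟪z, cube z⟫_ℂ).re = ‖z‖ ^ 4 := by
  have : ⟪z, cube z⟫_ℂ = ((‖z‖ ^ 4 : ℝ) : ℂ) := by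
    rw [RCLike.inner_apply, cube, mul_assoc, Complex.mul_conj']
    push_cast
    ring
  rw [this, Complex.ofReal_re]

/-- Convexity of `z ↦ ¼ |z|⁴`, whose gradient is `|z|² z`. -/
lemma re_inner_cube_sub_le (x y : ℂ) :
    (⟪cube y, x - y⟫_ℂ).re ≤ 1 / 4 * (⟪x, cube x⟫_ℂ).re - 1 / 4 * (⟪y, cube y⟫_ℂ).re := by
  have h1 : (⟪cube y, y⟫_ℂ).re = ‖y‖ ^ 4 := by
    rw [← inner_conj_symm, Complex.conj_re, re_inner_cube]
  have h2 : (⟪cube y, x⟫_ℂ).re ≤ ‖y‖ ^ 3 * ‖x‖ := by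
    refine (Complex.re_le_norm _).trans ((norm_inner_le_norm _ _).trans (le_of_eq ?_))
    rw [norm_cube]
    ring
  have h3 : ‖y‖ ^ 3 * ‖x‖ ≤ 1 / 4 * ‖x‖ ^ 4 + 3 / 4 * ‖y‖ ^ 4 := by
    -- Young's inequality with exponents `4` and `4 / 3`, from a factorization of the difference.
    have : 0 ≤ (‖x‖ - ‖y‖) ^ 2 * ((‖x‖ + ‖y‖) ^ 2 + 2 * ‖y‖ ^ 2) := by positivity
    linarith
  rw [inner_sub_right, Complex.sub_re, h1, re_inner_cube, re_inner_cube]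
  linarith

lemma sq_norm_le (z : ℂ) {ε : ℝ} (hε : 0 < ε) :
    ‖z‖ ^ 2 ≤ ε * (1 / 4 * (⟪z, cube z⟫_ℂ).re) + 1 / ε := by
  rw [re_inner_cube]
  -- The square is completed so that it produces `ε / 4 ‖z‖⁴`.
  have h1 : 0 ≤ (ε * ‖z‖ ^ 2 / 2 - 1) ^ 2 / ε := by positivity
  have h2 : (ε * ‖z‖ ^ 2 / 2 - 1) ^ 2 / ε = ε * (1 / 4 * ‖z‖ ^ 4) + 1 / ε - ‖z‖ ^ 2 := by
    field_simp
    ring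
  linarith

section Holder

variable {α : Type*} [MeasurableSpace α] {μ : Measure α}

instance : ENNReal.HolderTriple 6 6 3 where
  inv_add_inv_eq_inv := by
    rw [← ENNReal.toReal_eq_toReal_iff' (by simp) (by simp), ENNReal.toReal_add (by simp) (by simp)]
    norm_num [ENNReal.toReal_inv]

instance : ENNReal.HolderTriple 3 6 2 where
  inv_add_inv_eq_inv := by
    rw [← ENNReal.toReal_eq_toReal_iff' (by simp) (by simp), ENNReal.toReal_add (by simp) (by simp)]
    norm_num [ENNReal.toReal_inv]

/-- Hölder's inequality for a product of three functions in `L⁶`. -/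
lemma eLpNorm_mul_mul_le {f g k : α → ℝ} (hf : AEStronglyMeasurable f μ)
    (hg : AEStronglyMeasurable g μ) (hk : AEStronglyMeasurable k μ) :
    eLpNorm (fun x => f x * g x * k x) 2 μ
      ≤ eLpNorm f 6 μ * eLpNorm g 6 μ * eLpNorm k 6 μ := by
  refine (eLpNorm_smul_le_mul_eLpNorm (p := 3) (q := 6) hk (hf.mul hg)).trans ?_
  exact mul_le_mul_left (eLpNorm_smul_le_mul_eLpNorm (p := 6) (q := 6) hg hf) _

end Holder

variable {Ω : Set E3}

lemma memLp_cube (u : H10 Ω) : MemLp (fun x => cube (toL2 Ω u x)) 2 (volume.restrict Ω) := by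
  have hm := Lp.aestronglyMeasurable (toL2 Ω u)
  refine ⟨continuous_cube.comp_aestronglyMeasurable hm, ?_⟩
  have h6 : eLpNorm (fun x => ‖toL2 Ω u x‖) 6 (volume.restrict Ω) < ⊤ := by
    rw [eLpNorm_norm]
    exact (eLpNorm_toL2_six_le u).trans_lt
      (ENNReal.mul_lt_top ENNReal.coe_lt_top ENNReal.ofReal_lt_top)
  rw [← eLpNorm_norm]
  simp only [norm_cube]
  exact (eLpNorm_mul_mul_le hm.norm hm.norm hm.norm).trans_lt
    (ENNReal.mul_lt_top (ENNReal.mul_lt_top h6 h6) h6)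

/-- The map `u ↦ |u|² u` from `H¹₀` to `L²`. -/
def cubic (u : H10 Ω) : L2 Ω := (memLp_cube u).toLp _

lemma coeFn_cubic (u : H10 Ω) :
    cubic u =ᵐ[volume.restrict Ω] fun x => cube (toL2 Ω u x) := (memLp_cube u).coeFn_toLp

lemma cubicPairing_eq (u ψ : H10 Ω) : cubicPairing u ψ = ⟪toL2 Ω ψ, cubic u⟫_ℂ := by
  rw [L2.inner_def, cubicPairing]
  refine integral_congr_ae ?_
  filter_upwards [coeFn_cubic u] with x hx
  rw [hx, RCLike.inner_apply, cube]

/-- The potential `¼ ∫ |u|⁴` of the cubic term. -/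
def quartic (u : H10 Ω) : ℝ := 1 / 4 * (⟪toL2 Ω u, cubic u⟫_ℂ).re

lemma integrable_re_inner_L2 (f g : L2 Ω) :
    Integrable (fun x => (⟪f x, g x⟫_ℂ).re) (volume.restrict Ω) :=
  (L2.integrable_inner (𝕜 := ℂ) f g).re

lemma re_inner_L2 (f g : L2 Ω) :
    (⟪f, g⟫_ℂ).re = ∫ x in Ω, (⟪f x, g x⟫_ℂ).re := by
  rw [L2.inner_def]
  exact (integral_re (L2.integrable_inner (𝕜 := ℂ) f g)).symm

lemma norm_cubic_sub_le (u w : H10 Ω) :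
    ‖cubic u - cubic w‖ ≤ 2 * (sobolevConst : ℝ) ^ 3 * (‖u‖ + ‖w‖) ^ 2 * ‖u - w‖ := by
  set S := sobolevConst with hS
  have hu := Lp.aestronglyMeasurable (toL2 Ω u)
  have hw := Lp.aestronglyMeasurable (toL2 Ω w)
  have hs : AEStronglyMeasurable (fun x => ‖toL2 Ω u x‖ + ‖toL2 Ω w x‖) (volume.restrict Ω) :=
    hu.norm.add hw.norm
  have hd : AEStronglyMeasurable (fun x => ‖toL2 Ω (u - w) x‖) (volume.restrict Ω) :=
    (Lp.aestronglyMeasurable _).norm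
  have h1 : eLpNorm (cubic u - cubic w : L2 Ω) 2 (volume.restrict Ω)
      ≤ ENNReal.ofReal 2 * eLpNorm (fun x => (‖toL2 Ω u x‖ + ‖toL2 Ω w x‖)
        * (‖toL2 Ω u x‖ + ‖toL2 Ω w x‖) * ‖toL2 Ω (u - w) x‖) 2 (volume.restrict Ω) := by
    refine eLpNorm_le_mul_eLpNorm_of_ae_le_mul ?_ _
    filter_upwards [coeFn_cubic u, coeFn_cubic w, Lp.coeFn_sub (cubic u) (cubic w),
      Lp.coeFn_sub (toL2 Ω u) (toL2 Ω w)] with x h1 h2 h3 h4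
    rw [h3, Pi.sub_apply, h1, h2, map_sub, h4, Pi.sub_apply]
    refine (norm_cube_sub_le _ _).trans (le_of_eq ?_)
    rw [Real.norm_of_nonneg (by positivity)]
    ring
  have h6 : eLpNorm (fun x => ‖toL2 Ω u x‖ + ‖toL2 Ω w x‖) 6 (volume.restrict Ω)
      ≤ ENNReal.ofReal (S * (‖u‖ + ‖w‖)) := by
    refine (eLpNorm_add_le hu.norm hw.norm (by norm_num)).trans ?_
    rw [eLpNorm_norm, eLpNorm_norm, ENNReal.ofReal_mul S.coe_nonneg, ENNReal.ofReal_coe_nnreal,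
      ENNReal.ofReal_add (norm_nonneg _) (norm_nonneg _), mul_add]
    exact add_le_add (eLpNorm_toL2_six_le u) (eLpNorm_toL2_six_le w)
  have h7 : eLpNorm (fun x => ‖toL2 Ω (u - w) x‖) 6 (volume.restrict Ω)
      ≤ ENNReal.ofReal (S * ‖u - w‖) := by
    rw [eLpNorm_norm, ENNReal.ofReal_mul S.coe_nonneg, ENNReal.ofReal_coe_nnreal]
    exact eLpNorm_toL2_six_le _
  have h8 : eLpNorm (cubic u - cubic w : L2 Ω) 2 (volume.restrict Ω)
      ≤ ENNReal.ofReal (2 * (S : ℝ) ^ 3 * (‖u‖ + ‖w‖) ^ 2 * ‖u - w‖) := by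
    refine h1.trans ((mul_le_mul_right ((eLpNorm_mul_mul_le hs hs hd).trans
      (mul_le_mul' (mul_le_mul' h6 h6) h7)) _).trans (le_of_eq ?_))
    rw [← ENNReal.ofReal_mul (by positivity), ← ENNReal.ofReal_mul (by positivity),
      ← ENNReal.ofReal_mul (by positivity)]
    congr 1
    ring
  rw [Lp.norm_def]
  exact ENNReal.toReal_le_of_le_ofReal (by positivity) h8

/-- The cubic term satisfies the structural hypotheses of the abstract theory, with a constant that
does not depend on the domain. -/
lemma isCubic_cubic {V : ℝ} (hV : 0 ≤ V) (hvol : volume Ω ≤ ENNReal.ofReal V) :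
    IsCubic (toL2 Ω) cubic quartic (2 * (sobolevConst : ℝ) ^ 3) V where
  k_nonneg := by positivity
  V_nonneg := hV
  map_zero := by
    rw [Lp.eq_zero_iff_ae_eq_zero]
    filter_upwards [coeFn_cubic (0 : H10 Ω), Lp.coeFn_zero ℂ 2 (volume.restrict Ω)] with x h1 h2
    rw [h1, map_zero, h2]
    simp [cube]
  norm_sub_le := norm_cubic_sub_le
  euler u := by rw [quartic]; ring
  convex u w := by
    have hi := integrable_re_inner_L2 (Ω := Ω)
    rw [quartic, quartic, re_inner_L2, re_inner_L2, re_inner_L2, ← integral_const_mul,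
      ← integral_const_mul, ← integral_sub ((hi _ _).const_mul _) ((hi _ _).const_mul _)]
    refine integral_mono_ae (hi _ _) (((hi _ _).const_mul _).sub ((hi _ _).const_mul _)) ?_
    filter_upwards [coeFn_cubic u, coeFn_cubic w, Lp.coeFn_sub (toL2 Ω u) (toL2 Ω w)]
      with x h1 h2 h3
    simp only [h1, h2, h3, Pi.sub_apply]
    exact re_inner_cube_sub_le _ _
  norm_sq_le u ε hε := by
    have hi := integrable_re_inner_L2 (Ω := Ω)
    have hfin : volume Ω ≠ ⊤ := (hvol.trans_lt ENNReal.ofReal_lt_top).ne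
    have hc : Integrable (fun _ : E3 => 1 / ε) (volume.restrict Ω) :=
      integrableOn_const hfin
    have h1 : ∫ _ in Ω, (1 / ε) ≤ V / ε := by
      rw [setIntegral_const, smul_eq_mul, mul_one_div]
      exact div_le_div_of_nonneg_right (ENNReal.toReal_le_of_le_ofReal hV hvol) hε.le
    rw [← re_inner_self, re_inner_L2, quartic, re_inner_L2, ← integral_const_mul,
      ← integral_const_mul]
    refine le_trans ?_ (add_le_add_right h1 _)
    rw [← integral_add (((hi _ _).const_mul _).const_mul _) hc]
    refine integral_mono_ae (hi _ _) ((((hi _ _).const_mul _).const_mul _).add hc) ?_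
    filter_upwards [coeFn_cubic u] with x hx
    simp only [hx]
    rw [re_inner_self]
    exact sq_norm_le _ hε

end CubicTerm

noncomputable section WeakForm

open ContinuousLinearMap Filter

/-! ### Weak solutions and the integrated form of the system -/

section TestFunctions

variable {H : Type*} [NormedAddCommGroup H] [InnerProductSpace ℂ H]

/-- Integration by parts in time against `ξ(t) ψ`. -/
lemma integral_test_of_hasDerivAt {Y Z : ℝ → H} (hY : ∀ t, HasDerivAt Y (Z t) t)
    (hZ : Continuous Z) {T : ℝ} (ψ : H) {ξ : ℝ → ℂ} (hξ : ContDiff ℝ 1 ξ) (hξT : ξ T = 0) :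
    ∫ t in (0 : ℝ)..T, (⟪deriv ξ t • ψ, Y t⟫_ℂ + ⟪ξ t • ψ, Z t⟫_ℂ) = -⟪ξ 0 • ψ, Y 0⟫_ℂ := by
  have hYc : Continuous Y := continuous_iff_continuousAt.2 fun t => (hY t).continuousAt
  have hξ' : Continuous (deriv ξ) := hξ.continuous_deriv le_rfl
  have hd : ∀ t ∈ uIcc 0 T, HasDerivAt (fun t => ⟪ξ t • ψ, Y t⟫_ℂ)
      (⟪deriv ξ t • ψ, Y t⟫_ℂ + ⟪ξ t • ψ, Z t⟫_ℂ) t := fun t _ => by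
    have h1 : HasDerivAt (fun t => ξ t • ψ) (deriv ξ t • ψ) t :=
      ((hξ.differentiable one_ne_zero) t).hasDerivAt.smul_const ψ
    exact (h1.inner ℂ (hY t)).congr_deriv (add_comm _ _)
  have hξc := hξ.continuous
  rw [intervalIntegral.integral_eq_sub_of_hasDerivAt hd
    (Continuous.intervalIntegrable (by fun_prop) _ _), hξT, zero_smul, inner_zero_left, zero_sub]

/-- An equation tested with all `ξ(t) ψ`, `ξ(T) = 0`, is the integrated equation. The test function
`ξ` that shows it is the primitive of the defect, paired with `ψ`. -/
lemma integral_test_iff [CompleteSpace H] {X Z : ℝ → H} (hX : Continuous X) (hZ : Continuous Z)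
    {T : ℝ} (hT : 0 < T) (X₀ : H) :
    (∀ (ψ : H) (ξ : ℝ → ℂ), ContDiff ℝ 1 ξ → ξ T = 0 →
      ∫ t in (0 : ℝ)..T, (⟪deriv ξ t • ψ, X t⟫_ℂ + ⟪ξ t • ψ, Z t⟫_ℂ) = -⟪ξ 0 • ψ, X₀⟫_ℂ) ↔
    ∀ t ∈ Icc 0 T, X t = X₀ + ∫ s in (0 : ℝ)..t, Z s := by
  set Y : ℝ → H := fun t => X₀ + ∫ s in (0 : ℝ)..t, Z s with hYdef
  have hY : ∀ t, HasDerivAt Y (Z t) t := fun t =>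
    (intervalIntegral.integral_hasDerivAt_right (hZ.intervalIntegrable _ _)
      hZ.stronglyMeasurable.stronglyMeasurableAtFilter hZ.continuousAt).const_add X₀
  have hYc : Continuous Y := continuous_iff_continuousAt.2 fun t => (hY t).continuousAt
  have hY0 : Y 0 = X₀ := by simp [hYdef]
  constructor
  · intro h
    -- Each component `ζ` of the defect vanishes: test with its primitive `ξ`, which has `ξ T = 0`.
    suffices hzero : ∀ ψ : H, ∀ t ∈ Icc 0 T, ⟪ψ, X t - Y t⟫_ℂ = 0 by
      intro t ht
      exact sub_eq_zero.1 (inner_self_eq_zero.1 (hzero (X t - Y t) t ht))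
    intro ψ
    set ζ : ℝ → ℂ := fun t => ⟪ψ, X t - Y t⟫_ℂ with hζ
    have hζc : Continuous ζ := by fun_prop
    set ξ : ℝ → ℂ := fun t => ∫ s in T..t, ζ s with hξdef
    have hξd : ∀ t, HasDerivAt ξ (ζ t) t := fun t =>
      intervalIntegral.integral_hasDerivAt_right (hζc.intervalIntegrable _ _)
        hζc.stronglyMeasurable.stronglyMeasurableAtFilter hζc.continuousAt
    have hξderiv : deriv ξ = ζ := funext fun t => (hξd t).deriv
    have hξ : ContDiff ℝ 1 ξ :=
      contDiff_one_iff_deriv.2 ⟨fun t => (hξd t).differentiableAt, hξderiv ▸ hζc⟩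
    have hξT : ξ T = 0 := by simp [hξdef]
    have hξc := hξ.continuous
    have h1 := h ψ ξ hξ hξT
    have h2 := integral_test_of_hasDerivAt hY hZ ψ hξ hξT
    rw [hY0, ← h1, hξderiv, ← sub_eq_zero, ← intervalIntegral.integral_sub
      (Continuous.intervalIntegrable (by fun_prop) _ _)
      (Continuous.intervalIntegrable (by fun_prop) _ _)] at h2
    have h3 : ∀ t, ⟪ζ t • ψ, Y t⟫_ℂ + ⟪ξ t • ψ, Z t⟫_ℂ - (⟪ζ t • ψ, X t⟫_ℂ + ⟪ξ t • ψ, Z t⟫_ℂ)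
        = ((-‖ζ t‖ ^ 2 : ℝ) : ℂ) := fun t => by
      rw [add_sub_add_right_eq_sub, ← inner_sub_right, ← neg_sub, inner_neg_right,
        inner_smul_left]
      change -(conj (ζ t) * ζ t) = _
      rw [Complex.conj_mul']
      push_cast
      ring
    simp_rw [h3] at h2
    rw [intervalIntegral.integral_ofReal, Complex.ofReal_eq_zero, intervalIntegral.integral_neg,
      neg_eq_zero] at h2
    intro t ht
    by_contra hne
    have : 0 < ∫ s in (0 : ℝ)..T, ‖ζ s‖ ^ 2 :=
      intervalIntegral.integral_pos hT (hζc.norm.pow 2).continuousOn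
        (fun s _ => sq_nonneg _) ⟨t, ht, pow_pos (norm_pos_iff.2 hne) 2⟩
    exact this.ne' h2
  · intro h ψ ξ hξ hξT
    rw [← hY0, ← integral_test_of_hasDerivAt hY hZ ψ hξ hξT]
    refine intervalIntegral.integral_congr fun t ht => ?_
    rw [uIcc_of_le hT.le] at ht
    simp only [h t ht, hYdef]

end TestFunctions

section Abstract

variable {H L : Type*} [NormedAddCommGroup H] [InnerProductSpace ℂ H]
  [NormedAddCommGroup L] [InnerProductSpace ℂ L] [CompleteSpace H] [CompleteSpace L]
  {p : Coeffs} {J : H →L[ℂ] L} {N : H → L} {T : ℝ} {f h v₀ φ₀ : H} {v φ : ℝ → H}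

/-- The integrand of the first weak equation, in terms of the right-hand side of the integrated
equation. -/
lemma integrand_v_eq (hp : p.Admissible) (f u w ψ : H) (z z' : ℂ) :
    -p.d * ⟪J (z' • ψ), J u⟫_ℂ - Complex.I * (p.a - 1 / p.U) * ⟪J (z • ψ), J u⟫_ℂ
        - Complex.I * p.g / p.U * ⟪J (z • ψ), J w⟫_ℂ
        + Complex.I * p.c / (4 * p.m) * (⟪z • ψ, u⟫_ℂ - ⟪J (z • ψ), J u⟫_ℂ)
        + Complex.I * p.b * ⟪J (z • ψ), N u⟫_ℂ
      = -p.d * (⟪z' • ψ, gram J u⟫_ℂ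
        + ⟪z • ψ, adjoint J (p.forceV J N f u w) - p.thetaV • u⟫_ℂ) + ⟪J (z • ψ), J f⟫_ℂ := by
  have hd := hp.d_ne_zero
  rw [inner_gram, inner_sub_right, adjoint_inner_right, Coeffs.forceV]
  simp only [inner_sub_right, inner_add_right, inner_smul_right]
  generalize ⟪J (z' • ψ), J u⟫_ℂ = x₁
  generalize ⟪J (z • ψ), J u⟫_ℂ = x₂
  generalize ⟪J (z • ψ), J w⟫_ℂ = x₃
  generalize ⟪J (z • ψ), N u⟫_ℂ = x₄
  generalize ⟪J (z • ψ), J f⟫_ℂ = x₅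
  generalize ⟪z • ψ, u⟫_ℂ = x₆
  rw [Coeffs.thetaV, Coeffs.kappa, Coeffs.mass, Coeffs.coupling]
  push_cast
  have key : ∀ A B x : ℂ, -p.d * (p.d⁻¹ * A - B / p.d * x) = B * x - A := fun A B x => by
    field_simp
    ring
  rw [mul_add, key]
  ring

/-- The integrand of the second weak equation, in terms of the right-hand side of the integrated
equation. -/
lemma integrand_phi_eq (h u w ψ : H) (z z' : ℂ) :
    -⟪J (z' • ψ), J w⟫_ℂ - Complex.I * p.g / p.U * ⟪J (z • ψ), J u⟫_ℂ
        + Complex.I * (p.g ^ 2 / p.U + 2 * p.ν - 2 * p.μ) * ⟪J (z • ψ), J w⟫_ℂ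
        + Complex.I / (4 * p.m) * (⟪z • ψ, w⟫_ℂ - ⟪J (z • ψ), J w⟫_ℂ)
        + p.γ * ⟪J (z • ψ), J w⟫_ℂ
      = -1 * (⟪z' • ψ, gram J w⟫_ℂ
        + ⟪z • ψ, adjoint J (J (p.forcePhi h u w)) - p.thetaPhi • w⟫_ℂ)
        + ⟪J (z • ψ), J h⟫_ℂ := by
  rw [inner_gram, inner_sub_right, adjoint_inner_right, Coeffs.forcePhi]
  simp only [map_add, map_smul, inner_add_right, inner_smul_right (𝕜 := ℂ) (E := L),
    inner_smul_right (𝕜 := ℂ) (E := H) (z • ψ) w]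
  rw [Coeffs.selfPhi, Coeffs.thetaPhi, Coeffs.freq, Coeffs.coupling]
  push_cast
  ring

/-- The first equation of the system in weak form. -/
def TestedV (p : Coeffs) (J : H →L[ℂ] L) (N : H → L) (f : H) (T : ℝ) (v₀ : H) (v φ : ℝ → H) :
    Prop :=
  ∀ (ψ : H) (ξ : ℝ → ℂ), ContDiff ℝ 1 ξ → ξ T = 0 →
    ∫ t in (0 : ℝ)..T, (-p.d * ⟪J (deriv ξ t • ψ), J (v t)⟫_ℂ
        - Complex.I * (p.a - 1 / p.U) * ⟪J (ξ t • ψ), J (v t)⟫_ℂ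
        - Complex.I * p.g / p.U * ⟪J (ξ t • ψ), J (φ t)⟫_ℂ
        + Complex.I * p.c / (4 * p.m) * (⟪ξ t • ψ, v t⟫_ℂ - ⟪J (ξ t • ψ), J (v t)⟫_ℂ)
        + Complex.I * p.b * ⟪J (ξ t • ψ), N (v t)⟫_ℂ)
      = (∫ t in (0 : ℝ)..T, ⟪J (ξ t • ψ), J f⟫_ℂ) + p.d * ⟪J (ξ 0 • ψ), J v₀⟫_ℂ

/-- The second equation of the system in weak form. -/
def TestedPhi (p : Coeffs) (J : H →L[ℂ] L) (h : H) (T : ℝ) (φ₀ : H) (v φ : ℝ → H) : Prop :=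
  ∀ (ψ : H) (ξ : ℝ → ℂ), ContDiff ℝ 1 ξ → ξ T = 0 →
    ∫ t in (0 : ℝ)..T, (-⟪J (deriv ξ t • ψ), J (φ t)⟫_ℂ
        - Complex.I * p.g / p.U * ⟪J (ξ t • ψ), J (v t)⟫_ℂ
        + Complex.I * (p.g ^ 2 / p.U + 2 * p.ν - 2 * p.μ) * ⟪J (ξ t • ψ), J (φ t)⟫_ℂ
        + Complex.I / (4 * p.m) * (⟪ξ t • ψ, φ t⟫_ℂ - ⟪J (ξ t • ψ), J (φ t)⟫_ℂ)
        + p.γ * ⟪J (ξ t • ψ), J (φ t)⟫_ℂ)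
      = (∫ t in (0 : ℝ)..T, ⟪J (ξ t • ψ), J h⟫_ℂ) + ⟪J (ξ 0 • ψ), J φ₀⟫_ℂ

/-- The passage from the tested to the integrated equation, common to both equations: `δ` is the
coefficient of the time derivative. -/
lemma integral_eq_iff {δ : ℂ} (hδ : δ ≠ 0) (hT : 0 < T) {X Z : ℝ → H} (hX : Continuous X)
    (hZ : Continuous Z) (f x₀ : H) :
    (∀ (ψ : H) (ξ : ℝ → ℂ), ContDiff ℝ 1 ξ → ξ T = 0 →
      ∫ t in (0 : ℝ)..T, (-δ * (⟪deriv ξ t • ψ, gram J (X t)⟫_ℂ + ⟪ξ t • ψ, Z t⟫_ℂ)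
        + ⟪J (ξ t • ψ), J f⟫_ℂ)
      = (∫ t in (0 : ℝ)..T, ⟪J (ξ t • ψ), J f⟫_ℂ) + δ * ⟪J (ξ 0 • ψ), J x₀⟫_ℂ) ↔
    ∀ t ∈ Icc 0 T, gram J (X t) = gram J x₀ + ∫ s in (0 : ℝ)..t, Z s := by
  have hBX : Continuous fun t => gram J (X t) := (gram J).continuous.comp hX
  rw [← integral_test_iff hBX hZ hT]
  refine forall_congr' fun ψ => forall_congr' fun ξ => imp_congr_right fun hξ =>
    imp_congr_right fun _ => ?_
  have hξc := hξ.continuous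
  have hξ' : Continuous (deriv ξ) := hξ.continuous_deriv le_rfl
  rw [intervalIntegral.integral_add (Continuous.intervalIntegrable (by fun_prop) _ _)
    (Continuous.intervalIntegrable (by fun_prop) _ _), intervalIntegral.integral_const_mul,
    inner_gram, add_comm, add_left_cancel_iff, neg_mul, neg_eq_iff_eq_neg, ← mul_neg,
    mul_right_inj' hδ]

lemma injective_gram (hJ : Function.Injective J) : Function.Injective (gram J) := by
  rw [injective_iff_map_eq_zero]
  intro x hx
  have h1 := inner_gram J x x
  rw [hx, inner_zero_right] at h1
  exact (injective_iff_map_eq_zero J).1 hJ x (inner_self_eq_zero.1 h1.symm)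

lemma SolvesLinear.iff_of_injective {θ : ℂ} {F : ℝ → L} {y : ℝ → H} {x : H}
    (hJ : Function.Injective J) (hT : 0 < T) (hy : Continuous y) :
    (∀ t ∈ Icc 0 T, gram J (y t) = gram J x + ∫ s in (0 : ℝ)..t, (adjoint J (F s) - θ • y s)) ↔
      SolvesLinear J θ T F y ∧ y 0 = x := by
  constructor
  · intro h1
    have h0 : y 0 = x := injective_gram hJ (by simpa using h1 0 ⟨le_rfl, hT.le⟩)
    exact ⟨⟨hy, fun t ht => h0.symm ▸ h1 t ht⟩, h0⟩
  · rintro ⟨h1, rfl⟩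
    exact h1.eq

/-- The weak form of the system is equivalent to the integrated one. -/
lemma tested_iff_isMildSolution (hp : p.Admissible) (hJ : Function.Injective J) (hT : 0 < T)
    (hN : Continuous N) (hv : Continuous v) (hφ : Continuous φ) :
    TestedV p J N f T v₀ v φ ∧ TestedPhi p J h T φ₀ v φ ↔
      IsMildSolution p J N f h T v φ ∧ v 0 = v₀ ∧ φ 0 = φ₀ := by
  have hFv := continuous_forceV (p := p) (J := J) hN f hv hφ
  have hFφ := J.continuous.comp (continuous_forcePhi (p := p) h hv hφ)
  have hZv : Continuous fun t => adjoint J (p.forceV J N f (v t) (φ t)) - p.thetaV • v t := by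
    fun_prop
  have hZφ : Continuous fun t =>
      adjoint J (J (p.forcePhi h (v t) (φ t))) - p.thetaPhi • φ t :=
    ((adjoint J).continuous.comp hFφ).sub (continuous_const.smul hφ)
  have h1 : TestedV p J N f T v₀ v φ ↔ SolvesLinear J p.thetaV T
      (fun t => p.forceV J N f (v t) (φ t)) v ∧ v 0 = v₀ := by
    rw [← SolvesLinear.iff_of_injective hJ hT hv, ← integral_eq_iff hp.d_ne_zero hT hv hZv f v₀]
    simp only [TestedV, integrand_v_eq hp f]
  have h2 : TestedPhi p J h T φ₀ v φ ↔ SolvesLinear J p.thetaPhi T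
      (fun t => J (p.forcePhi h (v t) (φ t))) φ ∧ φ 0 = φ₀ := by
    rw [← SolvesLinear.iff_of_injective hJ hT hφ, ← integral_eq_iff one_ne_zero hT hφ hZφ h φ₀]
    simp only [TestedPhi, integrand_phi_eq h, one_mul]
  rw [h1, h2]
  constructor
  · rintro ⟨⟨a, b⟩, c, d⟩
    exact ⟨⟨a, c⟩, b, d⟩
  · rintro ⟨⟨a, c⟩, b, d⟩
    exact ⟨⟨a, b⟩, c, d⟩

/-- The second component of a solution is continuously differentiable with values in the dual
space. -/
lemma IsMildSolution.exists_hasL2TimeDeriv_dual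
    (hs : IsMildSolution p J N f h T v φ) :
    ∃ w : ℝ → H →L⋆[ℂ] ℂ, HasL2TimeDeriv T (fun t => innerSLFlip ℂ (gram J (φ t))) w := by
  have hv := hs.solves_v.continuous
  have hφ := hs.solves_φ.continuous
  have hZφ : Continuous fun t =>
      adjoint J (J (p.forcePhi h (v t) (φ t))) - p.thetaPhi • φ t :=
    ((adjoint J).continuous.comp (J.continuous.comp (continuous_forcePhi (p := p) h hv hφ))).sub
      (continuous_const.smul hφ)
  refine ⟨fun t => innerSLFlip ℂ (adjoint J (J (p.forcePhi h (v t) (φ t))) - p.thetaPhi • φ t),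
    HasL2TimeDeriv.of_hasDerivWithinAt ((innerSLFlip ℂ (E := H)).continuous.comp hZφ)
      fun t ht => ?_⟩
  have h1 : HasDerivAt (fun t => gram J (φ 0) + ∫ s in (0 : ℝ)..t,
      (adjoint J (J (p.forcePhi h (v s) (φ s))) - p.thetaPhi • φ s))
      (adjoint J (J (p.forcePhi h (v t) (φ t))) - p.thetaPhi • φ t) t :=
    (intervalIntegral.integral_hasDerivAt_right (hZφ.intervalIntegrable _ _)
      hZφ.stronglyMeasurable.stronglyMeasurableAtFilter hZφ.continuousAt).const_add _
  have h2 := (((innerSLFlip ℂ (E := H)).restrictScalars ℝ).hasFDerivAt.comp_hasDerivAt t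
    h1).hasDerivWithinAt (s := Icc 0 T)
  refine h2.congr_of_mem (fun s hs' => ?_) ht
  rw [hs.solves_φ.eq s hs']
  rfl

end Abstract

end WeakForm

noncomputable section Main

open ContinuousLinearMap Filter

/-! ### Weak solutions in `H¹₀` -/

variable {Ω : Set E3} {p : Coeffs} {f h v₀ φ₀ : H10 Ω} {T : ℝ} {v φ : ℝ → H10 Ω}

lemma gradPairing_eq (u ψ : H10 Ω) :
    gradPairing u ψ = ⟪ψ, u⟫_ℂ - ⟪toL2 Ω ψ, toL2 Ω u⟫_ℂ := by
  rw [inner_H10, add_sub_cancel_left, gradPairing]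

lemma continuous_cubic : Continuous (cubic : H10 Ω → L2 Ω) := by
  refine continuous_iff_continuousAt.2 fun x => ?_
  rw [ContinuousAt, tendsto_iff_norm_sub_tendsto_zero]
  refine squeeze_zero (fun _ => norm_nonneg _) (fun y => norm_cubic_sub_le y x) ?_
  have : Continuous fun y : H10 Ω =>
      2 * (sobolevConst : ℝ) ^ 3 * (‖y‖ + ‖x‖) ^ 2 * ‖y - x‖ := by fun_prop
  simpa using this.tendsto x

/-- A weak solution, extended to the real line by constants, solves the integrated system. -/
lemma IsWeakSolution.isMildSolution (hp : p.Admissible) (hΩ : IsOpen Ω) (hT : 0 < T)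
    (hs : IsWeakSolution p f h T v₀ φ₀ v φ) :
    IsMildSolution p (toL2 Ω) cubic f h T (fun t => v (clamp T t)) (fun t => φ (clamp T t)) ∧
      v 0 = v₀ ∧ φ 0 = φ₀ := by
  have h0 : clamp T 0 = 0 := clamp_of_mem ⟨le_rfl, hT.le⟩
  have key := (tested_iff_isMildSolution (N := cubic) (f := f) (h := h) (v₀ := v₀) (φ₀ := φ₀) hp
    (injective_toL2 hΩ) hT continuous_cubic
    (continuous_comp_clamp hT.le hs.continuousOn_v)
    (continuous_comp_clamp hT.le hs.continuousOn_φ)).1 ⟨fun ψ ξ hξ hξT => ?_, fun ψ ξ hξ hξT => ?_⟩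
  · simpa only [h0] using key
  · refine Eq.trans ?_ (hs.eq_v ψ ξ hξ hξT)
    refine intervalIntegral.integral_congr fun t ht => ?_
    rw [uIcc_of_le hT.le] at ht
    simp only [clamp_of_mem ht, pairing, gradPairing_eq, cubicPairing_eq]
  · refine Eq.trans ?_ (hs.eq_φ ψ ξ hξ hξT)
    refine intervalIntegral.integral_congr fun t ht => ?_
    rw [uIcc_of_le hT.le] at ht
    simp only [clamp_of_mem ht, pairing, gradPairing_eq]

/-- The embedding of `H¹₀` into its dual through `L²` is the Gram operator followed by the Riesz
map. -/
lemma toHNeg1_eq (u : H10 Ω) : toHNeg1 Ω u = innerSLFlip ℂ (gram (toL2 Ω) u) := by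
  ext ψ
  exact (inner_gram (toL2 Ω) ψ u).symm

lemma IsMildSolution.isWeakSolution (hp : p.Admissible) (hΩ : IsOpen Ω) (hT : 0 < T)
    (hs : IsMildSolution p (toL2 Ω) cubic f h T v φ) (hv0 : v 0 = v₀) (hφ0 : φ 0 = φ₀) :
    IsWeakSolution p f h T v₀ φ₀ v φ := by
  have hv := hs.solves_v.continuous
  have hφ := hs.solves_φ.continuous
  obtain ⟨h1, h2⟩ := (tested_iff_isMildSolution hp (injective_toL2 hΩ) hT continuous_cubic
    hv hφ).2 ⟨hs, hv0, hφ0⟩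
  refine ⟨hv.continuousOn, hφ.continuousOn, hs.solves_v.exists_hasL2TimeDeriv (injective_toL2 hΩ)
    (denseRange_toL2 hΩ) hT.le hp.thetaV_inv_re_pos (continuous_forceV continuous_cubic f hv hφ),
    ?_, fun ψ ξ hξ hξT => ?_, fun ψ ξ hξ hξT => ?_⟩
  · obtain ⟨w, hw⟩ := hs.exists_hasL2TimeDeriv_dual
    exact ⟨w, hw.congr_left fun t _ => (toHNeg1_eq (φ t)).symm⟩
  · simp only [gradPairing_eq, cubicPairing_eq]
    exact h1 ψ ξ hξ hξT
  · simp only [gradPairing_eq]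
    exact h2 ψ ξ hξ hξT

/-- The factor in the continuous dependence estimate. -/
def Coeffs.dependenceConst (p : Coeffs) : ℝ := 1 + 1 / (p.thetaV⁻¹).re

lemma le_dependenceConst_mul {r x y z : ℝ} (hr : 0 < r) (hx : 0 ≤ x) (hy : 0 ≤ y)
    (h : x + r * y ≤ z) : x + y ≤ (1 + 1 / r) * z := by
  have h1 : x + y ≤ (1 + 1 / r) * (x + r * y) := by
    have h2 : (1 + 1 / r) * (x + r * y) = x + y + (r * y + x / r) := by
      field_simp
      ring
    rw [h2]
    have : 0 ≤ r * y + x / r := by positivity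
    linarith
  exact h1.trans (mul_le_mul_of_nonneg_left h (by positivity))

lemma IsWeakSolution.dependence (hp : p.Admissible) (hΩ : IsOpen Ω) {V K R : ℝ} (hV : 0 ≤ V)
    (hvol : volume Ω ≤ ENNReal.ofReal V) (hf : ‖f‖ ≤ K) (hh : ‖h‖ ≤ K)
    {v₀₁ φ₀₁ v₀₂ φ₀₂ : H10 Ω} (hv₁ : ‖v₀₁‖ ≤ R) (hφ₁ : ‖φ₀₁‖ ≤ R) (hv₂ : ‖v₀₂‖ ≤ R)
    (hφ₂ : ‖φ₀₂‖ ≤ R) (hT : 0 < T) {v₁ φ₁ v₂ φ₂ : ℝ → H10 Ω}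
    (h₁ : IsWeakSolution p f h T v₀₁ φ₀₁ v₁ φ₁) (h₂ : IsWeakSolution p f h T v₀₂ φ₀₂ v₂ φ₂)
    {w₁ w₂ : ℝ → L2 Ω} (hw₁ : HasL2TimeDeriv T (fun t => toL2 Ω (v₁ t)) w₁)
    (hw₂ : HasL2TimeDeriv T (fun t => toL2 Ω (v₂ t)) w₂) {t : ℝ} (ht : t ∈ Icc 0 T) :
    ‖v₁ t - v₂ t‖ ^ 2 + ‖φ₁ t - φ₂ t‖ ^ 2 + ∫ s in (0 : ℝ)..t, ‖w₁ s - w₂ s‖ ^ 2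
      ≤ p.dependenceConst
        * Real.exp (p.dependenceRate (2 * (sobolevConst : ℝ) ^ 3) V K R * t)
        * (‖v₀₁ - v₀₂‖ ^ 2 + ‖φ₀₁ - φ₀₂‖ ^ 2) := by
  obtain ⟨hm₁, hv0₁, hφ0₁⟩ := h₁.isMildSolution hp hΩ hT
  obtain ⟨hm₂, hv0₂, hφ0₂⟩ := h₂.isMildSolution hp hΩ hT
  have h0 : clamp T 0 = 0 := clamp_of_mem ⟨le_rfl, hT.le⟩
  have hw : HasL2TimeDeriv T (fun t => toL2 Ω (v₁ (clamp T t) - v₂ (clamp T t)))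
      (fun t => w₁ t - w₂ t) := by
    refine (HasL2TimeDeriv.sub ((toL2 Ω).continuous.comp_continuousOn h₁.continuousOn_v)
      ((toL2 Ω).continuous.comp_continuousOn h₂.continuousOn_v) hw₁ hw₂).congr_left fun t ht => ?_
    simp only [Function.comp_apply, clamp_of_mem ht, map_sub]
  have key := hm₁.dependence hp (isCubic_cubic hV hvol) (injective_toL2 hΩ) (denseRange_toL2 hΩ)
    norm_toL2_le hm₂ (R := R) hf hh (by simpa only [h0, hv0₁] using hv₁)
    (by simpa only [h0, hφ0₁] using hφ₁) (by simpa only [h0, hv0₂] using hv₂)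
    (by simpa only [h0, hφ0₂] using hφ₂) hw ht
  simp only [h0, clamp_of_mem ht, hv0₁, hv0₂, hφ0₁, hφ0₂] at key
  refine (le_dependenceConst_mul hp.thetaV_inv_re_pos (by positivity)
    (intervalIntegral.integral_nonneg ht.1 fun s _ => by positivity) key).trans (le_of_eq ?_)
  rw [Coeffs.dependenceConst]
  ring

lemma IsWeakSolution.unique (hp : p.Admissible) (hΩ : IsOpen Ω) (hfin : volume Ω ≠ ⊤)
    (hT : 0 < T) {v₁ φ₁ v₂ φ₂ : ℝ → H10 Ω} (h₁ : IsWeakSolution p f h T v₀ φ₀ v₁ φ₁)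
    (h₂ : IsWeakSolution p f h T v₀ φ₀ v₂ φ₂) {t : ℝ} (ht : t ∈ Icc 0 T) :
    v₁ t = v₂ t ∧ φ₁ t = φ₂ t := by
  obtain ⟨hm₁, hv0₁, hφ0₁⟩ := h₁.isMildSolution hp hΩ hT
  obtain ⟨hm₂, hv0₂, hφ0₂⟩ := h₂.isMildSolution hp hΩ hT
  have h0 : clamp T 0 = 0 := clamp_of_mem ⟨le_rfl, hT.le⟩
  have hvol : volume Ω ≤ ENNReal.ofReal (volume Ω).toReal := (ENNReal.ofReal_toReal hfin).ge
  have key := hm₁.unique hp (isCubic_cubic ENNReal.toReal_nonneg hvol) (injective_toL2 hΩ)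
    (denseRange_toL2 hΩ) norm_toL2_le hm₂ (by simp only [h0, hv0₁, hv0₂])
    (by simp only [h0, hφ0₁, hφ0₂]) ht
  simpa only [clamp_of_mem ht] using key

end Main

end BCSBEC

theorem theorem2p2 (p : BCSBEC.Coeffs) (hp : p.Admissible) :
    -- Lipschitz dependence on the data; the constants depend only on the coefficients and on
    -- bounds for the volume of the domain, the norms of the forces and of the data.
    (∀ M K R : ℝ, ∃ L₁ L₂ : ℝ, 0 < L₁ ∧ 0 < L₂ ∧
      ∀ Ω : Set BCSBEC.E3, BCSBEC.IsSmoothBoundedDomain Ω → volume Ω ≤ ENNReal.ofReal M →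
      ∀ f h : BCSBEC.H10 Ω, ‖f‖ ≤ K → ‖h‖ ≤ K →
      ∀ v₀₁ φ₀₁ v₀₂ φ₀₂ : BCSBEC.H10 Ω, ‖v₀₁‖ ≤ R → ‖φ₀₁‖ ≤ R → ‖v₀₂‖ ≤ R → ‖φ₀₂‖ ≤ R →
      ∀ T : ℝ, 0 < T → ∀ v₁ φ₁ v₂ φ₂ : ℝ → BCSBEC.H10 Ω,
        BCSBEC.IsWeakSolution p f h T v₀₁ φ₀₁ v₁ φ₁ →
        BCSBEC.IsWeakSolution p f h T v₀₂ φ₀₂ v₂ φ₂ →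
      ∀ w₁ w₂ : ℝ → BCSBEC.L2 Ω,
        BCSBEC.HasL2TimeDeriv T (fun t => BCSBEC.toL2 Ω (v₁ t)) w₁ →
        BCSBEC.HasL2TimeDeriv T (fun t => BCSBEC.toL2 Ω (v₂ t)) w₂ →
      ∀ t ∈ Icc 0 T,
        ‖v₁ t - v₂ t‖ ^ 2 + ‖φ₁ t - φ₂ t‖ ^ 2 + ∫ s in (0 : ℝ)..t, ‖w₁ s - w₂ s‖ ^ 2
          ≤ L₁ * Real.exp (L₂ * t) * (‖v₀₁ - v₀₂‖ ^ 2 + ‖φ₀₁ - φ₀₂‖ ^ 2))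
    ∧
    ∀ Ω : Set BCSBEC.E3, BCSBEC.IsSmoothBoundedDomain Ω → ∀ f h : BCSBEC.H10 Ω,
      -- uniqueness of the weak solution
      (∀ (v₀ φ₀ : BCSBEC.H10 Ω) (T : ℝ), 0 < T → ∀ v₁ φ₁ v₂ φ₂ : ℝ → BCSBEC.H10 Ω,
        BCSBEC.IsWeakSolution p f h T v₀ φ₀ v₁ φ₁ →
        BCSBEC.IsWeakSolution p f h T v₀ φ₀ v₂ φ₂ →
        ∀ t ∈ Icc 0 T, v₁ t = v₂ t ∧ φ₁ t = φ₂ t)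
      ∧
      -- the solutions are the trajectories of a strongly continuous semigroup
      ∃ S : ℝ≥0 → BCSBEC.H10 Ω × BCSBEC.H10 Ω → BCSBEC.H10 Ω × BCSBEC.H10 Ω,
        BCSBEC.IsStronglyContinuousSemigroup S ∧
        ∀ (v₀ φ₀ : BCSBEC.H10 Ω) (T : ℝ), 0 < T →
          BCSBEC.IsWeakSolution p f h T v₀ φ₀
            (fun t => (S t.toNNReal (v₀, φ₀)).1) (fun t => (S t.toNNReal (v₀, φ₀)).2) := by
  refine ⟨fun M K R => ?_, fun Ω hΩ f h => ⟨?_, ?_⟩⟩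
  · -- `M` may be negative, while the bound for the volume in `isCubic_cubic` is nonnegative.
    refine ⟨p.dependenceConst,
      p.dependenceRate (2 * (BCSBEC.sobolevConst : ℝ) ^ 3) (max M 0) K R, ?_,
      hp.growthRate_pos _, ?_⟩
    · have := hp.thetaV_inv_re_pos
      unfold BCSBEC.Coeffs.dependenceConst
      positivity
    · intro Ω hΩ hvol f h hf hh v₀₁ φ₀₁ v₀₂ φ₀₂ hv₁ hφ₁ hv₂ hφ₂ T hT v₁ φ₁ v₂ φ₂ h₁ h₂ w₁ w₂ hw₁ hw₂
        t ht
      exact h₁.dependence hp hΩ.isOpen (le_max_right _ _)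
        (hvol.trans (ENNReal.ofReal_le_ofReal (le_max_left _ _))) hf hh hv₁ hφ₁ hv₂ hφ₂ hT h₂ hw₁
        hw₂ ht
  · intro v₀ φ₀ T hT v₁ φ₁ v₂ φ₂ h₁ h₂ t ht
    exact h₁.unique hp hΩ.isOpen hΩ.isBounded.measure_lt_top.ne hT h₂ ht
  · obtain ⟨S, hS, hsol⟩ := BCSBEC.exists_semigroup hp
      (BCSBEC.isCubic_cubic ENNReal.toReal_nonneg
        (ENNReal.ofReal_toReal (hΩ.isBounded.measure_lt_top (μ := volume)).ne).ge)
      (BCSBEC.injective_toL2 hΩ.isOpen) (BCSBEC.denseRange_toL2 hΩ.isOpen) BCSBEC.norm_toL2_le f h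
    refine ⟨S, hS, fun v₀ φ₀ T hT => (hsol (v₀, φ₀) T).isWeakSolution hp hΩ.isOpen hT ?_ ?_⟩
    · simp only [Real.toNNReal_zero, hS.map_zero]
    · simp only [Real.toNNReal_zero, hS.map_zero]
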